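/- Let $p$ be a prime, $e\ge 1$ and $q=p^e$. **The algebras.** For a commutative ring $K$ and an integer $n$, consider the associative unital $K$-algebra on generators $P^r$, $r\ge 0$, subject to $P^0=1$ and the Adem relations $$P^aP^b=\sum_{j=0}^{\lfloor a/n\rfloor}(-1)^{a+j}\binom{(n-1)(b-j)-1}{a-nj}P^{a+b-j}P^j\qquad (a<nb).$$ The algebra $\mathcal A_q$ of Steenrod $q$th powers is this algebra for $K=\mathbb F_q$, $n=q$. It is graded by giving $P^r$ degree $r$. Let $\mathcal A_p^*=\mathbb F_p[\xi_1,\xi_2,\dots]$ be the Hopf algebra with coproduct $\xi_k\mapsto\sum_{i=0}^k\xi_{k-i}^{p^i}\otimes\xi_i$ (where $\xi_0=1$) and counit $\xi_k\mapsto 0$ for $k\ge1$. Let $\mathcal A_p$ be its graded dual Hopf algebra, and let $P(R)$, for finite sequences $R=(r_1,r_2,\dots)$ of integers $\ge0$, be the Milnor basis of $\mathcal A_p$, dual to the monomials $\xi^R=\xi_1^{r_1}\xi_2^{r_2}\cdots$. Let $\mathcal A'_q\subset\mathcal A_p$ be the span of the $P(R)$ with $r_j=0$ whenever $e\nmid j$;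 it is a Hopf subalgebra of $\mathcal A_p$. Write $P_e^r=P(0,\dots,0,r)\in\mathcal A'_q$, with $r$ in position $e$. **Proposition.** (0) The algebra given by the above presentation with $K=\mathbb F_p$, $n=p$ is isomorphic to $\mathcal A_p$ by $P^r\mapsto P(r)$. (1) The formula $P^r\mapsto\sum_{i+j=r}P^i\otimes P^j$ defines a coproduct making $\mathcal A_q$ a Hopf algebra over $\mathbb F_q$, and there is an isomorphism of Hopf algebras over $\mathbb F_q$ $$\rho:\mathcal A_q\to\mathcal A'_q\otimes_{\mathbb F_p}\mathbb F_q,\qquad \rho(P^r)=P_e^r\otimes 1\quad(r\ge 0).$$ (2) The elements $P^{p^j}$, $j\ge 0$, form a minimal generating set for $\mathcal A_q$ as an algebra over $\mathbb F_q$. (3) The homogeneous parts $\mathcal A_q^d$, $d\ge0$, make $\mathcal A_q$ a graded algebra and are finite-dimensional, and the Poincaré series of $\mathcal A_q$ is $$\sum_{d\ge 0}\dim_{\mathbb F_q}(\mathcal A_q^d)\,\tau^d=\prod_{j\ge 1}\frac{1}{1-\tau^{(q^j-1)/(q-1)}}.$$ -/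

import Mathlib

open scoped TensorProduct

noncomputable section

namespace Steenrod

/-- A Hopf algebra structure on a given algebra `A` over a field `K`. -/
structure HopfStructure (K A : Type*) [Field K] [Ring A] [Algebra K A] where
  comul : A →ₐ[K] A ⊗[K] A
  counit : A →ₐ[K] K
  antipode : A →ₗ[K] A
  coassoc : (Algebra.TensorProduct.assoc K K K A A A).toAlgHom.comp
    ((Algebra.TensorProduct.map comul (.id K A)).comp comul) =
      (Algebra.TensorProduct.map (.id K A) comul).comp comul
  counit_left : (Algebra.TensorProduct.map counit (.id K A)).comp comul =
    (Algebra.TensorProduct.lid K A).symm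
  counit_right : (Algebra.TensorProduct.map (.id K A) counit).comp comul =
    (Algebra.TensorProduct.rid K K A).symm
  antipode_left : LinearMap.mul' K A ∘ₗ antipode.rTensor A ∘ₗ comul.toLinearMap =
    Algebra.linearMap K A ∘ₗ counit.toLinearMap
  antipode_right : LinearMap.mul' K A ∘ₗ antipode.lTensor A ∘ₗ comul.toLinearMap =
    Algebra.linearMap K A ∘ₗ counit.toLinearMap

/-- The corresponding instance of Mathlib's class `HopfAlgebra`, over the given algebra structure. -/
abbrev HopfStructure.toHopfAlgebra {K A : Type*} [Field K] [Ring A] [Algebra K A]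
    (H : HopfStructure K A) : HopfAlgebra K A :=
  letI : Bialgebra K A :=
    Bialgebra.ofAlgHom H.comul H.counit H.coassoc H.counit_left H.counit_right
  { antipode := H.antipode
    mul_antipode_rTensor_comul := H.antipode_left
    mul_antipode_lTensor_comul := H.antipode_right }

/-- A Hopf subalgebra: a subalgebra stable under the coproduct and the antipode. -/
structure IsHopfSubalgebra {K A : Type*} [Field K] [Ring A] [HopfAlgebra K A]
    (S : Subalgebra K A) : Prop where
  comul_mem : ∀ x ∈ S, Coalgebra.comul (R := K) x ∈
    (Algebra.TensorProduct.map S.val S.val).range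
  antipode_mem : ∀ x ∈ S, HopfAlgebra.antipode K x ∈ S

namespace IsHopfSubalgebra

variable {K A : Type*} [Field K] [Ring A] [HopfAlgebra K A] {S : Subalgebra K A}

theorem map_val_injective (S : Subalgebra K A) :
    Function.Injective (Algebra.TensorProduct.map S.val S.val) :=
  TensorProduct.map_injective_of_flat_flat S.val.toLinearMap S.val.toLinearMap
    Subtype.val_injective Subtype.val_injective

theorem map_val_injective₃ (S : Subalgebra K A) :
    Function.Injective
      (Algebra.TensorProduct.map S.val (Algebra.TensorProduct.map S.val S.val)) :=
  TensorProduct.map_injective_of_flat_flat S.val.toLinearMap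
    (Algebra.TensorProduct.map S.val S.val).toLinearMap
    Subtype.val_injective (map_val_injective S)

/-- The restriction of the coproduct to a Hopf subalgebra. -/
def comul (hS : IsHopfSubalgebra S) : S →ₐ[K] S ⊗[K] S :=
  (AlgEquiv.ofInjective _ (map_val_injective S)).symm.toAlgHom.comp
    (((Bialgebra.comulAlgHom K A).comp S.val).codRestrict
      (Algebra.TensorProduct.map S.val S.val).range fun x => hS.comul_mem x x.2)

theorem map_comul (hS : IsHopfSubalgebra S) (x : S) :
    Algebra.TensorProduct.map S.val S.val (hS.comul x) = Coalgebra.comul (R := K) (x : A) := by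
  have h := AlgEquiv.apply_symm_apply (AlgEquiv.ofInjective _ (map_val_injective S))
    ((((Bialgebra.comulAlgHom K A).comp S.val).codRestrict
      (Algebra.TensorProduct.map S.val S.val).range fun x => hS.comul_mem x x.2) x)
  exact congrArg Subtype.val h

/-- A Hopf subalgebra is a Hopf algebra. -/
def hopfStructure (hS : IsHopfSubalgebra S) : HopfStructure K S where
  comul := hS.comul
  counit := (Bialgebra.counitAlgHom K A).comp S.val
  antipode := ((HopfAlgebra.antipode K).comp S.val.toLinearMap).codRestrict
    (Subalgebra.toSubmodule S) fun x => hS.antipode_mem x x.2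
  coassoc := by
    apply AlgHom.ext; intro x
    apply map_val_injective₃ S
    have h1 : ∀ t : S ⊗[K] S, Algebra.TensorProduct.map S.val (Algebra.TensorProduct.map S.val S.val)
        ((Algebra.TensorProduct.assoc K K K S S S)
          (Algebra.TensorProduct.map hS.comul (.id K S) t)) =
        (TensorProduct.assoc K A A A) ((Coalgebra.comul (R := K)).rTensor A
          (Algebra.TensorProduct.map S.val S.val t)) := by
      intro t
      induction t with
      | zero => simp
      | add x y hx hy => simp only [map_add, hx, hy]
      | tmul a b =>
        simp only [Algebra.TensorProduct.map_tmul, AlgHom.id_apply, LinearMap.rTensor_tmul]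
        change _ = (TensorProduct.assoc K A A A) (Coalgebra.comul (R := K) (a : A) ⊗ₜ (b : A))
        rw [← hS.map_comul]
        induction hS.comul a with
        | zero => simp
        | add x y hx hy => simp only [TensorProduct.add_tmul, map_add, hx, hy]
        | tmul c d => rfl
    have h2 : ∀ t : S ⊗[K] S, Algebra.TensorProduct.map S.val (Algebra.TensorProduct.map S.val S.val)
          (Algebra.TensorProduct.map (.id K S) hS.comul t) =
        ((Coalgebra.comul (R := K)).lTensor A (Algebra.TensorProduct.map S.val S.val t)) := by
      intro t
      induction t with
      | zero => simp
      | add x y hx hy => simp only [map_add, hx, hy]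
      | tmul a b =>
        simp only [Algebra.TensorProduct.map_tmul, AlgHom.id_apply, LinearMap.lTensor_tmul]
        rw [hS.map_comul]; rfl
    refine (h1 (hS.comul x)).trans (Eq.trans ?_ (h2 (hS.comul x)).symm)
    rw [hS.map_comul]
    exact Coalgebra.coassoc_apply (R := K) (x : A)
  counit_left := by
    apply AlgHom.ext; intro x
    apply (Algebra.TensorProduct.lid K S).injective
    apply Subtype.val_injective
    have h : ∀ t : S ⊗[K] S, ((Algebra.TensorProduct.lid K S (Algebra.TensorProduct.map
        ((Bialgebra.counitAlgHom K A).comp S.val) (.id K S) t) : S) : A) =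
        TensorProduct.lid K A ((Coalgebra.counit (R := K)).rTensor A
          (Algebra.TensorProduct.map S.val S.val t)) := by
      intro t
      induction t with
      | zero => simp
      | add x y hx hy => simp only [map_add, Subalgebra.coe_add, hx, hy]
      | tmul a b => rfl
    refine (h (hS.comul x)).trans ?_
    rw [hS.map_comul, Coalgebra.rTensor_counit_comul]
    simp
  counit_right := by
    apply AlgHom.ext; intro x
    apply (Algebra.TensorProduct.rid K K S).injective
    apply Subtype.val_injective
    have h : ∀ t : S ⊗[K] S, ((Algebra.TensorProduct.rid K K S (Algebra.TensorProduct.map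
        (.id K S) ((Bialgebra.counitAlgHom K A).comp S.val) t) : S) : A) =
        TensorProduct.rid K A ((Coalgebra.counit (R := K)).lTensor A
          (Algebra.TensorProduct.map S.val S.val t)) := by
      intro t
      induction t with
      | zero => simp
      | add x y hx hy => simp only [map_add, Subalgebra.coe_add, hx, hy]
      | tmul a b => rfl
    refine (h (hS.comul x)).trans ?_
    rw [hS.map_comul, Coalgebra.lTensor_counit_comul]
    simp
  antipode_left := by
    apply LinearMap.ext; intro x
    apply Subtype.val_injective
    have h : ∀ t : S ⊗[K] S, ((LinearMap.mul' K S ((((HopfAlgebra.antipode K).comp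
          S.val.toLinearMap).codRestrict (Subalgebra.toSubmodule S)
            fun x => hS.antipode_mem x x.2).rTensor S t) : S) : A) =
        LinearMap.mul' K A ((HopfAlgebra.antipode K).rTensor A
          (Algebra.TensorProduct.map S.val S.val t)) := by
      intro t
      induction t with
      | zero => simp
      | add x y hx hy => simp only [map_add, Subalgebra.coe_add, hx, hy]
      | tmul a b => rfl
    refine (h (hS.comul x)).trans ?_
    rw [hS.map_comul, HopfAlgebra.mul_antipode_rTensor_comul_apply]
    rfl
  antipode_right := by
    apply LinearMap.ext; intro x
    apply Subtype.val_injective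
    have h : ∀ t : S ⊗[K] S, ((LinearMap.mul' K S ((((HopfAlgebra.antipode K).comp
          S.val.toLinearMap).codRestrict (Subalgebra.toSubmodule S)
            fun x => hS.antipode_mem x x.2).lTensor S t) : S) : A) =
        LinearMap.mul' K A ((HopfAlgebra.antipode K).lTensor A
          (Algebra.TensorProduct.map S.val S.val t)) := by
      intro t
      induction t with
      | zero => simp
      | add x y hx hy => simp only [map_add, Subalgebra.coe_add, hx, hy]
      | tmul a b => rfl
    refine (h (hS.comul x)).trans ?_
    rw [hS.map_comul, HopfAlgebra.mul_antipode_lTensor_comul_apply]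
    rfl

end IsHopfSubalgebra

/-- The polynomial algebra `𝔽_p[ξ₁, ξ₂, …]` (the variable `X n` is `ξ_{n+1}`).  It is a type synonym
because it carries Milnor's coproduct, not the one Mathlib puts on `MvPolynomial`. -/
def MilnorDual (p : ℕ) : Type := MvPolynomial ℕ (ZMod p)

namespace MilnorDual

variable (p : ℕ)

instance : CommRing (MilnorDual p) := inferInstanceAs (CommRing (MvPolynomial ℕ (ZMod p)))

instance : Algebra (ZMod p) (MilnorDual p) :=
  inferInstanceAs (Algebra (ZMod p) (MvPolynomial ℕ (ZMod p)))

/-- The generators `ξ_k`, with the convention `ξ₀ = 1`. -/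
def xi : ℕ → MilnorDual p
  | 0 => 1
  | n + 1 => (MvPolynomial.X n : MvPolynomial ℕ (ZMod p))

/-- The monomial `ξ^R = ∏ ξ_{n+1} ^ R n`. -/
def mono (R : ℕ →₀ ℕ) : MilnorDual p := (MvPolynomial.monomial R 1 : MvPolynomial ℕ (ZMod p))

/-- The monomials form a basis. -/
def basis : Module.Basis (ℕ →₀ ℕ) (ZMod p) (MilnorDual p) :=
  MvPolynomial.basisMonomials ℕ (ZMod p)

variable {p}

@[simp] theorem xi_zero : xi p 0 = 1 := rfl

@[simp] theorem basis_apply (R : ℕ →₀ ℕ) : basis p R = mono p R := by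
  exact congrFun (MvPolynomial.coe_basisMonomials ℕ (ZMod p)) R

theorem mono_zero : mono p 0 = 1 := rfl

theorem mono_add (R S : ℕ →₀ ℕ) : mono p (R + S) = mono p R * mono p S := by
  have h := MvPolynomial.monomial_mul (R := ZMod p) (s := R) (s' := S) (a := 1) (b := 1)
  rw [one_mul] at h
  exact h.symm

theorem mono_single (n : ℕ) : mono p (Finsupp.single n 1) = xi p (n + 1) := rfl

/-- The algebra map with prescribed values on the generators `ξ_{n+1}`. -/
def lift {B : Type*} [CommRing B] [Algebra (ZMod p) B] (f : ℕ → B) :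
    MilnorDual p →ₐ[ZMod p] B :=
  (MvPolynomial.aeval f : MvPolynomial ℕ (ZMod p) →ₐ[ZMod p] B)

@[simp] theorem lift_xi {B : Type*} [CommRing B] [Algebra (ZMod p) B] (f : ℕ → B) (n : ℕ) :
    lift f (xi p (n + 1)) = f n :=
  MvPolynomial.aeval_X f n

theorem algHom_ext {B : Type*} [Semiring B] [Algebra (ZMod p) B]
    {f g : MilnorDual p →ₐ[ZMod p] B} (h : ∀ n, f (xi p (n + 1)) = g (xi p (n + 1))) : f = g :=
  @MvPolynomial.algHom_ext (ZMod p) ℕ _ B _ _ f g h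

/-- Raising to a power of `p` is additive in a commutative `𝔽_p`-algebra. -/
theorem sum_pow_char [Fact p.Prime] {B ι : Type*} [CommRing B] [Algebra (ZMod p) B]
    (s : Finset ι) (f : ι → B) (n : ℕ) : (∑ i ∈ s, f i) ^ p ^ n = ∑ i ∈ s, f i ^ p ^ n := by
  rcases subsingleton_or_nontrivial B with hB | hB
  · exact Subsingleton.elim _ _
  · have : CharP B p := charP_of_injective_algebraMap (algebraMap (ZMod p) B).injective p
    exact sum_pow_char_pow p n s f

variable (p)

/-- Milnor's coproduct `ξ_k ↦ ∑_{i ≤ k} ξ_{k-i}^{p^i} ⊗ ξ_i`. -/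
def comulHom : MilnorDual p →ₐ[ZMod p] MilnorDual p ⊗[ZMod p] MilnorDual p :=
  lift fun n => ∑ i ∈ Finset.range (n + 2), (xi p (n + 1 - i) ^ p ^ i) ⊗ₜ[ZMod p] xi p i

/-- The augmentation `ξ_k ↦ 0` for `k ≥ 1`. -/
def counitHom : MilnorDual p →ₐ[ZMod p] ZMod p := lift fun _ => 0

variable {p}

theorem comulHom_xi (k : ℕ) : comulHom p (xi p k) =
    ∑ i ∈ Finset.range (k + 1), (xi p (k - i) ^ p ^ i) ⊗ₜ[ZMod p] xi p i := by
  cases k with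
  | zero => simp [Algebra.TensorProduct.one_def]
  | succ n => simp [comulHom]

theorem counitHom_xi (k : ℕ) : counitHom p (xi p k) = if k = 0 then 1 else 0 := by
  cases k with
  | zero => simp
  | succ n => simp [counitHom]

variable [Fact p.Prime]

theorem counitHom_xi_pow (k i : ℕ) :
    counitHom p (xi p k) ^ p ^ i = if k = 0 then 1 else 0 := by
  rw [counitHom_xi]; split_ifs <;> simp

instance : Bialgebra (ZMod p) (MilnorDual p) :=
  Bialgebra.ofAlgHom (comulHom p) (counitHom p)
    (by
      refine algHom_ext fun n => ?_
      simp only [AlgHom.comp_apply, comulHom_xi, map_sum, Algebra.TensorProduct.map_tmul,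
        map_pow, sum_pow_char, AlgHom.id_apply]
      simp only [TensorProduct.sum_tmul,
        TensorProduct.tmul_sum, Algebra.TensorProduct.tmul_pow, ← pow_mul, ← pow_add, map_sum]
      rw [Finset.sum_sigma', Finset.sum_sigma']
      refine Finset.sum_bij' (fun x _ => ⟨x.1 + x.2, x.1⟩) (fun x _ => ⟨x.2, x.1 - x.2⟩) ?_ ?_ ?_ ?_ ?_
      · rintro ⟨i, j⟩ h; simp at h ⊢; omega
      · rintro ⟨i, j⟩ h; simp at h ⊢; omega
      · rintro ⟨i, j⟩ h; simp
      · rintro ⟨i, j⟩ h; simp at h ⊢; omega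
      · rintro ⟨i, j⟩ h
        simp only [Nat.add_sub_cancel_left, Nat.sub_sub, add_comm j i]
        rfl)
    (by
      refine algHom_ext fun n => ?_
      simp only [AlgHom.comp_apply, comulHom_xi, map_sum, Algebra.TensorProduct.map_tmul,
        map_pow, AlgHom.id_apply, counitHom_xi_pow]
      rw [Finset.sum_eq_single (n + 1)]
      · simp
      · intro i hi hne
        simp at hi
        have : n + 1 - i ≠ 0 := by omega
        simp [this]
      · simp)
    (by
      refine algHom_ext fun n => ?_
      simp only [AlgHom.comp_apply, comulHom_xi, map_sum, Algebra.TensorProduct.map_tmul,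
        AlgHom.id_apply, counitHom_xi]
      rw [Finset.sum_eq_single 0]
      · simp
      · intro i hi hne
        simp [hne]
      · simp)

theorem comul_xi (k : ℕ) : Coalgebra.comul (R := ZMod p) (xi p k) =
    ∑ i ∈ Finset.range (k + 1), (xi p (k - i) ^ p ^ i) ⊗ₜ[ZMod p] xi p i := comulHom_xi k

theorem counit_xi (k : ℕ) : Coalgebra.counit (R := ZMod p) (xi p k) = if k = 0 then 1 else 0 :=
  counitHom_xi k

variable (p) in
/-- The recursive solution of `∑_{i ≤ k} ξ_{k-i}^{p^i} χ(ξ_i) = 0`, `χ(ξ₀) = 1`. -/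
def chi : ℕ → MilnorDual p
  | 0 => 1
  | n + 1 => -∑ i : Fin (n + 1), xi p (n + 1 - i) ^ p ^ (i : ℕ) * chi i

variable (p) in
/-- The recursive solution of `∑_{i ≤ k} χ(ξ_{k-i})^{p^i} ξ_i = 0`, `χ(ξ₀) = 1`. -/
def chi' : ℕ → MilnorDual p
  | 0 => 1
  | n + 1 => -∑ i : Fin (n + 1), chi' (n - i) ^ p ^ (i + 1 : ℕ) * xi p (i + 1)

variable (p) in
def chiHom : MilnorDual p →ₐ[ZMod p] MilnorDual p := lift fun n => chi p (n + 1)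

variable (p) in
def chiHom' : MilnorDual p →ₐ[ZMod p] MilnorDual p := lift fun n => chi' p (n + 1)

theorem chiHom_xi (k : ℕ) : chiHom p (xi p k) = chi p k := by
  cases k with
  | zero => simp [chi]
  | succ n => simp [chiHom]

theorem chiHom'_xi (k : ℕ) : chiHom' p (xi p k) = chi' p k := by
  cases k with
  | zero => simp [chi']
  | succ n => simp [chiHom']

open WithConv in
theorem id_mul_chiHom :
    toConv (AlgHom.id (ZMod p) (MilnorDual p)) * toConv (chiHom p) = 1 := by
  apply WithConv.ext
  refine algHom_ext fun n => ?_
  have h1 : (1 : WithConv (MilnorDual p →ₐ[ZMod p] MilnorDual p)).ofConv (xi p (n + 1)) = 0 := by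
    refine (AlgHom.convOne_apply (R := ZMod p) (xi p (n + 1))).trans ?_
    simp [counit_xi]
  rw [h1]
  refine (AlgHom.convMul_apply (R := ZMod p) _ _ (xi p (n + 1))).trans ?_
  rw [comul_xi, Finset.sum_range_succ]
  simp [chiHom_xi, chi, Finset.sum_range]

open WithConv in
theorem chiHom'_mul_id :
    toConv (chiHom' p) * toConv (AlgHom.id (ZMod p) (MilnorDual p)) = 1 := by
  apply WithConv.ext
  refine algHom_ext fun n => ?_
  have h1 : (1 : WithConv (MilnorDual p →ₐ[ZMod p] MilnorDual p)).ofConv (xi p (n + 1)) = 0 := by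
    refine (AlgHom.convOne_apply (R := ZMod p) (xi p (n + 1))).trans ?_
    simp [counit_xi]
  rw [h1]
  refine (AlgHom.convMul_apply (R := ZMod p) _ _ (xi p (n + 1))).trans ?_
  rw [comul_xi, Finset.sum_range_succ']
  simp [chiHom'_xi, chi', Finset.sum_range]

open WithConv in
theorem chiHom_mul_id :
    toConv (chiHom p) * toConv (AlgHom.id (ZMod p) (MilnorDual p)) = 1 := by
  have h : toConv (chiHom' p) = toConv (chiHom p) := left_inv_eq_right_inv chiHom'_mul_id id_mul_chiHom
  rw [← h, chiHom'_mul_id]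


/-! ### A weight filtration, used to see that finitely supported functionals are closed under the
operations below -/

/-- The weight `∑ (n + 1) R n` of an exponent sequence. -/
def wt : (ℕ →₀ ℕ) →+ ℕ := Finsupp.weight fun n => n + 1

theorem wt_single (n r : ℕ) : wt (Finsupp.single n r) = r * (n + 1) := by
  simp [wt, Finsupp.weight_apply]

theorem le_wt (R : ℕ →₀ ℕ) (n : ℕ) : R n * (n + 1) ≤ wt R := by
  have h : R = Finsupp.single n (R n) + R.erase n := (Finsupp.single_add_erase n R).symm
  calc R n * (n + 1) = wt (Finsupp.single n (R n)) := (wt_single _ _).symm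
    _ ≤ wt (Finsupp.single n (R n)) + wt (R.erase n) := Nat.le_add_right _ _
    _ = wt R := by rw [← map_add, ← h]

theorem finite_wt_lt (N : ℕ) : {R : ℕ →₀ ℕ | wt R < N}.Finite := by
  refine (Set.finite_Iic (∑ n ∈ Finset.range N, Finsupp.single n N)).subset fun R hR n => ?_
  have h := le_wt R n
  have hR : wt R < N := hR
  by_cases hn : n < N
  · have : (∑ m ∈ Finset.range N, Finsupp.single m N) n = N := by
      simp [Finsupp.finsetSum_apply, Finsupp.single_apply, hn]
    rw [this]; nlinarith
  · have h0 : R n = 0 := by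
      by_contra h0
      have : 1 ≤ R n := Nat.one_le_iff_ne_zero.mpr h0
      nlinarith
    rw [h0]; exact Nat.zero_le _

variable (p) in
/-- The span of the monomials of weight at least `d`. -/
def fil (d : ℕ) : Submodule (ZMod p) (MilnorDual p) :=
  Submodule.span (ZMod p) (mono p '' {R | d ≤ wt R})

theorem mono_mem_fil {R : ℕ →₀ ℕ} {d : ℕ} (h : d ≤ wt R) : mono p R ∈ fil p d :=
  Submodule.subset_span ⟨R, h, rfl⟩

theorem fil_anti {d d' : ℕ} (h : d ≤ d') : fil p d' ≤ fil p d :=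
  Submodule.span_mono (Set.image_mono fun _ hR => le_trans h hR)

theorem mem_fil_zero (x : MilnorDual p) : x ∈ fil p 0 := by
  have h := (basis p).mem_span x
  refine Submodule.span_mono ?_ h
  rintro _ ⟨R, rfl⟩
  exact ⟨R, Nat.zero_le _, (basis_apply R).symm⟩

theorem mul_mem_fil {x y : MilnorDual p} {d d' : ℕ} (hx : x ∈ fil p d) (hy : y ∈ fil p d') :
    x * y ∈ fil p (d + d') := by
  have h := Submodule.mul_mem_mul hx hy
  rw [fil, fil, Submodule.span_mul_span] at h
  refine Submodule.span_le.mpr ?_ h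
  rintro _ ⟨_, ⟨R, hR, rfl⟩, _, ⟨S, hS, rfl⟩, rfl⟩
  change mono p R * mono p S ∈ fil p (d + d')
  rw [← mono_add]
  exact mono_mem_fil (by rw [map_add]; exact add_le_add hR hS)

theorem xi_mem_fil (k : ℕ) : xi p k ∈ fil p k := by
  cases k with
  | zero => exact mem_fil_zero _
  | succ n => rw [← mono_single]; exact mono_mem_fil (by rw [wt_single]; omega)

theorem pow_mem_fil {x : MilnorDual p} {d m : ℕ} (hx : x ∈ fil p d) (hm : 1 ≤ m) :
    x ^ m ∈ fil p d := by
  have h := mul_mem_fil hx (mem_fil_zero (x ^ (m - 1)))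
  rwa [← pow_succ', Nat.sub_add_cancel hm, add_zero] at h

theorem one_le_pow (i : ℕ) : 1 ≤ p ^ i := Nat.one_le_pow _ _ (Nat.Prime.pos Fact.out)

/-- An algebra map respects filtrations if it does so on the generators. -/
theorem map_mem_of_fil {B : Type*} [CommRing B] [Algebra (ZMod p) B]
    (G : ℕ → Submodule (ZMod p) B) (h1 : (1 : B) ∈ G 0) (hanti : ∀ {d d'}, d ≤ d' → G d' ≤ G d)
    (hmul : ∀ {x y d d'}, x ∈ G d → y ∈ G d' → x * y ∈ G (d + d'))
    (φ : MilnorDual p →ₐ[ZMod p] B) (hφ : ∀ n, φ (xi p (n + 1)) ∈ G (n + 1))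
    {x : MilnorDual p} {d : ℕ} (hx : x ∈ fil p d) : φ x ∈ G d := by
  have key : ∀ R, φ (mono p R) ∈ G (wt R) := by
    intro R
    induction R using Finsupp.induction_linear with
    | zero => rw [mono_zero, map_one, map_zero]; exact h1
    | add R S hR hS => rw [mono_add, map_mul, map_add]; exact hmul hR hS
    | single n r =>
      induction r with
      | zero => rw [Finsupp.single_zero, mono_zero, map_one, map_zero]; exact h1
      | succ r ih =>
        rw [Finsupp.single_add, mono_add, map_mul, map_add]
        refine hmul ih ?_
        rw [mono_single, wt_single, one_mul]
        exact hφ n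
  have : fil p d ≤ (G d).comap φ.toLinearMap := by
    refine Submodule.span_le.mpr ?_
    rintro _ ⟨R, hR, rfl⟩
    exact hanti hR (key R)
  exact this hx

variable (p) in
/-- The induced filtration on the tensor square. -/
def fil2 (d : ℕ) : Submodule (ZMod p) (MilnorDual p ⊗[ZMod p] MilnorDual p) :=
  Submodule.span (ZMod p) {t | ∃ i j x y, d ≤ i + j ∧ x ∈ fil p i ∧ y ∈ fil p j ∧ t = x ⊗ₜ y}

theorem tmul_mem_fil2 {x y : MilnorDual p} {d i j : ℕ} (h : d ≤ i + j) (hx : x ∈ fil p i)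
    (hy : y ∈ fil p j) : x ⊗ₜ[ZMod p] y ∈ fil2 p d :=
  Submodule.subset_span ⟨i, j, x, y, h, hx, hy, rfl⟩

theorem comul_mem_fil2 {x : MilnorDual p} {d : ℕ} (hx : x ∈ fil p d) :
    Coalgebra.comul (R := ZMod p) x ∈ fil2 p d := by
  refine map_mem_of_fil (fil2 p) ?_ ?_ ?_ (comulHom p) ?_ hx
  · exact tmul_mem_fil2 (Nat.zero_le _) (mem_fil_zero 1) (mem_fil_zero 1)
  · rintro d d' h
    refine Submodule.span_mono ?_
    rintro _ ⟨i, j, x, y, hd, r⟩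
    exact ⟨i, j, x, y, h.trans hd, r⟩
  · intro x y d d' hx hy
    have h := Submodule.mul_mem_mul hx hy
    rw [fil2, fil2, Submodule.span_mul_span] at h
    refine Submodule.span_le.mpr ?_ h
    rintro _ ⟨_, ⟨i, j, x, y, hd, hx, hy, rfl⟩, _, ⟨i', j', x', y', hd', hx', hy', rfl⟩, rfl⟩
    change (x ⊗ₜ[ZMod p] y) * (x' ⊗ₜ[ZMod p] y') ∈ fil2 p (d + d')
    rw [Algebra.TensorProduct.tmul_mul_tmul]
    exact tmul_mem_fil2 (by omega) (mul_mem_fil hx hx') (mul_mem_fil hy hy')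
  · intro n
    rw [comulHom_xi]
    refine Submodule.sum_mem _ fun i hi => ?_
    simp only [Finset.mem_range] at hi
    exact tmul_mem_fil2 (i := n + 1 - i) (j := i) (by omega)
      (pow_mem_fil (xi_mem_fil _) (one_le_pow i)) (xi_mem_fil i)

theorem chi_mem_fil (k : ℕ) : chi p k ∈ fil p k := by
  induction k using Nat.strong_induction_on with
  | _ k ih =>
    cases k with
    | zero => exact mem_fil_zero _
    | succ n =>
      rw [chi]
      refine Submodule.neg_mem _ (Submodule.sum_mem _ fun i _ => ?_)
      refine fil_anti (d' := (n + 1 - i) + i) (by omega) ?_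
      exact mul_mem_fil (pow_mem_fil (xi_mem_fil _) (one_le_pow _)) (ih i i.2)

theorem chiHom_mem_fil {x : MilnorDual p} {d : ℕ} (hx : x ∈ fil p d) : chiHom p x ∈ fil p d := by
  refine map_mem_of_fil (fil p) (mem_fil_zero 1) fil_anti mul_mem_fil (chiHom p) (fun n => ?_) hx
  rw [chiHom_xi]; exact chi_mem_fil _

/-- A functional has finite support on monomials iff it kills some step of the filtration. -/
theorem finite_support_iff (f : MilnorDual p →ₗ[ZMod p] ZMod p) :
    {R | f (mono p R) ≠ 0}.Finite ↔ ∃ N, ∀ x ∈ fil p N, f x = 0 := by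
  constructor
  · intro h
    obtain ⟨N, hN⟩ := (h.image wt).bddAbove
    refine ⟨N + 1, fun x hx => ?_⟩
    have : fil p (N + 1) ≤ LinearMap.ker f := by
      refine Submodule.span_le.mpr ?_
      rintro _ ⟨R, hR, rfl⟩
      by_contra h0
      have h1 : wt R ≤ N := hN ⟨R, h0, rfl⟩
      have h2 : N + 1 ≤ wt R := hR
      omega
    exact this hx
  · rintro ⟨N, hN⟩
    refine (finite_wt_lt N).subset fun R hR => ?_
    by_contra h
    exact hR (hN _ (mono_mem_fil (not_lt.mp h)))

end MilnorDual

open MilnorDual WithConv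

variable (p : ℕ) [Fact p.Prime]

/-- The convolution algebra of all linear functionals on `𝔽_p[ξ₁, ξ₂, …]`. -/
abbrev FullDual : Type := WithConv (MilnorDual p →ₗ[ZMod p] ZMod p)

/-- The graded dual of `𝔽_p[ξ₁, ξ₂, …]`: the functionals which are nonzero on finitely many monomials only (the homogeneous
parts being finite-dimensional, these are the functionals supported in finitely many degrees).  The
product is convolution, `(f g)(x) = ∑ f(x') g(x'')` with `Δ x = ∑ x' ⊗ x''`. -/
def restrictedDual : Subalgebra (ZMod p) (FullDual p) where
  carrier := {f | {R | f (mono p R) ≠ 0}.Finite}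
  mul_mem' := by
    intro f g hf hg
    obtain ⟨N, hN⟩ := (finite_support_iff f.ofConv).mp hf
    obtain ⟨M, hM⟩ := (finite_support_iff g.ofConv).mp hg
    refine (finite_support_iff (f * g).ofConv).mpr ⟨N + M, fun x hx => ?_⟩
    have : fil2 p (N + M) ≤
        LinearMap.ker (LinearMap.mul' (ZMod p) (ZMod p) ∘ₗ TensorProduct.map f.ofConv g.ofConv) := by
      refine Submodule.span_le.mpr ?_
      rintro _ ⟨i, j, x, y, hd, hx, hy, rfl⟩
      change LinearMap.mul' (ZMod p) (ZMod p) (TensorProduct.map f.ofConv g.ofConv (x ⊗ₜ y)) = 0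
      rw [TensorProduct.map_tmul, LinearMap.mul'_apply]
      rcases le_or_gt N i with h | h
      · rw [hN x (fil_anti h hx), zero_mul]
      · rw [hM y (fil_anti (by omega) hy), mul_zero]
    exact this (comul_mem_fil2 hx)
  add_mem' := by
    intro f g hf hg
    refine (hf.union hg).subset fun R hR => ?_
    by_contra h
    simp only [Set.mem_union, Set.mem_ofPred_eq, not_or, not_not] at h
    refine hR ?_
    change f (mono p R) + g (mono p R) = 0
    rw [h.1, h.2, add_zero]
  algebraMap_mem' := by
    intro c
    refine (finite_support_iff _).mpr ⟨1, fun x hx => ?_⟩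
    change c • Coalgebra.counit (R := ZMod p) x = 0
    have : fil p 1 ≤ LinearMap.ker (Coalgebra.counit (R := ZMod p) (A := MilnorDual p)) := by
      refine fun x hx => ?_
      refine map_mem_of_fil (fun d => if d = 0 then ⊤ else ⊥) (by simp) ?_ ?_ (counitHom p) ?_ hx
      · intro d d' h
        rcases Nat.eq_zero_or_pos d with h0 | h0
        · simp [h0]
        · have : d' ≠ 0 := by omega
          simp [this]
      · intro x y d d' hx hy
        rcases Nat.eq_zero_or_pos d with h0 | h0
        · rcases Nat.eq_zero_or_pos d' with h1 | h1
          · simp [h0, h1]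
          · have : d' ≠ 0 := by omega
            simp [this] at hy; simp [hy]
        · have : d ≠ 0 := by omega
          simp [this] at hx; simp [hx]
      · intro n; simp [counitHom_xi]
    rw [show Coalgebra.counit (R := ZMod p) x = 0 from this hx, smul_zero]

/-- The algebra `A_p` of Steenrod `p`th powers, in Milnor's description as the graded dual of the
Hopf algebra `𝔽_p[ξ₁, ξ₂, …]`. -/
def SteenrodAlgebra : Type := restrictedDual p

instance : Ring (SteenrodAlgebra p) := inferInstanceAs (Ring (restrictedDual p))

instance : Algebra (ZMod p) (SteenrodAlgebra p) :=
  inferInstanceAs (Algebra (ZMod p) (restrictedDual p))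

/-- The underlying functional of an element of `A_p`. -/
def toDual : SteenrodAlgebra p →ₗ[ZMod p] (MilnorDual p →ₗ[ZMod p] ZMod p) :=
  (WithConv.linearEquiv (ZMod p) (MilnorDual p →ₗ[ZMod p] ZMod p)).toLinearMap ∘ₗ
    (restrictedDual p).val.toLinearMap

/-- The coordinates of an element of `A_p` in the Milnor basis. -/
def milnorRepr : SteenrodAlgebra p ≃ₗ[ZMod p] ((ℕ →₀ ℕ) →₀ ZMod p) where
  toFun f := Finsupp.ofSupportFinite (fun R => f.1 (mono p R)) f.2
  map_add' f g := by ext R; rfl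
  map_smul' c f := by ext R; rfl
  invFun c := ⟨toConv ((basis p).constr (ZMod p) c), by
    refine c.hasFiniteSupport.subset fun R hR => ?_
    intro h
    apply hR
    change (basis p).constr (ZMod p) c (mono p R) = 0
    rw [← basis_apply, Module.Basis.constr_basis, h]⟩
  left_inv f := by
    apply Subtype.ext; apply WithConv.ext
    refine (basis p).ext fun R => ?_
    change (basis p).constr (ZMod p) _ (basis p R) = f.1 (basis p R)
    rw [Module.Basis.constr_basis, basis_apply]; rfl
  right_inv c := by
    ext R
    change (basis p).constr (ZMod p) c (mono p R) = c R
    rw [← basis_apply, Module.Basis.constr_basis]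

/-- The Milnor basis of `A_p`, dual to the basis of monomials. -/
def milnorBasis : Module.Basis (ℕ →₀ ℕ) (ZMod p) (SteenrodAlgebra p) :=
  Module.Basis.ofRepr (milnorRepr p)

/-- The Milnor basis element `P(R)`, the functional with `⟨P(R), ξ^S⟩ = 1` if `S = R` and `0`
otherwise. The entry `r_{n+1}` in position `n + 1` is `R n`. -/
def milnorP (R : ℕ →₀ ℕ) : SteenrodAlgebra p := milnorBasis p R

variable {p}

theorem milnorP_mono (R S : ℕ →₀ ℕ) :
    (milnorP p R).1 (mono p S) = if R = S then 1 else 0 := by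
  change (milnorRepr p ((milnorRepr p).symm (Finsupp.single R 1))) S = _
  rw [LinearEquiv.apply_symm_apply, Finsupp.single_apply]

theorem ext_mono {f g : SteenrodAlgebra p} (h : ∀ R, f.1 (mono p R) = g.1 (mono p R)) : f = g :=
  (milnorRepr p).injective (Finsupp.ext h)


/-! ### The Hopf algebra structure of `A_p` -/


variable (p)

/-- Evaluation of a tensor of functionals on a tensor. -/
def pair2 : SteenrodAlgebra p ⊗[ZMod p] SteenrodAlgebra p →ₗ[ZMod p]
    (MilnorDual p ⊗[ZMod p] MilnorDual p →ₗ[ZMod p] ZMod p ⊗[ZMod p] ZMod p) :=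
  TensorProduct.homTensorHomMap (RingHom.id (ZMod p)) (MilnorDual p) (MilnorDual p) (ZMod p) (ZMod p) ∘ₗ
    TensorProduct.map (toDual p) (toDual p)

variable {p}

theorem pair2_tmul (f g : SteenrodAlgebra p) :
    pair2 p (f ⊗ₜ g) = TensorProduct.map f.1.ofConv g.1.ofConv := rfl

theorem pair2_injective : Function.Injective (pair2 p) := by
  have key : ∀ (t : SteenrodAlgebra p ⊗[ZMod p] SteenrodAlgebra p) (R S : ℕ →₀ ℕ),
      ((milnorBasis p).tensorProduct (milnorBasis p)).repr t (R, S) =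
        TensorProduct.lid (ZMod p) (ZMod p) (pair2 p t (mono p R ⊗ₜ mono p S)) := by
    intro t R S
    induction t with
    | zero => simp
    | add x y hx hy => simp only [map_add, Finsupp.add_apply, hx, hy, LinearMap.add_apply]
    | tmul f g =>
      rw [Module.Basis.tensorProduct_repr_tmul_apply, pair2_tmul, TensorProduct.map_tmul,
        TensorProduct.lid_tmul, smul_eq_mul, smul_eq_mul, mul_comm]
      rfl
  intro s t h
  apply ((milnorBasis p).tensorProduct (milnorBasis p)).repr.injective
  ext ⟨R, S⟩
  rw [key, key, h]

theorem conv_add_mul {R X B : Type*} [CommRing R] [AddCommGroup X] [Module R X]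
    [CoalgebraStruct R X] [Ring B] [Algebra R B] (f g h : X →ₗ[R] B) :
    toConv (f + g) * toConv h = toConv f * toConv h + toConv g * toConv h :=
  add_mul (toConv f) (toConv g) (toConv h)

theorem conv_mul_add {R X B : Type*} [CommRing R] [AddCommGroup X] [Module R X]
    [CoalgebraStruct R X] [Ring B] [Algebra R B] (f g h : X →ₗ[R] B) :
    toConv h * toConv (f + g) = toConv h * toConv f + toConv h * toConv g :=
  mul_add (toConv h) (toConv f) (toConv g)

theorem pair2_mul (s t : SteenrodAlgebra p ⊗[ZMod p] SteenrodAlgebra p) :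
    toConv (pair2 p (s * t)) = toConv (pair2 p s) * toConv (pair2 p t) := by
  induction s with
  | zero => rw [zero_mul, map_zero]; exact (zero_mul (toConv (pair2 p t))).symm
  | add x y hx hy =>
    rw [add_mul, map_add, map_add]
    exact (congrArg₂ (· + ·) hx hy).trans (conv_add_mul _ _ _).symm
  | tmul a b =>
    induction t with
    | zero => rw [mul_zero, map_zero]; exact (mul_zero (toConv (pair2 p (a ⊗ₜ b)))).symm
    | add x y hx hy =>
      rw [mul_add, map_add, map_add]
      exact (congrArg₂ (· + ·) hx hy).trans (conv_mul_add _ _ _).symm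
    | tmul c d =>
      rw [Algebra.TensorProduct.tmul_mul_tmul, pair2_tmul, pair2_tmul, pair2_tmul]
      exact TensorProduct.map_convMul_map.symm

variable (p) in
/-- The coproduct of `A_p`, `P(R) ↦ ∑_{S + T = R} P(S) ⊗ P(T)`. -/
def comulLin : SteenrodAlgebra p →ₗ[ZMod p] SteenrodAlgebra p ⊗[ZMod p] SteenrodAlgebra p :=
  (milnorBasis p).constr (ZMod p) fun R =>
    ∑ x ∈ Finset.HasAntidiagonal.antidiagonal R, milnorP p x.1 ⊗ₜ[ZMod p] milnorP p x.2

theorem comulLin_milnorP (R : ℕ →₀ ℕ) : comulLin p (milnorP p R) =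
    ∑ x ∈ Finset.HasAntidiagonal.antidiagonal R, milnorP p x.1 ⊗ₜ[ZMod p] milnorP p x.2 :=
  (milnorBasis p).constr_basis (ZMod p) _ R

theorem milnor_induction {P : SteenrodAlgebra p → Prop} (h0 : P 0)
    (hadd : ∀ f g, P f → P g → P (f + g)) (hsmul : ∀ (c : ZMod p) f, P f → P (c • f))
    (hP : ∀ R, P (milnorP p R)) (f : SteenrodAlgebra p) : P f := by
  refine Submodule.span_induction (p := fun f _ => P f) ?_ h0 (fun f g _ _ => hadd f g)
    (fun c f _ => hsmul c f) ((milnorBasis p).mem_span f)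
  rintro _ ⟨R, rfl⟩
  exact hP R

/-- The coproduct of `A_p` is dual to the product of polynomials. -/
theorem pair2_comulLin (f : SteenrodAlgebra p) : pair2 p (comulLin p f) =
    (TensorProduct.lid (ZMod p) (ZMod p)).symm.toLinearMap ∘ₗ f.1.ofConv ∘ₗ
      LinearMap.mul' (ZMod p) (MilnorDual p) := by
  induction f using milnor_induction with
  | h0 =>
    rw [map_zero, map_zero]
    exact (by rw [LinearMap.zero_comp, LinearMap.comp_zero] :
      (TensorProduct.lid (ZMod p) (ZMod p)).symm.toLinearMap ∘ₗ
        (0 : MilnorDual p →ₗ[ZMod p] ZMod p) ∘ₗ LinearMap.mul' (ZMod p) (MilnorDual p) = 0).symm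
  | hadd f g hf hg =>
    rw [map_add, map_add, hf, hg]
    apply LinearMap.ext; intro x
    exact (map_add (TensorProduct.lid (ZMod p) (ZMod p)).symm _ _).symm
  | hsmul c f hf =>
    rw [map_smul, map_smul, hf]
    apply LinearMap.ext; intro x
    exact (map_smul (TensorProduct.lid (ZMod p) (ZMod p)).symm c _).symm
  | hP R =>
    refine ((basis p).tensorProduct (basis p)).ext ?_
    rintro ⟨U, V⟩
    rw [Module.Basis.tensorProduct_apply, basis_apply, basis_apply, comulLin_milnorP, map_sum,
      LinearMap.sum_apply]
    simp only [LinearMap.comp_apply, LinearMap.mul'_apply, ← mono_add, LinearEquiv.coe_coe,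
      pair2_tmul, TensorProduct.map_tmul]
    change ∑ x ∈ Finset.HasAntidiagonal.antidiagonal R, ((milnorP p x.1).1 (mono p U)) ⊗ₜ[ZMod p]
      ((milnorP p x.2).1 (mono p V)) =
        (TensorProduct.lid (ZMod p) (ZMod p)).symm ((milnorP p R).1 (mono p (U + V)))
    simp only [milnorP_mono]
    rw [TensorProduct.lid_symm_apply]
    by_cases h : R = U + V
    · rw [if_pos h, Finset.sum_eq_single (U, V)]
      · simp
      · rintro ⟨S, T⟩ _ hne
        by_cases h1 : S = U
        · have h2 : T ≠ V := fun h2 => hne (by rw [h1, h2])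
          simp [h2]
        · simp [h1]
      · intro hn; exact absurd (Finset.HasAntidiagonal.mem_antidiagonal.mpr h.symm) hn
    · rw [if_neg h, TensorProduct.tmul_zero]
      refine Finset.sum_eq_zero ?_
      rintro ⟨S, T⟩ hST
      rw [Finset.HasAntidiagonal.mem_antidiagonal] at hST
      by_cases h1 : S = U
      · have h2 : T ≠ V := fun h2 => h (by rw [← hST, h1, h2])
        simp [h2]
      · simp [h1]

theorem comulLin_mul (f g : SteenrodAlgebra p) :
    comulLin p (f * g) = comulLin p f * comulLin p g := by
  apply pair2_injective
  apply WithConv.toConv_injective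
  rw [pair2_mul, pair2_comulLin, pair2_comulLin, pair2_comulLin]
  have h1 := LinearMap.convMul_comp_coalgHom_distrib f.1 g.1
    (Bialgebra.mulCoalgHom (ZMod p) (MilnorDual p))
  have h2 := LinearMap.algHom_comp_convMul_distrib
    (Algebra.TensorProduct.lid (ZMod p) (ZMod p)).symm.toAlgHom
    (toConv (f.1.ofConv ∘ₗ (Bialgebra.mulCoalgHom (ZMod p) (MilnorDual p)).toLinearMap))
    (toConv (g.1.ofConv ∘ₗ (Bialgebra.mulCoalgHom (ZMod p) (MilnorDual p)).toLinearMap))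
  rw [← h1] at h2
  exact congrArg toConv h2

theorem milnorP_zero : milnorP p 0 = 1 := by
  refine ext_mono fun R => ?_
  rw [milnorP_mono]
  change _ = counitHom p (mono p R)
  induction R using Finsupp.induction_linear with
  | zero => simp [mono_zero]
  | add R S hR hS =>
    rw [mono_add, map_mul, ← hR, ← hS]
    by_cases h1 : R = 0
    · simp [h1, eq_comm]
    · have : R + S ≠ 0 := fun h => h1 (by
        ext n; have := DFunLike.congr_fun h n; simp at this; simp [this.1])
      simp [h1, this, eq_comm]
  | single n r =>
    have : mono p (Finsupp.single n r) = xi p (n + 1) ^ r := by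
      induction r with
      | zero => simp [mono_zero]
      | succ r ih => rw [Finsupp.single_add, mono_add, ih, mono_single, pow_succ]
    rw [this, map_pow, counitHom_xi]
    rcases Nat.eq_zero_or_pos r with h | h
    · simp [h]
    · have h' : r ≠ 0 := by omega
      have : (0 : ℕ →₀ ℕ) ≠ Finsupp.single n r := fun h => h' (by simpa using h.symm)
      simp [h', this]

variable (p) in
/-- The coproduct as an algebra map. -/
def comulAlg : SteenrodAlgebra p →ₐ[ZMod p] SteenrodAlgebra p ⊗[ZMod p] SteenrodAlgebra p :=
  AlgHom.ofLinearMap (comulLin p)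
    (by
      rw [← milnorP_zero, comulLin_milnorP, 
        show (Finset.HasAntidiagonal.antidiagonal (0 : ℕ →₀ ℕ)) = {(0, 0)} by
          ext ⟨a, b⟩; simp,
        Finset.sum_singleton, milnorP_zero, Algebra.TensorProduct.one_def])
    comulLin_mul

variable (p) in
/-- The counit `f ↦ ⟨f, 1⟩`. -/
def counitAlg : SteenrodAlgebra p →ₐ[ZMod p] ZMod p :=
  AlgHom.ofLinearMap
    { toFun := fun f => f.1 (1 : MilnorDual p)
      map_add' := fun _ _ => rfl
      map_smul' := fun _ _ => rfl }
    (by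
      change Coalgebra.counit (R := ZMod p) (1 : MilnorDual p) = 1
      exact Bialgebra.counit_one)
    (by
      intro f g
      change LinearMap.mul' (ZMod p) (ZMod p) (TensorProduct.map f.1.ofConv g.1.ofConv
        (Coalgebra.comul (R := ZMod p) (1 : MilnorDual p))) = f.1 (1 : MilnorDual p) * g.1 (1 : MilnorDual p)
      rw [Bialgebra.comul_one, Algebra.TensorProduct.one_def, TensorProduct.map_tmul,
        LinearMap.mul'_apply])

theorem counitAlg_milnorP (R : ℕ →₀ ℕ) : counitAlg p (milnorP p R) = if R = 0 then 1 else 0 :=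
  milnorP_mono R 0

variable (p) in
/-- The antipode `f ↦ f ∘ χ`. -/
def antipodeLin : SteenrodAlgebra p →ₗ[ZMod p] SteenrodAlgebra p where
  toFun f := ⟨toConv (f.1.ofConv ∘ₗ (chiHom p).toLinearMap), by
    obtain ⟨N, hN⟩ := (finite_support_iff f.1.ofConv).mp f.2
    exact (finite_support_iff _).mpr ⟨N, fun x hx => hN _ (chiHom_mem_fil hx)⟩⟩
  map_add' _ _ := rfl
  map_smul' _ _ := rfl

theorem coe_antipodeLin (f : SteenrodAlgebra p) (x : MilnorDual p) :
    (antipodeLin p f).1 x = f.1 (chiHom p x) := rfl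

theorem mul_chi_left (x : MilnorDual p) : LinearMap.mul' (ZMod p) (MilnorDual p)
    ((chiHom p).toLinearMap.rTensor _ (Coalgebra.comul (R := ZMod p) x)) =
      algebraMap (ZMod p) _ (Coalgebra.counit (R := ZMod p) x) :=
  congrArg (fun φ : WithConv (MilnorDual p →ₐ[ZMod p] MilnorDual p) => φ.ofConv x) chiHom_mul_id

theorem mul_chi_right (x : MilnorDual p) : LinearMap.mul' (ZMod p) (MilnorDual p)
    ((chiHom p).toLinearMap.lTensor _ (Coalgebra.comul (R := ZMod p) x)) =
      algebraMap (ZMod p) _ (Coalgebra.counit (R := ZMod p) x) :=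
  congrArg (fun φ : WithConv (MilnorDual p →ₐ[ZMod p] MilnorDual p) => φ.ofConv x) id_mul_chiHom

theorem pair2_rTensor (t : SteenrodAlgebra p ⊗[ZMod p] SteenrodAlgebra p)
    (u : MilnorDual p ⊗[ZMod p] MilnorDual p) :
    pair2 p ((antipodeLin p).rTensor _ t) u = pair2 p t ((chiHom p).toLinearMap.rTensor _ u) := by
  induction t with
  | zero => simp
  | add a b ha hb => simp only [map_add, LinearMap.add_apply, ha, hb]
  | tmul f g =>
    induction u with
    | zero => simp
    | add a b ha hb => simp only [map_add, ha, hb]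
    | tmul x y => rfl

theorem pair2_lTensor (t : SteenrodAlgebra p ⊗[ZMod p] SteenrodAlgebra p)
    (u : MilnorDual p ⊗[ZMod p] MilnorDual p) :
    pair2 p ((antipodeLin p).lTensor _ t) u = pair2 p t ((chiHom p).toLinearMap.lTensor _ u) := by
  induction t with
  | zero => simp
  | add a b ha hb => simp only [map_add, LinearMap.add_apply, ha, hb]
  | tmul f g =>
    induction u with
    | zero => simp
    | add a b ha hb => simp only [map_add, ha, hb]
    | tmul x y => rfl

/-- The product of `A_p` is dual to the coproduct of polynomials. -/
theorem toDual_mul' (t : SteenrodAlgebra p ⊗[ZMod p] SteenrodAlgebra p) (x : MilnorDual p) :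
    toDual p (LinearMap.mul' (ZMod p) (SteenrodAlgebra p) t) x =
      LinearMap.mul' (ZMod p) (ZMod p) (pair2 p t (Coalgebra.comul (R := ZMod p) x)) := by
  induction t with
  | zero => simp
  | add a b ha hb => simp only [map_add, LinearMap.add_apply, ha, hb]
  | tmul f g => rfl

theorem toDual_injective : Function.Injective (toDual p) := fun _ _ h =>
  ext_mono fun R => LinearMap.congr_fun h (mono p R)

theorem mul'_pair2_comulLin (f : SteenrodAlgebra p) (u : MilnorDual p ⊗[ZMod p] MilnorDual p) :
    LinearMap.mul' (ZMod p) (ZMod p) (pair2 p (comulLin p f) u) =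
      toDual p f (LinearMap.mul' (ZMod p) (MilnorDual p) u) := by
  rw [pair2_comulLin]
  exact one_mul _

theorem toDual_algebraMap_counit (f : SteenrodAlgebra p) (x : MilnorDual p) :
    toDual p (algebraMap (ZMod p) (SteenrodAlgebra p) (counitAlg p f)) x =
      toDual p f (algebraMap (ZMod p) _ (Coalgebra.counit (R := ZMod p) x)) := by
  rw [Algebra.algebraMap_eq_smul_one, Algebra.algebraMap_eq_smul_one, map_smul, map_smul,
    smul_eq_mul, mul_comm]
  rfl

variable (p) in
/-- The Hopf algebra structure of `A_p`, dual to that of `𝔽_p[ξ₁, ξ₂, …]`. -/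
def steenrodHopf : HopfStructure (ZMod p) (SteenrodAlgebra p) where
  comul := comulAlg p
  counit := counitAlg p
  antipode := antipodeLin p
  coassoc := by
    apply AlgHom.toLinearMap_injective
    refine (milnorBasis p).ext fun R => ?_
    change TensorProduct.assoc _ _ _ _ ((comulLin p).rTensor _ (comulLin p (milnorP p R))) =
      (comulLin p).lTensor _ (comulLin p (milnorP p R))
    simp only [comulLin_milnorP, map_sum, LinearMap.rTensor_tmul, LinearMap.lTensor_tmul,
      TensorProduct.sum_tmul, TensorProduct.tmul_sum, TensorProduct.assoc_tmul]
    rw [Finset.sum_sigma', Finset.sum_sigma']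
    refine Finset.sum_bij' (fun x _ => ⟨(x.2.1, x.2.2 + x.1.2), (x.2.2, x.1.2)⟩)
      (fun x _ => ⟨(x.1.1 + x.2.1, x.2.2), (x.1.1, x.2.1)⟩) ?_ ?_ ?_ ?_ ?_
    · rintro ⟨⟨a, b⟩, ⟨c, d⟩⟩ h
      simp only [Finset.mem_sigma, Finset.HasAntidiagonal.mem_antidiagonal] at h ⊢
      exact ⟨by rw [← add_assoc, h.2, h.1], trivial⟩
    · rintro ⟨⟨a, b⟩, ⟨c, d⟩⟩ h
      simp only [Finset.mem_sigma, Finset.HasAntidiagonal.mem_antidiagonal] at h ⊢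
      exact ⟨by rw [add_assoc, h.2, h.1], trivial⟩
    · rintro ⟨⟨a, b⟩, ⟨c, d⟩⟩ h
      simp only [Finset.mem_sigma, Finset.HasAntidiagonal.mem_antidiagonal] at h
      simp [h.2]
    · rintro ⟨⟨a, b⟩, ⟨c, d⟩⟩ h
      simp only [Finset.mem_sigma, Finset.HasAntidiagonal.mem_antidiagonal] at h
      simp [h.2]
    · rintro ⟨⟨a, b⟩, ⟨c, d⟩⟩ h
      rfl
  counit_left := by
    apply AlgHom.toLinearMap_injective
    refine (milnorBasis p).ext fun R => ?_
    change (counitAlg p).toLinearMap.rTensor _ (comulLin p (milnorP p R)) =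
      (1 : ZMod p) ⊗ₜ milnorP p R
    rw [comulLin_milnorP, map_sum, Finset.sum_eq_single (0, R)]
    · simp [counitAlg_milnorP]
    · rintro ⟨S, T⟩ h hne
      rw [Finset.HasAntidiagonal.mem_antidiagonal] at h
      have : S ≠ 0 := fun h0 => hne (by rw [← h, h0, zero_add])
      simp [counitAlg_milnorP, this]
    · simp
  counit_right := by
    apply AlgHom.toLinearMap_injective
    refine (milnorBasis p).ext fun R => ?_
    change (counitAlg p).toLinearMap.lTensor _ (comulLin p (milnorP p R)) =
      milnorP p R ⊗ₜ (1 : ZMod p)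
    rw [comulLin_milnorP, map_sum, Finset.sum_eq_single (R, 0)]
    · simp [counitAlg_milnorP]
    · rintro ⟨S, T⟩ h hne
      rw [Finset.HasAntidiagonal.mem_antidiagonal] at h
      have : T ≠ 0 := fun h0 => hne (by rw [← h, h0, add_zero])
      simp [counitAlg_milnorP, this]
    · simp
  antipode_left := by
    refine LinearMap.ext fun f => toDual_injective (LinearMap.ext fun x => ?_)
    refine (toDual_mul' ((antipodeLin p).rTensor _ (comulLin p f)) x).trans ?_
    rw [pair2_rTensor, mul'_pair2_comulLin, mul_chi_left]
    exact (toDual_algebraMap_counit f x).symm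
  antipode_right := by
    refine LinearMap.ext fun f => toDual_injective (LinearMap.ext fun x => ?_)
    refine (toDual_mul' ((antipodeLin p).lTensor _ (comulLin p f)) x).trans ?_
    rw [pair2_lTensor, mul'_pair2_comulLin, mul_chi_right]
    exact (toDual_algebraMap_counit f x).symm

instance : HopfAlgebra (ZMod p) (SteenrodAlgebra p) := (steenrodHopf p).toHopfAlgebra

theorem comul_milnorP (R : ℕ →₀ ℕ) : Coalgebra.comul (R := ZMod p) (milnorP p R) =
    ∑ x ∈ Finset.HasAntidiagonal.antidiagonal R, milnorP p x.1 ⊗ₜ[ZMod p] milnorP p x.2 :=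
  comulLin_milnorP R

/-! ### The Hopf subalgebra `A'_q` -/

/-- The exponent sequence `R` is supported in positions divisible by `e`. -/
def SupportedOn (e : ℕ) (R : ℕ →₀ ℕ) : Prop := ∀ n, R n ≠ 0 → e ∣ n + 1

variable (p) in
/-- The algebra map with `ξ_k ↦ ξ_k` if `e ∣ k` and `ξ_k ↦ 0` otherwise. -/
def proj (e : ℕ) : MilnorDual p →ₐ[ZMod p] MilnorDual p :=
  MilnorDual.lift fun n => if e ∣ n + 1 then xi p (n + 1) else 0

theorem proj_xi (e k : ℕ) : proj p e (xi p k) = if e ∣ k then xi p k else 0 := by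
  cases k with
  | zero => simp
  | succ n => simp [proj]

theorem mono_eq_prod (R : ℕ →₀ ℕ) : mono p R = R.prod fun n r => xi p (n + 1) ^ r := by
  have h := MvPolynomial.monomial_eq (R := ZMod p) (s := R) (a := 1)
  rw [MvPolynomial.C_1, one_mul] at h
  exact h

theorem proj_mono_of_supported {e : ℕ} {R : ℕ →₀ ℕ} (h : SupportedOn e R) :
    proj p e (mono p R) = mono p R := by
  rw [mono_eq_prod, Finsupp.prod, map_prod]
  refine Finset.prod_congr rfl fun n hn => ?_
  rw [map_pow, proj_xi, if_pos (h n (Finsupp.mem_support_iff.mp hn))]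

theorem proj_mono_of_not_supported {e : ℕ} {R : ℕ →₀ ℕ} (h : ¬ SupportedOn e R) :
    proj p e (mono p R) = 0 := by
  simp only [SupportedOn, not_forall] at h
  obtain ⟨n, hn, hd⟩ := h
  rw [mono_eq_prod, Finsupp.prod, map_prod]
  refine Finset.prod_eq_zero (Finsupp.mem_support_iff.mpr hn) ?_
  rw [map_pow, proj_xi, if_neg hd, zero_pow hn]

variable (p) in
/-- The span of the Milnor basis elements supported in positions divisible by `e`. -/
def milnorSpan (e : ℕ) : Submodule (ZMod p) (SteenrodAlgebra p) :=
  Submodule.span (ZMod p) (milnorP p '' {R | SupportedOn e R})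

theorem mem_milnorSpan_iff (e : ℕ) (f : SteenrodAlgebra p) :
    f ∈ milnorSpan p e ↔ toDual p f ∘ₗ (proj p e).toLinearMap = toDual p f := by
  constructor
  · intro h
    induction h using Submodule.span_induction with
    | zero => rw [map_zero, LinearMap.zero_comp]
    | add f g _ _ hf hg => rw [map_add, LinearMap.add_comp, hf, hg]
    | smul c f _ hf => rw [map_smul, LinearMap.smul_comp, hf]
    | mem f hf =>
      obtain ⟨R, hR, rfl⟩ := hf
      refine (basis p).ext fun S => ?_
      rw [basis_apply]
      change toDual p (milnorP p R) (proj p e (mono p S)) = _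
      by_cases hS : SupportedOn e S
      · rw [proj_mono_of_supported hS]
      · have hne : R ≠ S := fun h => hS (h ▸ hR)
        rw [proj_mono_of_not_supported hS, map_zero]
        exact ((milnorP_mono R S).trans (if_neg hne)).symm
  · intro h
    rw [← (milnorBasis p).linearCombination_repr f, Finsupp.linearCombination_apply]
    refine Submodule.sum_mem _ fun R hR => Submodule.smul_mem _ _ (Submodule.subset_span ⟨R, ?_, rfl⟩)
    by_contra hn
    refine Finsupp.mem_support_iff.mp hR ?_
    change toDual p f (mono p R) = 0
    rw [← h]
    change toDual p f (proj p e (mono p R)) = 0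
    rw [proj_mono_of_not_supported hn, map_zero]

theorem proj_comul (e : ℕ) (x : MilnorDual p) :
    Algebra.TensorProduct.map (proj p e) (proj p e) (Coalgebra.comul (R := ZMod p) (proj p e x)) =
      Algebra.TensorProduct.map (proj p e) (proj p e) (Coalgebra.comul (R := ZMod p) x) := by
  have h : ((Algebra.TensorProduct.map (proj p e) (proj p e)).comp (comulHom p)).comp (proj p e) =
      (Algebra.TensorProduct.map (proj p e) (proj p e)).comp (comulHom p) := by
    refine algHom_ext fun n => ?_
    simp only [AlgHom.comp_apply, proj_xi]
    split_ifs with hd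
    · rfl
    · rw [map_zero, map_zero, comulHom_xi, map_sum]
      refine (Finset.sum_eq_zero fun i hi => ?_).symm
      rw [Algebra.TensorProduct.map_tmul, map_pow, proj_xi, proj_xi]
      have hp : p ^ i ≠ 0 := Nat.one_le_iff_ne_zero.mp (one_le_pow i)
      by_cases h1 : e ∣ i
      · have h2 : ¬ e ∣ n + 1 - i := fun h2 => hd (by
          have := dvd_add h2 h1
          rwa [Nat.sub_add_cancel (by simp only [Finset.mem_range] at hi; omega)] at this)
        rw [if_neg h2, zero_pow hp, TensorProduct.zero_tmul]
      · rw [if_neg h1, TensorProduct.tmul_zero]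
  exact DFunLike.congr_fun h x

theorem proj_chi (e : ℕ) (x : MilnorDual p) :
    proj p e (chiHom p (proj p e x)) = proj p e (chiHom p x) := by
  have key : ∀ k, ¬ e ∣ k → proj p e (chi p k) = 0 := by
    intro k
    induction k using Nat.strong_induction_on with
    | _ k ih =>
      intro hk
      cases k with
      | zero => exact absurd (dvd_zero e) hk
      | succ n =>
        rw [chi, map_neg, map_sum, neg_eq_zero]
        refine Finset.sum_eq_zero fun i _ => ?_
        have hi : (i : ℕ) < n + 1 := i.2
        have hp : p ^ (i : ℕ) ≠ 0 := Nat.one_le_iff_ne_zero.mp (one_le_pow _)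
        rw [map_mul, map_pow, proj_xi]
        by_cases h1 : e ∣ (i : ℕ)
        · have h2 : ¬ e ∣ n + 1 - i := fun h2 => hk (by
            have := dvd_add h2 h1
            rwa [Nat.sub_add_cancel (by omega)] at this)
          rw [if_neg h2, zero_pow hp, zero_mul]
        · rw [ih _ hi h1, mul_zero]
  have h : ((proj p e).comp (chiHom p)).comp (proj p e) = (proj p e).comp (chiHom p) := by
    refine algHom_ext fun n => ?_
    simp only [AlgHom.comp_apply, proj_xi]
    split_ifs with hd
    · rfl
    · rw [map_zero, map_zero, chiHom_xi, key _ hd]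
  exact DFunLike.congr_fun h x

theorem SupportedOn.of_add_left {e : ℕ} {R S T : ℕ →₀ ℕ} (hR : SupportedOn e R) (h : S + T = R) :
    SupportedOn e S := fun n hn => hR n (by
  rw [← h, Finsupp.add_apply]; omega)

theorem SupportedOn.of_add_right {e : ℕ} {R S T : ℕ →₀ ℕ} (hR : SupportedOn e R) (h : S + T = R) :
    SupportedOn e T := fun n hn => hR n (by
  rw [← h, Finsupp.add_apply]; omega)

variable (p) in
/-- The subalgebra `A'_q` of `A_p`, `q = p ^ e`: the span of the Milnor basis elements `P(R)` with
`R` supported in positions divisible by `e`. -/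
def milnorSubalgebra (e : ℕ) : Subalgebra (ZMod p) (SteenrodAlgebra p) :=
  (milnorSpan p e).toSubalgebra
    (Submodule.subset_span ⟨0, fun n hn => absurd rfl hn, milnorP_zero⟩)
    (by
      intro f g hf hg
      rw [mem_milnorSpan_iff] at hf hg ⊢
      have key : ∀ u : MilnorDual p ⊗[ZMod p] MilnorDual p,
          pair2 p (f ⊗ₜ g) (Algebra.TensorProduct.map (proj p e) (proj p e) u) =
            pair2 p (f ⊗ₜ g) u := by
        intro u
        induction u with
        | zero => simp
        | add a b ha hb => simp only [map_add, ha, hb]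
        | tmul x y =>
          have h1 : toDual p f (proj p e x) = toDual p f x := LinearMap.congr_fun hf x
          have h2 : toDual p g (proj p e y) = toDual p g y := LinearMap.congr_fun hg y
          exact congrArg₂ (fun a b : ZMod p => a ⊗ₜ[ZMod p] b) h1 h2
      refine LinearMap.ext fun x => ?_
      change toDual p (LinearMap.mul' (ZMod p) (SteenrodAlgebra p) (f ⊗ₜ g)) (proj p e x) =
        toDual p (LinearMap.mul' (ZMod p) (SteenrodAlgebra p) (f ⊗ₜ g)) x
      rw [toDual_mul', toDual_mul', ← key, proj_comul, key])

theorem isHopfSubalgebra_milnorSubalgebra (e : ℕ) : IsHopfSubalgebra (milnorSubalgebra p e) where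
  comul_mem := by
    intro f hf
    replace hf : f ∈ milnorSpan p e := hf
    induction hf using Submodule.span_induction with
    | zero => rw [map_zero]; exact zero_mem _
    | add f g _ _ hf hg => rw [map_add]; exact add_mem hf hg
    | smul c f _ hf => rw [map_smul]; exact Subalgebra.smul_mem _ hf c
    | mem f hf =>
      obtain ⟨R, hR, rfl⟩ := hf
      rw [comul_milnorP]
      refine sum_mem ?_
      rintro ⟨S, T⟩ h
      rw [Finset.HasAntidiagonal.mem_antidiagonal] at h
      exact ⟨(⟨milnorP p S, Submodule.subset_span ⟨S, hR.of_add_left h, rfl⟩⟩ :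
          milnorSubalgebra p e) ⊗ₜ (⟨milnorP p T, Submodule.subset_span
            ⟨T, hR.of_add_right h, rfl⟩⟩ : milnorSubalgebra p e), rfl⟩
  antipode_mem := by
    intro f hf
    replace hf : f ∈ milnorSpan p e := hf
    change antipodeLin p f ∈ milnorSpan p e
    rw [mem_milnorSpan_iff] at hf ⊢
    refine LinearMap.ext fun x => ?_
    have hf' : ∀ y, toDual p f (proj p e y) = toDual p f y := LinearMap.congr_fun hf
    change toDual p f (chiHom p (proj p e x)) = toDual p f (chiHom p x)
    rw [← hf', proj_chi, hf']

instance (e : ℕ) : HopfAlgebra (ZMod p) (milnorSubalgebra p e) :=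
  (isHopfSubalgebra_milnorSubalgebra e).hopfStructure.toHopfAlgebra

variable (p) in
/-- The element `P_e^r = P(0, …, 0, r)` of `A'_q`, with `r` in position `e`. -/
def milnorPower {e : ℕ} (he : 1 ≤ e) (r : ℕ) : milnorSubalgebra p e :=
  ⟨milnorP p (Finsupp.single (e - 1) r), Submodule.subset_span ⟨_, fun n hn => by
    have h : e - 1 = n := by
      by_contra h; exact hn (Finsupp.single_eq_of_ne (Ne.symm h))
    rw [← h, Nat.sub_add_cancel he], rfl⟩⟩

/-! ### The algebra given by the Adem relations -/

/-- The relation `P⁰ = 1` and the `q`-Adem relations on the free algebra on `P⁰, P¹, P², …`. -/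
inductive AdemRel (K : Type*) [CommRing K] (q : ℕ) : FreeAlgebra K ℕ → FreeAlgebra K ℕ → Prop
  | zero : AdemRel K q (FreeAlgebra.ι K 0) 1
  | adem (a b : ℕ) (h : a < q * b) :
      AdemRel K q (FreeAlgebra.ι K a * FreeAlgebra.ι K b)
        (∑ j ∈ Finset.range (a / q + 1),
          ((-1) ^ (a + j) * (((q - 1) * (b - j) - 1).choose (a - q * j) : K)) •
            (FreeAlgebra.ι K (a + b - j) * FreeAlgebra.ι K j))

/-- The `K`-algebra generated by `P^r`, `r ≥ 0`, subject to `P⁰ = 1` and the `q`-Adem relations.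
For `K = 𝔽_q` this is the algebra `A_q` of Steenrod `q`th powers. -/
def SteenrodPowers (K : Type*) [CommRing K] (q : ℕ) : Type _ := RingQuot (AdemRel K q)

namespace SteenrodPowers

variable (K : Type*) [CommRing K] (q : ℕ)

instance : Ring (SteenrodPowers K q) := inferInstanceAs (Ring (RingQuot (AdemRel K q)))

instance : Algebra K (SteenrodPowers K q) :=
  inferInstanceAs (Algebra K (RingQuot (AdemRel K q)))

/-- The generator `P^r`. -/
def P (r : ℕ) : SteenrodPowers K q :=
  RingQuot.mkAlgHom K (AdemRel K q) (FreeAlgebra.ι K r)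

/-- The part of degree `d`, where `P^r` has degree `r`: the span of the monomials
`P^{a₁} ⋯ P^{a_l}` with `a₁ + ⋯ + a_l = d`. -/
def homogeneous (d : ℕ) : Submodule K (SteenrodPowers K q) :=
  Submodule.span K {x | ∃ l : List ℕ, l.sum = d ∧ x = (l.map (P K q)).prod}

end SteenrodPowers

end Steenrod

end

open scoped PowerSeries.WithPiTopology

noncomputable section

namespace Steenrod

/-! ### Binomial identities modulo `p` -/

section

open PowerSeries

/-! Everything rests on comparing two families of admissible monomials `P^{a₁}P^{a₂}⋯` with `aᵢ ≥ q
aᵢ₊₁`. Such words correspond to exponent sequences `R` through `Rᵢ = aᵢ - q aᵢ₊₁`.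

In the presented algebra the Adem relations rewrite any word into admissible ones of the same
degree, so the admissible monomials span (`prod_mem_span_adm`). In `A'_q` the elements `P_e^r`
satisfy the same relations (`isAdem_milnorPower`) and their admissible monomials form a basis
(`admBasis`). After extension of scalars, `P^r ↦ 1 ⊗ P_e^r` therefore carries a spanning family
bijectively to a basis, so the family is a basis and the map is an isomorphism. The Hopf structure
is transported along it.

Both facts about `A'_q` are computed by duality with the polynomial ring on `ζ_k = ξ_{ke}`. Left
multiplication by `P_e^r` is dual to extracting the coefficient of `t^r` from `ζ_k ↦ ζ_k +
t^{q^{k-1}} ζ_{k-1}`. A product `P_e^a P_e^b` pairs nontrivially only with some `ζ₁^m ζ₂^n`, and the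
value is a binomial coefficient. The Adem relations thereby become the congruence `choose_eq_sum`,
proved with generating series. For the basis, the leading coefficient in `t` of the image of `ζ^S`
is `ζ^{shift S}`; hence the pairing of admissible monomials with the `ζ^S` is unitriangular for the
lexicographic order on words. This gives independence, and a dimension count in each degree gives
spanning.

The `P^{p^j}` generate because, for `r` not a power of `p`, a suitable Adem relation contains `P^r`
with a unit coefficient, by Lucas. None can be dropped: for each `k` there is a representation in
the dual numbers that sends `P^{p^k}` to `ε` and every other `P^r`, `r > 0`, to `0`. Finally the
admissible basis is homogeneous, so the Poincaré series counts exponent sequences by degree. -/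

theorem coeff_pow_eq_coeff_derivative {n : ℕ} (φ : (ZMod n)⟦X⟧) (a : ℕ) :
    coeff (a + 1) (φ ^ (a + 1)) = coeff a (φ ^ a * derivative (ZMod n) φ) := by
  -- Differentiating `φ ^ (a + 1)` gives the identity multiplied by `a + 1`, which may vanish modulo
  -- `n`. Over `ℤ` the factor can be cancelled.
  obtain ⟨ψ, rfl⟩ : ∃ ψ : ℤ⟦X⟧, ψ.map (Int.castRingHom (ZMod n)) = φ := by
    choose f hf using fun k => ZMod.intCast_surjective (coeff k φ)
    exact ⟨PowerSeries.mk f, by ext k; simp [hf]⟩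
  have h : coeff (a + 1) (ψ ^ (a + 1)) = coeff a (ψ ^ a * derivative ℤ ψ) := by
    have h1 : coeff a (derivative ℤ (ψ ^ (a + 1))) =
        coeff (a + 1) (ψ ^ (a + 1)) * ((a : ℤ) + 1) := by
      exact coeff_derivative _ _
    rw [Derivation.leibniz_pow] at h1
    simp only [Nat.add_sub_cancel, smul_eq_mul, nsmul_eq_mul] at h1
    have h2 : ((a + 1 : ℕ) : ℤ⟦X⟧) = C ((a + 1 : ℕ) : ℤ) := by simp
    rw [h2, coeff_C_mul] at h1
    push_cast at h1
    have h3 : ((a : ℤ) + 1) ≠ 0 := by positivity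
    refine mul_left_cancel₀ h3 ?_
    rw [h1]; ring
  have hd : derivative (ZMod n) (ψ.map (Int.castRingHom (ZMod n))) =
      (derivative ℤ ψ).map (Int.castRingHom (ZMod n)) := by
    ext k; simp [coeff_derivative]
  rw [hd, ← map_pow, ← map_pow, ← map_mul, coeff_map, coeff_map, h]

variable {p : ℕ} [Fact p.Prime] {e q : ℕ}

section
variable (p q)

/-- The power series `1 - x`. -/
local notation "𝔻" => (1 - X : (ZMod p)⟦X⟧)
local notation "𝔹" => (1 - X ^ (q + 1) : (ZMod p)⟦X⟧)
local notation "𝔾" => (PowerSeries.mk 1 : (ZMod p)⟦X⟧)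

theorem mk_one_mul_one_sub : 𝔾 * 𝔻 = 1 := mk_one_mul_one_sub_eq_one (ZMod p)

/-- The series `(1 - x)^{-(b+1)} (1 - x^q)^{-a} (1 - x^{q+1})^{a+b}`. -/
def ademSeries (a b : ℕ) : (ZMod p)⟦X⟧ := 𝔾 ^ (b + 1) * 𝔾 ^ (q * a) * 𝔹 ^ (a + b)

variable {p q}

theorem one_sub_X_pow (hq : q = p ^ e) : 𝔻 ^ q = 1 - X ^ q := by
  subst hq
  have : CharP (ZMod p)⟦X⟧ p :=
    charP_of_injective_algebraMap (algebraMap (ZMod p) (ZMod p)⟦X⟧).injective p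
  rw [sub_pow_char_pow, one_pow]

theorem mk_one_pow_mul (n : ℕ) : 𝔾 ^ n * 𝔻 ^ n = 1 := by
  rw [← mul_pow, mk_one_mul_one_sub, one_pow]

/-- Pascal's rule for series. Since `(1 - x)^q = 1 - x^q` in characteristic `p`, one factor splits
as `1 - x^{q+1} = x(1 - x)^q + (1 - x)`, and each summand cancels against negative powers of `1 -
x`. -/
theorem ademSeries_succ_succ (hq : q = p ^ e) (a b : ℕ) : ademSeries p q (a + 1) (b + 1) =
    X * ademSeries p q a (b + 1) + ademSeries p q (a + 1) b := by
  have hB : 𝔹 = X * 𝔻 ^ q + 𝔻 := by rw [one_sub_X_pow hq]; ring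
  have h1 := mk_one_mul_one_sub p
  have h2 := mk_one_pow_mul (p := p) q
  have e1 : ademSeries p q (a + 1) (b + 1) =
      𝔾 ^ (b + 2) * 𝔾 ^ (q * a) * 𝔾 ^ q * 𝔹 ^ (a + b + 1) * 𝔹 := by
    rw [ademSeries]; ring
  have e2 : 𝔾 ^ (b + 2) * 𝔾 ^ (q * a) * 𝔾 ^ q * 𝔹 ^ (a + b + 1) * (X * 𝔻 ^ q + 𝔻) =
     X * (𝔾 ^ (b + 2) * 𝔾 ^ (q * a) * 𝔹 ^ (a + b + 1)) * (𝔾 ^ q * 𝔻 ^ q) +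
      𝔾 ^ (b + 1) * 𝔾 ^ (q * a) * 𝔾 ^ q * 𝔹 ^ (a + b + 1) * (𝔾 * 𝔻) := by ring
  rw [e1]
  nth_rewrite 2 [hB]
  rw [e2, h1, h2, ademSeries, ademSeries]
  ring

/-- For `φ = (1 - x)^{-q}(1 - x^{q+1})`, the vanishing of `q` modulo `p` gives `φ' = -(1 -
x)^{-q}x^q`, so `φ - xφ' = (1 - x)^{-q}`. The series in question is then `φ^{a+1} - xφ^aφ'`, and
`coeff_pow_eq_coeff_derivative` makes the two coefficients cancel. -/
theorem coeff_ademSeries_aux (hq : q = p ^ e) (he : 1 ≤ e) (a : ℕ) :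
    coeff (a + 1) (𝔾 ^ (q * (a + 1)) * 𝔹 ^ a) = 0 := by
  have h2 := mk_one_pow_mul (p := p) q
  have hc : (q : (ZMod p)⟦X⟧) = 0 := by
    have : CharP (ZMod p)⟦X⟧ p :=
    charP_of_injective_algebraMap (algebraMap (ZMod p) (ZMod p)⟦X⟧).injective p
    rw [CharP.cast_eq_zero_iff (ZMod p)⟦X⟧ p, hq]
    exact dvd_pow_self p (by omega)
  set φ : (ZMod p)⟦X⟧ := 𝔾 ^ q * 𝔹 with hφ
  have hG : derivative (ZMod p) (𝔾 ^ q) = 0 := by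
    rw [Derivation.leibniz_pow]
    simp [hc]
  have hφ' : derivative (ZMod p) φ = - (𝔾 ^ q * X ^ q) := by
    rw [hφ, Derivation.leibniz, hG, map_sub, Derivation.leibniz_pow]
    simp [hc]
  have key : 𝔾 ^ (q * (a + 1)) * 𝔹 ^ a = φ ^ (a + 1) - X * (φ ^ a * derivative (ZMod p) φ) := by
    have h3 : φ + X * (𝔾 ^ q * X ^ q) = 𝔾 ^ q := by
      rw [hφ]; ring
    have h4 : φ ^ (a + 1) - X * (φ ^ a * derivative (ZMod p) φ) =
      φ ^ a * (φ + X * (𝔾 ^ q * X ^ q)) := by rw [hφ']; ring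
    rw [h4, h3, hφ, mul_pow]; ring
  rw [key, map_sub, coeff_succ_X_mul, coeff_pow_eq_coeff_derivative, sub_self]

/-- The boundary case of Pascal's rule: the same splitting leaves a remainder, whose relevant
coefficient is zero by `coeff_ademSeries_aux`. -/
theorem ademSeries_succ_zero (hq : q = p ^ e) (a : ℕ) : ademSeries p q (a + 1) 0 =
    X * ademSeries p q a 0 + 𝔾 ^ (q * (a + 1)) * 𝔹 ^ a := by
  have hB : 𝔹 = X * 𝔻 ^ q + 𝔻 := by rw [one_sub_X_pow hq]; ring
  have h1 := mk_one_mul_one_sub p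
  have h2 := mk_one_pow_mul (p := p) q
  have e1 : ademSeries p q (a + 1) 0 =
      𝔾 * 𝔾 ^ (q * a) * 𝔾 ^ q * 𝔹 ^ a * 𝔹 := by
    rw [ademSeries]; ring
  have e2 : 𝔾 * 𝔾 ^ (q * a) * 𝔾 ^ q * 𝔹 ^ a * (X * 𝔻 ^ q + 𝔻) =
     X * (𝔾 * 𝔾 ^ (q * a) * 𝔹 ^ a) * (𝔾 ^ q * 𝔻 ^ q) +
      𝔾 ^ (q * a) * 𝔾 ^ q * 𝔹 ^ a * (𝔾 * 𝔻) := by ring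
  rw [e1]
  nth_rewrite 2 [hB]
  rw [e2, h1, h2, ademSeries]
  ring

theorem coeff_ademSeries (hq : q = p ^ e) (he : 1 ≤ e) (a b : ℕ) :
    coeff a (ademSeries p q a b) = ((a + b).choose b : ZMod p) := by
  induction a generalizing b with
  | zero => simp [ademSeries]
  | succ a iha =>
    induction b with
    | zero =>
      rw [ademSeries_succ_zero hq, map_add, coeff_succ_X_mul, iha, coeff_ademSeries_aux hq he]
      simp
    | succ b ihb =>
      rw [ademSeries_succ_succ hq, map_add, coeff_succ_X_mul, iha, ihb]
      rw [show a + 1 + (b + 1) = (a + 1 + b) + 1 by ring, Nat.choose_succ_succ,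
        show a + 1 + b = a + (b + 1) by ring]
      push_cast; ring

theorem neg_one_pow_mul_eq (hq : q = p ^ e) (j : ℕ) :
    (-1 : ZMod p) ^ (q * j) = (-1) ^ j := by
  rw [pow_mul]
  congr 1
  rw [hq]
  rcases Nat.Prime.eq_two_or_odd' (Fact.out : p.Prime) with h | h
  · subst h
    rw [show (-1 : ZMod 2) = 1 from rfl, one_pow]
  · exact (h.pow).neg_one_pow

theorem coeff_one_sub_pow (n k : ℕ) :
    coeff k (𝔻 ^ n) = (-1) ^ k * (n.choose k : ZMod p) := by
  have h : 𝔻 ^ n = rescale (-1) (((1 + Polynomial.X : Polynomial (ZMod p)) ^ n :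
      Polynomial (ZMod p)) : (ZMod p)⟦X⟧) := by
    simp [sub_eq_add_neg]
  rw [h, coeff_rescale, Polynomial.coeff_coe, Polynomial.coeff_one_add_X_pow]

/-- The binomial identity behind the Adem relations. -/
theorem choose_eq_sum (hq : q = p ^ e) (he : 1 ≤ e) {a b : ℕ} (hab : a < q * b) :
    ((a + b).choose b : ZMod p) = ∑ j ∈ Finset.range (a / q + 1),
      ((-1) ^ (a + j) * (((q - 1) * (b - j) - 1).choose (a - q * j) : ZMod p)) *
        ((a + b).choose j : ZMod p) := by
  have hp2 : 2 ≤ p := Nat.Prime.two_le Fact.out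
  have hq2 : 2 ≤ q := hq ▸ hp2.trans (Nat.le_self_pow (by omega) p)
  have hb : 1 ≤ b := by
    by_contra h
    have : b = 0 := by omega
    simp [this] at hab
  have key : ademSeries p q a b = 𝔻 ^ ((q - 1) * b - 1) *
      ∑ j ∈ Finset.range (a + b + 1), ((a + b).choose j : (ZMod p)⟦X⟧) *
        (X ^ q * 𝔾 ^ (q - 1)) ^ j := by
    have h1 : (1 : (ZMod p)⟦X⟧) + X ^ q * 𝔾 ^ (q - 1) = 𝔾 ^ q * 𝔹 := by
      have e1 : (1 : (ZMod p)⟦X⟧) = 𝔾 ^ q * 𝔻 ^ q := (mk_one_pow_mul q).symm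
      have e2 : 𝔾 ^ (q - 1) = 𝔾 ^ q * 𝔻 := by
        obtain ⟨r, rfl⟩ : ∃ r, q = r + 1 := ⟨q - 1, by omega⟩
        rw [Nat.add_sub_cancel, pow_succ, mul_assoc, mk_one_mul_one_sub, mul_one]
      rw [e2]
      nth_rewrite 1 [e1]
      rw [one_sub_X_pow hq]
      ring
    have h2 : ∑ j ∈ Finset.range (a + b + 1), ((a + b).choose j : (ZMod p)⟦X⟧) *
        (X ^ q * 𝔾 ^ (q - 1)) ^ j = (𝔾 ^ q * 𝔹) ^ (a + b) := by
      rw [← h1, add_comm 1, add_pow]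
      refine Finset.sum_congr rfl fun j _ => by rw [one_pow]; ring
    rw [h2, ademSeries]
    have h3 : q * (a + b) = ((q - 1) * b - 1) + (b + 1 + q * a) := by
      obtain ⟨r, rfl⟩ : ∃ r, q = r + 2 := ⟨q - 2, by omega⟩
      obtain ⟨c, rfl⟩ : ∃ c, b = c + 1 := ⟨b - 1, by omega⟩
      have : (r + 2 - 1) * (c + 1) - 1 = r * c + r + c := by
        rw [show r + 2 - 1 = r + 1 by omega, show (r + 1) * (c + 1) = r * c + r + c + 1 by ring]
        omega
      rw [this]; ring
    rw [mul_pow, ← pow_mul, h3, pow_add 𝔾 ((q - 1) * b - 1), pow_add 𝔾 (b + 1)]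
    have h4 := mk_one_pow_mul (p := p) ((q - 1) * b - 1)
    calc _ = 1 * (𝔾 ^ (b + 1) * 𝔾 ^ (q * a) * 𝔹 ^ (a + b)) := (one_mul _).symm
      _ = (𝔾 ^ ((q - 1) * b - 1) * 𝔻 ^ ((q - 1) * b - 1)) *
          (𝔾 ^ (b + 1) * 𝔾 ^ (q * a) * 𝔹 ^ (a + b)) := by rw [h4]
      _ = _ := by ring
  rw [← coeff_ademSeries hq he, key, Finset.mul_sum, map_sum]
  have hsub : Finset.range (a / q + 1) ⊆ Finset.range (a + b + 1) := by
    refine Finset.range_mono ?_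
    have := Nat.div_le_self a q
    omega
  rw [← Finset.sum_subset hsub]
  · refine Finset.sum_congr rfl fun j hj => ?_
    have hj : q * j ≤ a := by
      have : j ≤ a / q := by simpa [Nat.lt_succ_iff] using hj
      calc q * j ≤ q * (a / q) := Nat.mul_le_mul_left _ this
        _ ≤ a := Nat.mul_div_le a q
    -- The hypothesis `a < q * b` is needed here: it keeps `b - j` positive, so the subtractions in
    -- `(q - 1) * (b - j) - 1` are not truncated.
    have hjb : j < b := by
      by_contra h
      have : q * b ≤ q * j := Nat.mul_le_mul_left _ (by omega)
      omega
    have h1 : 𝔻 ^ ((q - 1) * b - 1) * (((a + b).choose j : (ZMod p)⟦X⟧) *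
        (X ^ q * 𝔾 ^ (q - 1)) ^ j) =
        C ((a + b).choose j : ZMod p) * (𝔻 ^ ((q - 1) * (b - j) - 1) * X ^ (q * j)) := by
      have h2 : (q - 1) * b - 1 = ((q - 1) * (b - j) - 1) + (q - 1) * j := by
        have : (q - 1) * b = (q - 1) * (b - j) + (q - 1) * j := by
          rw [← mul_add, Nat.sub_add_cancel hjb.le]
        have : 1 ≤ (q - 1) * (b - j) := Nat.mul_pos (by omega) (by omega)
        omega
      rw [h2, pow_add, mul_pow, ← pow_mul, ← pow_mul, map_natCast]
      calc _ = ((a + b).choose j : (ZMod p)⟦X⟧) * (𝔻 ^ ((q - 1) * (b - j) - 1) * X ^ (q * j)) *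
          (𝔾 ^ ((q - 1) * j) * 𝔻 ^ ((q - 1) * j)) := by ring
        _ = _ := by rw [mk_one_pow_mul, mul_one]
    rw [h1, coeff_C_mul, coeff_mul_X_pow', if_pos hj, coeff_one_sub_pow]
    have h5 : (-1 : ZMod p) ^ (a + j) = (-1) ^ (a - q * j) := by
      have : a = (a - q * j) + q * j := by omega
      conv_lhs => rw [this]
      rw [pow_add, pow_add, neg_one_pow_mul_eq hq, mul_assoc, ← pow_add, ← two_mul, pow_mul]
      simp
    rw [h5]; ring
  -- The remaining terms of the binomial expansion are divisible by `x^{qj}` with `q * j > a`.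
  · intro j _ hj
    have hj : a < q * j := by
      have : a / q < j := by simpa [Nat.lt_succ_iff] using hj
      exact (Nat.div_lt_iff_lt_mul (by omega)).mp this |>.trans_eq (mul_comm _ _)
    rw [mul_pow, ← pow_mul]
    have : 𝔻 ^ ((q - 1) * b - 1) * (((a + b).choose j : (ZMod p)⟦X⟧) *
        (X ^ (q * j) * (𝔾 ^ (q - 1)) ^ j)) = (𝔻 ^ ((q - 1) * b - 1) *
          ((a + b).choose j : (ZMod p)⟦X⟧) * (𝔾 ^ (q - 1)) ^ j) * X ^ (q * j) := by ring
    rw [this, coeff_mul_X_pow', if_neg (by omega)]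

end

/-- Lucas' theorem for the leading coefficient in the Adem relation for `P^a P^{p^k}`. -/
theorem choose_ne_zero_of_lt (hq : q = p ^ e) (he : 1 ≤ e) (k a : ℕ) (ha : a < (p - 1) * p ^ k) :
    (((q - 1) * p ^ k - 1).choose a : ZMod p) ≠ 0 := by
  have hp : p.Prime := Fact.out
  have hp2 : 2 ≤ p := hp.two_le
  have hlt : ∀ {m r : ℕ}, m < p → r ≤ m → ¬ p ∣ m.choose r := fun hm hr h => by
    have h1 := hp.dvd_factorial.mp (h.trans (Dvd.intro _ ((mul_assoc _ _ _).symm.trans (Nat.choose_mul_factorial_mul_factorial hr))))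
    omega
  rw [Ne, ZMod.natCast_eq_zero_iff]
  obtain ⟨d, rfl⟩ : ∃ d, q = p * (d + 1) := by
    obtain ⟨c, hc⟩ := dvd_pow_self p (show e ≠ 0 by omega)
    have : 0 < p ^ e := Nat.pow_pos hp.pos
    refine ⟨c - 1, ?_⟩
    rw [hq, hc, Nat.sub_add_cancel]
    by_contra h
    have : c = 0 := by omega
    simp [this] at hc
    omega
  clear hq he
  induction k generalizing a with
  | zero =>
    intro h
    have hl := (Choose.choose_modEq_choose_mod_mul_choose_div_nat (n := (p * (d + 1) - 1) * p ^ 0 - 1) (k := a) (p := p))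
    rw [Nat.ModEq.dvd_iff hl dvd_rfl] at h
    have h1 : (p * (d + 1) - 1) * p ^ 0 - 1 = (p - 2) + p * d := by
      have : p * (d + 1) = p * d + p := by ring
      rw [pow_zero]; omega
    have ha' : a < p - 1 := by simpa using ha
    -- The last base-`p` digit of `q - 2` is `p - 2`, and `a < p - 1` has the single digit `a ≤ p -
    -- 2`.
    have h2 : ((p * (d + 1) - 1) * p ^ 0 - 1) % p = p - 2 := by
      rw [h1, Nat.add_mul_mod_self_left, Nat.mod_eq_of_lt (by omega)]
    rw [h2, Nat.mod_eq_of_lt (by omega : a < p), Nat.div_eq_of_lt (by omega : a < p),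
      Nat.choose_zero_right, mul_one] at h
    exact hlt (by omega) (by omega) h
  | succ k ih =>
    intro h
    have hl := (Choose.choose_modEq_choose_mod_mul_choose_div_nat (n := (p * (d + 1) - 1) * p ^ (k + 1) - 1) (k := a) (p := p))
    rw [Nat.ModEq.dvd_iff hl dvd_rfl] at h
    set N := (p * (d + 1) - 1) * p ^ k with hN
    have hNpos : 1 ≤ N := Nat.mul_pos (by
      have : p * (d + 1) = p * d + p := by ring
      omega) (Nat.pow_pos hp.pos)
    -- The last digit is now `p - 1`, which dominates any digit of `a`; the remaining digits are
    -- those of the previous case.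
    have h1 : (p * (d + 1) - 1) * p ^ (k + 1) - 1 = (p - 1) + p * (N - 1) := by
      have h3 : (p * (d + 1) - 1) * p ^ (k + 1) = p * N := by rw [hN]; ring
      obtain ⟨n, hn⟩ : ∃ n, N = n + 1 := ⟨N - 1, by omega⟩
      rw [h3, hn, Nat.add_sub_cancel, mul_add]
      omega
    rw [h1, Nat.add_mul_mod_self_left, Nat.mod_eq_of_lt (by omega : p - 1 < p),
      Nat.add_mul_div_left _ _ hp.pos, Nat.div_eq_of_lt (by omega : p - 1 < p), zero_add] at h
    rcases (hp.dvd_mul).mp h with h | h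
    · have := Nat.mod_lt a hp.pos
      exact hlt (by omega) (by omega) h
    · refine ih (a / p) ?_ h
      rw [Nat.div_lt_iff_lt_mul hp.pos]
      calc a < _ := ha
        _ = _ := by ring

end

/-! ### Exponent sequences and admissible words -/

/-- The exponent sequence `(R 1, R 2, …)`. -/
def shift (R : ℕ →₀ ℕ) : ℕ →₀ ℕ := R.comapDomain Nat.succ Nat.succ_injective.injOn

@[simp] theorem shift_apply (R : ℕ →₀ ℕ) (n : ℕ) : shift R n = R (n + 1) := rfl

@[simp] theorem shift_zero : shift 0 = 0 := by ext; rfl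

theorem exists_shift_eq (c : ℕ) (S : ℕ →₀ ℕ) : ∃ R : ℕ →₀ ℕ, R 0 = c ∧ shift R = S := by
  refine ⟨Finsupp.single 0 c + S.mapDomain Nat.succ, ?_, ?_⟩
  · rw [Finsupp.add_apply, Finsupp.single_eq_same, Finsupp.mapDomain_of_notMem_range, add_zero]
    simp
  · ext n
    rw [shift_apply, Finsupp.add_apply, Finsupp.mapDomain_apply Nat.succ_injective]
    simp

theorem sum_eq_add_sum_shift {M : Type*} [AddCommMonoid M] (R : ℕ →₀ ℕ) (f : ℕ → ℕ → M)
    (hf : ∀ k, f k 0 = 0) : R.sum f = f 0 (R 0) + (shift R).sum fun k r => f (k + 1) r := by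
  obtain ⟨N, hN⟩ : ∃ N, R.support ⊆ Finset.range (N + 1) :=
    ⟨R.support.sup id, fun n hn => by
      simpa [Nat.lt_succ_iff] using Finset.le_sup (f := id) hn⟩
  have hN' : (shift R).support ⊆ Finset.range N := fun n hn => by
    have : n + 1 ∈ R.support := by simpa using hn
    have := hN this
    simp only [Finset.mem_range] at this ⊢
    omega
  rw [Finsupp.sum_of_support_subset _ hN _ (fun k _ => hf k),
    Finsupp.sum_of_support_subset _ hN' _ (fun k _ => hf (k + 1)), Finset.sum_range_succ', add_comm]
  rfl

/-- The first entry `∑ R k q ^ k` of the admissible word attached to `R`. -/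
def top (q : ℕ) (R : ℕ →₀ ℕ) : ℕ := R.sum fun k r => r * q ^ k

/-- Read as `a₁ = R 0 + q a₂`: the entries of `R` are the excesses in the admissibility inequalities
of the word. -/
theorem top_eq (q : ℕ) (R : ℕ →₀ ℕ) : top q R = R 0 + q * top q (shift R) := by
  rw [top, sum_eq_add_sum_shift _ _ (by simp), top, Finsupp.mul_sum]
  simp only [pow_zero, mul_one, pow_succ]
  congr 1
  exact Finsupp.sum_congr fun k _ => by ring

@[simp] theorem top_zero (q : ℕ) : top q 0 = 0 := Finsupp.sum_zero_index

/-- The degree `(q ^ (k + 1) - 1) / (q - 1)` of the generator in position `k`. -/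
def genDegree (q k : ℕ) : ℕ := ∑ i ∈ Finset.range (k + 1), q ^ i

/-- The degree of the monomial with exponents `R`. -/
def degree (q : ℕ) (R : ℕ →₀ ℕ) : ℕ := R.sum fun k r => r * genDegree q k

/-- Comes from `genDegree q (k + 1) = genDegree q k + q ^ (k + 1)`; iterated, it identifies the
degree of `R` with the sum of its word. -/
theorem degree_eq (q : ℕ) (R : ℕ →₀ ℕ) : degree q R = top q R + degree q (shift R) := by
  rw [degree, sum_eq_add_sum_shift _ _ (by simp), top,
    sum_eq_add_sum_shift R (fun k r => r * q ^ k) (by simp), degree, add_assoc, ← Finsupp.sum_add]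
  simp only [genDegree, ← mul_add]
  have h : genDegree q 0 = q ^ 0 := by simp [genDegree]
  congr 1
  refine Finsupp.sum_congr fun k _ => ?_
  rw [Finset.sum_range_succ _ (k + 1), add_comm]

@[simp] theorem degree_zero (q : ℕ) : degree q 0 = 0 := Finsupp.sum_zero_index

theorem succ_le_genDegree {q : ℕ} (hq : 1 ≤ q) (k : ℕ) : k + 1 ≤ genDegree q k := by
  calc k + 1 = ∑ i ∈ Finset.range (k + 1), 1 := by simp
    _ ≤ _ := Finset.sum_le_sum fun i _ => Nat.one_le_pow _ _ hq

theorem wt_le_degree {q : ℕ} (hq : 1 ≤ q) (R : ℕ →₀ ℕ) : MilnorDual.wt R ≤ degree q R := by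
  rw [MilnorDual.wt, Finsupp.weight_apply]
  exact Finset.sum_le_sum fun k _ => Nat.mul_le_mul_left _ (succ_le_genDegree hq k)

theorem finite_degree_eq {q : ℕ} (hq : 1 ≤ q) (d : ℕ) : {R | degree q R = d}.Finite :=
  (MilnorDual.finite_wt_lt (d + 1)).subset fun R hR => by
    have h1 := wt_le_degree hq R
    have h2 : degree q R = d := hR
    simp only [Set.mem_ofPred_eq]
    omega

/-- The first `n` entries of the admissible word attached to `R`. -/
def word (q : ℕ) : ℕ → (ℕ →₀ ℕ) → List ℕ
  | 0, _ => []
  | n + 1, R => top q R :: word q n (shift R)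

/-- A bound for the positions of the nonzero entries of `R`. -/
def len (R : ℕ →₀ ℕ) : ℕ := R.support.sup Nat.succ

theorem apply_eq_zero_of_len_le {R : ℕ →₀ ℕ} {k : ℕ} (h : len R ≤ k) : R k = 0 := by
  by_contra h0
  have : k.succ ≤ len R := Finset.le_sup (f := Nat.succ) (Finsupp.mem_support_iff.mpr h0)
  omega

theorem sum_word {q n : ℕ} {R : ℕ →₀ ℕ} (h : ∀ k, n ≤ k → R k = 0) :
    (word q n R).sum = degree q R := by
  induction n generalizing R with
  | zero =>
    have : R = 0 := by ext k; exact h k (Nat.zero_le k)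
    simp [this, word]
  | succ n ih =>
    rw [word, List.sum_cons, ih fun k hk => h (k + 1) (by omega), ← degree_eq]

section Admissible

variable {A : Type*} [Monoid A] (q : ℕ) (x : ℕ → A)

/-- The product of the values of `x` along the admissible word attached to `R`. -/
def adm (R : ℕ →₀ ℕ) : A := ((word q (len R) R).map x).prod

variable {q x}

/-- Beyond the support of `R` the word continues with zeros, which contribute factors `x 0 = 1`. The
cut-off in `adm` is thus immaterial. -/
theorem prod_word_add (h0 : x 0 = 1) {n : ℕ} (m : ℕ) {R : ℕ →₀ ℕ} (h : ∀ k, n ≤ k → R k = 0) :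
    ((word q (n + m) R).map x).prod = ((word q n R).map x).prod := by
  induction n generalizing R with
  | zero =>
    have : R = 0 := by ext k; exact h k (Nat.zero_le k)
    subst this
    induction m with
    | zero => rfl
    | succ m ih => 
      have h1 : word q (0 + (m + 1)) 0 = 0 :: word q (0 + m) 0 := by
        rw [← add_assoc, word, shift_zero, top_zero]
      rw [h1, List.map_cons, List.prod_cons, h0, one_mul, ih]
  | succ n ih =>
    rw [Nat.add_right_comm, word, word, List.map_cons, List.prod_cons, List.map_cons,
      List.prod_cons, ih fun k hk => h (k + 1) (by omega)]

theorem adm_eq (h0 : x 0 = 1) {n : ℕ} {R : ℕ →₀ ℕ} (h : ∀ k, n ≤ k → R k = 0) :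
    adm q x R = ((word q n R).map x).prod := by
  rcases le_total (len R) n with hn | hn
  · obtain ⟨m, rfl⟩ := Nat.exists_eq_add_of_le hn
    exact (prod_word_add h0 m fun k => apply_eq_zero_of_len_le).symm
  · obtain ⟨m, hm⟩ := Nat.exists_eq_add_of_le hn
    rw [adm, hm, prod_word_add h0 m h]

theorem adm_zero : adm q x 0 = 1 := by simp [adm, len, word]

theorem adm_eq_mul (h0 : x 0 = 1) (R : ℕ →₀ ℕ) :
    adm q x R = x (top q R) * adm q x (shift R) := by
  rw [adm_eq h0 (n := len R + 1) (fun k hk => apply_eq_zero_of_len_le (by omega)), word,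
    List.map_cons, List.prod_cons, ← adm_eq h0 (n := len R) (R := shift R)
      (fun k hk => apply_eq_zero_of_len_le (R := R) (by omega))]

theorem map_adm {B F : Type*} [Monoid B] [FunLike F A B] [MonoidHomClass F A B] (f : F)
    (R : ℕ →₀ ℕ) : f (adm q x R) = adm q (fun r => f (x r)) R := by
  rw [adm, adm, map_list_prod, List.map_map]; rfl

end Admissible

/-- Every admissible word is attached to an exponent sequence. -/
theorem exists_word_eq {q : ℕ} (l : List ℕ) (hl : l.IsChain fun a b => q * b ≤ a) :
    ∃ R : ℕ →₀ ℕ, (∀ k, l.length ≤ k → R k = 0) ∧ word q l.length R = l := by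
  induction l with
  | nil => exact ⟨0, fun _ _ => rfl, rfl⟩
  | cons a l ih =>
    obtain ⟨S, hS, hw⟩ := ih hl.tail
    have ha : q * top q S ≤ a := by
      cases l with
      | nil =>
        have : S = 0 := by ext k; exact hS k (Nat.zero_le k)
        simp [this]
      | cons b l =>
        rw [List.length_cons, word, List.cons.injEq] at hw
        rw [hw.1]
        exact (List.isChain_cons_cons.mp hl).1
    -- The new first exponent is the slack in the inequality between the first two entries.
    obtain ⟨R, h0, hR⟩ := exists_shift_eq (a - q * top q S) S
    refine ⟨R, fun k hk => ?_, ?_⟩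
    · rw [List.length_cons] at hk
      obtain ⟨k, rfl⟩ : ∃ k', k = k' + 1 := ⟨k - 1, by omega⟩
      rw [← shift_apply, hR]
      exact hS k (by omega)
    · rw [List.length_cons, word, hR, hw, top_eq, hR, h0, Nat.sub_add_cancel ha]

theorem exists_of_not_isChain {α : Type*} {r : α → α → Prop} (l : List α) (h : ¬ l.IsChain r) :
    ∃ l₁ a b l₂, l = l₁ ++ a :: b :: l₂ ∧ ¬ r a b := by
  induction l with
  | nil => exact absurd .nil h
  | cons a l ih =>
    cases l with
    | nil => exact absurd (.singleton a) h
    | cons b l =>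
      by_cases hab : r a b
      · obtain ⟨l₁, c, d, l₂, hl, hcd⟩ := ih fun hc => h (List.isChain_cons_cons.mpr ⟨hab, hc⟩)
        exact ⟨a :: l₁, c, d, l₂, by rw [hl]; rfl, hcd⟩
      · exact ⟨[], a, b, l, rfl, hab⟩

/-- The moment `∑ i aᵢ` of a word. -/
def moment : List ℕ → ℕ
  | [] => 0
  | _ :: l => moment l + l.sum

/-- The termination measure for Adem rewriting: moving weight one place to the left lowers the
moment. -/
theorem moment_append_lt {a b a' b' : ℕ} (h : a + b = a' + b') (hb : b' < b) (l₁ l₂ : List ℕ) :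
    moment (l₁ ++ a' :: b' :: l₂) < moment (l₁ ++ a :: b :: l₂) := by
  induction l₁ with
  | nil => simp only [List.nil_append, moment, List.sum_cons]; omega
  | cons c l ih =>
    simp only [List.cons_append, moment, List.sum_append, List.sum_cons]
    omega

/-! ### Sequences satisfying the Adem relations -/

/-- The coefficients in the Adem relations. -/
def ademCoeff (K : Type*) [CommRing K] (q a b j : ℕ) : K :=
  (-1) ^ (a + j) * (((q - 1) * (b - j) - 1).choose (a - q * j) : K)

/-- The sequence `x` satisfies `x 0 = 1` and the Adem relations. -/
structure IsAdem (K : Type*) {A : Type*} [CommRing K] [Ring A] [Algebra K A] (q : ℕ) (x : ℕ → A) :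
    Prop where
  zero : x 0 = 1
  mul_eq : ∀ a b, a < q * b → x a * x b =
    ∑ j ∈ Finset.range (a / q + 1), ademCoeff K q a b j • (x (a + b - j) * x j)

namespace IsAdem

variable {K A : Type*} [CommRing K] [Ring A] [Algebra K A] {q : ℕ} {x : ℕ → A}

theorem map {B F : Type*} [Ring B] [Algebra K B] [FunLike F A B] [AlgHomClass F K A B] (f : F)
    (h : IsAdem K q x) : IsAdem K q fun r => f (x r) where
  zero := by rw [h.zero, map_one]
  mul_eq a b hab := by
    rw [← map_mul, h.mul_eq a b hab, map_sum]
    simp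

theorem lt_of_le_div {a b j : ℕ} (hab : a < q * b) (hj : j ≤ a / q) : j < b := by
  have h1 : q * j ≤ a := (Nat.mul_le_mul_left q hj).trans (Nat.mul_div_le a q)
  exact Nat.lt_of_mul_lt_mul_left (h1.trans_lt hab)

/-- An inadmissible adjacent pair `(a, b)` is replaced by pairs `(a + b - j, j)` with `j < b`, which
keeps the sum and lowers the moment; strong induction on the moment concludes. -/
theorem prod_mem_span_chain (h : IsAdem K q x) (l : List ℕ) : (l.map x).prod ∈
    Submodule.span K {y | ∃ l' : List ℕ, l'.IsChain (fun a b => q * b ≤ a) ∧ l'.sum = l.sum ∧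
      y = (l'.map x).prod} := by
  induction hm : moment l using Nat.strong_induction_on generalizing l with
  | _ m ih =>
    by_cases hl : l.IsChain fun a b => q * b ≤ a
    · exact Submodule.subset_span ⟨l, hl, rfl, rfl⟩
    · obtain ⟨l₁, a, b, l₂, rfl, hab⟩ := exists_of_not_isChain l hl
      rw [not_le] at hab
      have h1 : ((l₁ ++ a :: b :: l₂).map x).prod = ∑ j ∈ Finset.range (a / q + 1),
          ademCoeff K q a b j • ((l₁ ++ (a + b - j) :: j :: l₂).map x).prod := by
        simp only [List.map_append, List.map_cons, List.prod_append, List.prod_cons]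
        rw [← mul_assoc (x a), h.mul_eq a b hab, Finset.sum_mul, Finset.mul_sum]
        simp [mul_assoc]
      rw [h1]
      refine Submodule.sum_mem _ fun j hj => Submodule.smul_mem _ _ ?_
      have hjb := lt_of_le_div hab (Nat.lt_succ_iff.mp (Finset.mem_range.mp hj))
      have := ih _ (hm ▸ moment_append_lt (by omega : a + b = a + b - j + j) hjb l₁ l₂) _ rfl
      rwa [show (l₁ ++ (a + b - j) :: j :: l₂).sum = (l₁ ++ a :: b :: l₂).sum by
        simp only [List.sum_append, List.sum_cons]; omega] at this

theorem prod_mem_span_adm (h : IsAdem K q x) (l : List ℕ) :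
    (l.map x).prod ∈ Submodule.span K (adm q x '' {R | degree q R = l.sum}) := by
  refine Submodule.span_mono ?_ (h.prod_mem_span_chain l)
  rintro _ ⟨l', hl', hs, rfl⟩
  obtain ⟨R, hR, hw⟩ := exists_word_eq l' hl'
  refine ⟨R, ?_, ?_⟩
  · change degree q R = _
    rw [← sum_word hR, hw, hs]
  · rw [adm_eq h.zero hR, hw]

end IsAdem

/-! ### Universal property and admissible spanning set of the presented algebra -/

namespace SteenrodPowers

variable (K : Type*) [CommRing K] (q : ℕ)

theorem isAdem_P : IsAdem K q (P K q) where
  zero := by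
    have h := RingQuot.mkAlgHom_rel K (AdemRel.zero (K := K) (q := q))
    rw [map_one] at h
    exact h
  mul_eq a b hab := by
    have h := RingQuot.mkAlgHom_rel K (AdemRel.adem (K := K) (q := q) a b hab)
    simp only [map_mul, map_sum, map_smul] at h
    exact h

variable {K q} {A : Type*} [Ring A] [Algebra K A] {x : ℕ → A}

/-- The algebra map determined by a sequence satisfying the Adem relations. -/
def lift (h : IsAdem K q x) : SteenrodPowers K q →ₐ[K] A :=
  RingQuot.liftAlgHom K ⟨FreeAlgebra.lift K x, by
    intro y z hyz
    cases hyz with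
    | zero => simp [h.zero]
    | adem a b hab => simpa [ademCoeff] using h.mul_eq a b hab⟩

@[simp] theorem lift_P (h : IsAdem K q x) (r : ℕ) : lift h (P K q r) = x r := by
  refine (RingQuot.liftAlgHom_mkAlgHom_apply K (s := AdemRel K q) _ _ _).trans ?_
  simp

theorem mem_span_prod (y : SteenrodPowers K q) :
    y ∈ Submodule.span K (Set.range fun l : List ℕ => (l.map (P K q)).prod) := by
  obtain ⟨z, rfl⟩ := RingQuot.mkAlgHom_surjective K (AdemRel K q) y
  let S := Submodule.span K (Set.range fun l : List ℕ => (l.map (P K q)).prod)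
  have hmul : ∀ u ∈ S, ∀ v ∈ S, u * v ∈ S := by
    intro u hu v hv
    have h := Submodule.mul_mem_mul hu hv
    rw [Submodule.span_mul_span] at h
    refine Submodule.span_mono ?_ h
    rintro _ ⟨_, ⟨l, rfl⟩, _, ⟨l', rfl⟩, rfl⟩
    exact ⟨l ++ l', by simp⟩
  have h1 : (1 : SteenrodPowers K q) ∈ S := Submodule.subset_span ⟨[], rfl⟩
  change RingQuot.mkAlgHom K (AdemRel K q) z ∈ S
  induction z using FreeAlgebra.induction with
  | grade0 c =>
    rw [AlgHom.commutes]
    exact (Algebra.algebraMap_eq_smul_one (A := SteenrodPowers K q) c) ▸ S.smul_mem c h1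
  | grade1 r => exact Submodule.subset_span ⟨[r], List.prod_singleton⟩
  | mul u v hu hv => rw [map_mul]; exact hmul _ hu _ hv
  | add u v hu hv => rw [map_add]; exact S.add_mem hu hv

theorem homogeneous_eq (d : ℕ) :
    homogeneous K q d = Submodule.span K (adm q (P K q) '' {R | degree q R = d}) := by
  apply le_antisymm
  · refine Submodule.span_le.mpr ?_
    rintro _ ⟨l, rfl, rfl⟩
    exact (isAdem_P K q).prod_mem_span_adm l
  · refine Submodule.span_mono ?_
    rintro _ ⟨R, hR, rfl⟩
    exact ⟨_, (sum_word fun k => apply_eq_zero_of_len_le).trans hR, rfl⟩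

theorem span_adm : Submodule.span K (Set.range (adm q (P K q))) = ⊤ := by
  refine eq_top_iff.mpr fun y _ => ?_
  refine Submodule.span_le.mpr ?_ (mem_span_prod y)
  rintro _ ⟨l, rfl⟩
  exact Submodule.span_mono (Set.image_subset_range _ _) ((isAdem_P K q).prod_mem_span_adm l)

end SteenrodPowers

section

open MilnorDual

/-! ### The dual of `A'_q` and the action of the generators -/

variable {p : ℕ} [Fact p.Prime] {e q : ℕ}

variable (p) in
/-- The subalgebra `𝔽_p[ξ_e, ξ_{2e}, …]`. -/
def embed (e : ℕ) : MvPolynomial ℕ (ZMod p) →ₐ[ZMod p] MilnorDual p :=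
  MvPolynomial.aeval fun k => xi p ((k + 1) * e)

theorem embed_X (e k : ℕ) : embed p e (MvPolynomial.X k) = xi p ((k + 1) * e) :=
  MvPolynomial.aeval_X _ _

variable (p) in
/-- The generating function of the elements `P_e^r`, an algebra map. -/
def powerHom (e : ℕ) : MilnorDual p →ₐ[ZMod p] Polynomial (ZMod p) :=
  MilnorDual.lift fun n => if n + 1 = e then Polynomial.X else 0

theorem powerHom_xi (e k : ℕ) : powerHom p e (xi p (k + 1)) =
    if k + 1 = e then Polynomial.X else 0 := MilnorDual.lift_xi _ _

theorem powerHom_mono_single (he : 1 ≤ e) (r : ℕ) :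
    powerHom p e (mono p (Finsupp.single (e - 1) r)) = Polynomial.X ^ r := by
  rw [mono_eq_prod, Finsupp.prod_single_index (h := fun n r => xi p (n + 1) ^ r) (pow_zero _), map_pow, powerHom_xi,
    if_pos (by omega)]

/-- Both sides are linear in `x`, and on monomials both see only the powers of `ξ_e`. -/
theorem coeff_powerHom (he : 1 ≤ e) (r : ℕ) (x : MilnorDual p) :
    (powerHom p e x).coeff r = (milnorP p (Finsupp.single (e - 1) r)).1 x := by
  suffices h : Polynomial.lcoeff (ZMod p) r ∘ₗ (powerHom p e).toLinearMap =
      (milnorP p (Finsupp.single (e - 1) r)).1.ofConv from LinearMap.congr_fun h x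
  refine (basis p).ext fun R => ?_
  rw [basis_apply]
  change (powerHom p e (mono p R)).coeff r = (milnorP p (Finsupp.single (e - 1) r)).1 (mono p R)
  rw [milnorP_mono]
  by_cases hR : ∃ n, n ≠ e - 1 ∧ R n ≠ 0
  · obtain ⟨n, hn, hRn⟩ := hR
    rw [if_neg (fun h => hRn (by rw [← h, Finsupp.single_eq_of_ne hn])), mono_eq_prod,
      Finsupp.prod, map_prod, Finset.prod_eq_zero (Finsupp.mem_support_iff.mpr hRn),
      Polynomial.coeff_zero]
    rw [map_pow, powerHom_xi, if_neg (by omega), zero_pow hRn]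
  · push Not at hR
    obtain ⟨s, rfl⟩ : ∃ s, R = Finsupp.single (e - 1) s := by
      refine ⟨R (e - 1), ?_⟩
      ext n
      by_cases hn : n = e - 1
      · rw [hn, Finsupp.single_eq_same]
      · rw [Finsupp.single_eq_of_ne hn, hR n hn]
    rw [powerHom_mono_single he, Polynomial.coeff_X_pow]
    exact if_congr (Finsupp.single_injective (e - 1) |>.eq_iff).symm rfl rfl

variable (p) in
/-- The generating function of the transposes of the left multiplications by `P_e^r`. -/
def actHom (e : ℕ) : MilnorDual p →ₐ[ZMod p] Polynomial (MilnorDual p) :=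
  (Algebra.TensorProduct.lift
    ((Polynomial.mapAlgHom (Algebra.ofId (ZMod p) (MilnorDual p))).comp (powerHom p e))
    (Algebra.algHom (ZMod p) (MilnorDual p) (Polynomial (MilnorDual p)))
    (fun _ _ => Commute.all _ _)).comp (comulHom p)

/-- The product is convolution, so `P_e^r` acts on the left tensor factor of the coproduct, where it
is the coefficient of `t^r` in `powerHom`. -/
theorem milnorP_mul_apply (he : 1 ≤ e) (r : ℕ) (f : SteenrodAlgebra p) (x : MilnorDual p) :
    (milnorP p (Finsupp.single (e - 1) r) * f).1 x = f.1 ((actHom p e x).coeff r) := by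
  have key : ∀ u : MilnorDual p ⊗[ZMod p] MilnorDual p,
      LinearMap.mul' (ZMod p) (ZMod p)
        (TensorProduct.map (milnorP p (Finsupp.single (e - 1) r)).1.ofConv f.1.ofConv u) =
      f.1.ofConv ((Algebra.TensorProduct.lift
        ((Polynomial.mapAlgHom (Algebra.ofId (ZMod p) (MilnorDual p))).comp (powerHom p e))
        (Algebra.algHom (ZMod p) (MilnorDual p) (Polynomial (MilnorDual p)))
        (fun _ _ => Commute.all _ _) u).coeff r) := by
    intro u
    induction u with
    | zero => simp
    | add a b ha hb => simp only [map_add, ha, hb, Polynomial.coeff_add]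
    | tmul a b =>
      rw [TensorProduct.map_tmul, LinearMap.mul'_apply, Algebra.TensorProduct.lift_tmul]
      have h1 : (milnorP p (Finsupp.single (e - 1) r)).1.ofConv a = (powerHom p e a).coeff r :=
        (coeff_powerHom he r a).symm
      have h2 : (Algebra.algHom (ZMod p) (MilnorDual p) (Polynomial (MilnorDual p))) b =
        Polynomial.C b := rfl
      rw [h1, h2, Polynomial.coeff_mul_C]
      have h3 : (((Polynomial.mapAlgHom (Algebra.ofId (ZMod p) (MilnorDual p))).comp
          (powerHom p e)) a).coeff r = algebraMap (ZMod p) (MilnorDual p)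
            ((powerHom p e a).coeff r) := by
        simp
      rw [h3, ← Algebra.smul_def, map_smul, smul_eq_mul]
  exact key _

variable (p) in
/-- The map `ζ_k ↦ ζ_k + t^{q^{k-1}} ζ_{k-1}` (where `ζ_0 = 1`). -/
def lowerHom (q : ℕ) : MvPolynomial ℕ (ZMod p) →ₐ[ZMod p] Polynomial (MvPolynomial ℕ (ZMod p)) :=
  MvPolynomial.aeval fun k => Polynomial.C (MvPolynomial.X k) +
    Polynomial.X ^ q ^ k * Polynomial.C (if k = 0 then 1 else MvPolynomial.X (k - 1))

theorem lowerHom_X (q k : ℕ) : lowerHom p q (MvPolynomial.X k) =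
    Polynomial.C (MvPolynomial.X k) +
    Polynomial.X ^ q ^ k * Polynomial.C (if k = 0 then 1 else MvPolynomial.X (k - 1)) :=
  MvPolynomial.aeval_X _ _

/-- In `∑ ξ_{m-i}^{p^i} ⊗ ξ_i` with `m = (k + 1)e`, the left factor survives `powerHom` only when `m
- i` is `0` or `e`, that is, for `i = m` and `i = ke`. -/
theorem actHom_xi (he : 1 ≤ e) (k : ℕ) : actHom p e (xi p ((k + 1) * e)) =
    Polynomial.C (xi p ((k + 1) * e)) + Polynomial.X ^ p ^ (k * e) * Polynomial.C (xi p (k * e)) := by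
  have hp0 : ∀ i : ℕ, p ^ i ≠ 0 := fun i => (Nat.pow_pos (Nat.Prime.pos Fact.out)).ne'
  have h1 : actHom p e (xi p ((k + 1) * e)) = ∑ i ∈ Finset.range ((k + 1) * e + 1),
      ((powerHom p e (xi p ((k + 1) * e - i))).map (algebraMap (ZMod p) (MilnorDual p))) ^ p ^ i *
        Polynomial.C (xi p i) := by
    rw [actHom, AlgHom.comp_apply, comulHom_xi, map_sum]
    refine Finset.sum_congr rfl fun i _ => ?_
    rw [Algebra.TensorProduct.lift_tmul, map_pow]
    rfl
  have hlt : k * e < (k + 1) * e := by nlinarith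
  rw [h1, Finset.sum_range_succ, Finset.sum_eq_single (k * e)]
  · have h2 : (k + 1) * e - k * e = (e - 1) + 1 := by
      have : (k + 1) * e = k * e + e := by ring
      omega
    rw [h2, powerHom_xi, if_pos (by omega), Nat.sub_self, xi_zero, map_one, Polynomial.map_one,
      one_pow, one_mul, Polynomial.map_X, add_comm]
  · intro i hi hne
    have hi : i < (k + 1) * e := Finset.mem_range.mp hi
    have h3 : (k + 1) * e = k * e + e := by ring
    obtain ⟨m, hm⟩ : ∃ m, (k + 1) * e - i = m + 1 := ⟨(k + 1) * e - i - 1, by omega⟩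
    rw [hm, powerHom_xi, if_neg (by omega), Polynomial.map_zero, zero_pow (hp0 i), zero_mul]
  · intro h
    exact absurd (Finset.mem_range.mpr hlt) h

/-- The action preserves `𝔽_p[ξ_e, ξ_{2e}, …]`, where `p ^ (ke) = q ^ k` leaves a formula in `q`
alone. -/
theorem actHom_embed (hq : q = p ^ e) (he : 1 ≤ e) (z : MvPolynomial ℕ (ZMod p)) :
    actHom p e (embed p e z) = (lowerHom p q z).map (embed p e : _ →+* MilnorDual p) := by
  suffices h : (actHom p e).comp (embed p e) =
      (Polynomial.mapAlgHom (embed p e)).comp (lowerHom p q) from DFunLike.congr_fun h z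
  refine MvPolynomial.algHom_ext fun k => ?_
  rw [AlgHom.comp_apply, AlgHom.comp_apply, embed_X, actHom_xi he, lowerHom_X, hq, ← pow_mul,
    mul_comm k e]
  simp only [Polynomial.coe_mapAlgHom, Polynomial.map_add, Polynomial.map_mul,
    Polynomial.map_pow, Polynomial.map_X, Polynomial.map_C, RingHom.coe_coe, embed_X]
  cases k with
  | zero => simp
  | succ k => simp [embed_X, mul_comm e]

variable (p) in
/-- The restriction of a functional to `𝔽_p[ξ_e, ξ_{2e}, …]`. -/
def restrict (e : ℕ) : SteenrodAlgebra p →ₗ[ZMod p] (MvPolynomial ℕ (ZMod p) →ₗ[ZMod p] ZMod p) :=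
  LinearMap.lcomp (ZMod p) (ZMod p) (embed p e).toLinearMap ∘ₗ toDual p

theorem restrict_apply (f : SteenrodAlgebra p) (z : MvPolynomial ℕ (ZMod p)) :
    restrict p e f z = f.1 (embed p e z) := rfl

theorem restrict_milnorP_mul (hq : q = p ^ e) (he : 1 ≤ e) (r : ℕ) (f : SteenrodAlgebra p)
    (z : MvPolynomial ℕ (ZMod p)) :
    restrict p e (milnorP p (Finsupp.single (e - 1) r) * f) z =
      restrict p e f ((lowerHom p q z).coeff r) := by
  rw [restrict_apply, restrict_apply, milnorP_mul_apply he, actHom_embed hq he,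
    Polynomial.coeff_map]
  rfl

theorem restrict_milnorP (he : 1 ≤ e) (r : ℕ) (z : MvPolynomial ℕ (ZMod p)) :
    restrict p e (milnorP p (Finsupp.single (e - 1) r)) z =
      (powerHom p e (embed p e z)).coeff r := (coeff_powerHom he r _).symm

theorem powerHom_embed (he : 1 ≤ e) (k : ℕ) : powerHom p e (embed p e (MvPolynomial.X k)) =
    if k = 0 then Polynomial.X else 0 := by
  have h1 : (k + 1) * e = k * e + (e - 1) + 1 := by
    have : (k + 1) * e = k * e + e := by ring
    omega
  rw [embed_X, h1, powerHom_xi]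
  refine if_congr ?_ rfl rfl
  constructor
  · intro h
    have : k * e = 0 := by omega
    rcases Nat.mul_eq_zero.mp this with h | h <;> omega
  · rintro rfl; omega

/-- The exponent sequence of the monomial `ζ^S`. -/
def spread (e : ℕ) (S : ℕ →₀ ℕ) : ℕ →₀ ℕ := S.mapDomain fun k => (k + 1) * e - 1

theorem spread_index_injective (he : 1 ≤ e) : Function.Injective fun k : ℕ => (k + 1) * e - 1 := by
  intro k l h
  have h1 : 1 ≤ (k + 1) * e := Nat.mul_pos (by omega) he
  have h2 : 1 ≤ (l + 1) * e := Nat.mul_pos (by omega) he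
  have h3 : (k + 1) * e - 1 = (l + 1) * e - 1 := h
  have : (k + 1) * e = (l + 1) * e := by omega
  have := Nat.eq_of_mul_eq_mul_right he this
  omega

theorem spread_injective (he : 1 ≤ e) : Function.Injective (spread e) :=
  Finsupp.mapDomain_injective (spread_index_injective he)

theorem embed_monomial (he : 1 ≤ e) (S : ℕ →₀ ℕ) :
    embed p e (MvPolynomial.monomial S 1) = mono p (spread e S) := by
  rw [mono_eq_prod, spread, Finsupp.prod_mapDomain_index_inj (spread_index_injective he),
    MvPolynomial.monomial_eq, map_mul, MvPolynomial.C_1, map_one, one_mul, Finsupp.prod,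
    Finsupp.prod, map_prod]
  refine Finset.prod_congr rfl fun k _ => ?_
  rw [map_pow, embed_X, Nat.sub_add_cancel (Nat.mul_pos (by omega) he)]

theorem supportedOn_iff (he : 1 ≤ e) (R : ℕ →₀ ℕ) : SupportedOn e R ↔ ∃ S, spread e S = R := by
  constructor
  · intro h
    refine ⟨R.comapDomain _ (spread_index_injective he).injOn,
      Finsupp.mapDomain_comapDomain _ (spread_index_injective he) R fun n hn => ?_⟩
    obtain ⟨c, hc⟩ := h n (Finsupp.mem_support_iff.mp hn)
    have hc0 : c ≠ 0 := by rintro rfl; simp at hc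
    refine ⟨c - 1, ?_⟩
    change (c - 1 + 1) * e - 1 = n
    rw [Nat.sub_add_cancel (by omega), mul_comm, ← hc, Nat.add_sub_cancel]
  · rintro ⟨S, rfl⟩ n hn
    by_contra hd
    refine hn (Finsupp.mapDomain_of_notMem_range _ _ ?_)
    rintro ⟨k, rfl⟩
    refine hd ⟨k + 1, ?_⟩
    change (k + 1) * e - 1 + 1 = _
    rw [Nat.sub_add_cancel (Nat.mul_pos (by omega) he), mul_comm]

variable (p) in
/-- The pairing between `A'_q` and the monomials of its dual. -/
def pairing (e : ℕ) : milnorSubalgebra p e →ₗ[ZMod p] ((ℕ →₀ ℕ) → ZMod p) :=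
  LinearMap.pi fun S => LinearMap.applyₗ (MvPolynomial.monomial S (1 : ZMod p)) ∘ₗ
    restrict p e ∘ₗ (milnorSubalgebra p e).val.toLinearMap

/-- An element of `A'_q` is unchanged by composition with `proj p e`, so it vanishes on every
monomial involving some `ξ_j` with `e ∤ j`; the other monomials are the `ζ^S`. -/
theorem pairing_injective (he : 1 ≤ e) : Function.Injective (pairing p e) := by
  rw [injective_iff_map_eq_zero]
  intro f hf
  apply Subtype.ext
  refine ext_mono fun R => ?_
  have h0 : ∀ R, (0 : SteenrodAlgebra p).1 (mono p R) = 0 := fun R => rfl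
  change f.1.1 (mono p R) = (0 : SteenrodAlgebra p).1 (mono p R)
  rw [h0]
  by_cases hR : SupportedOn e R
  · obtain ⟨S, rfl⟩ := (supportedOn_iff he R).mp hR
    rw [← embed_monomial he]
    exact congrFun hf S
  · have h : f.1 ∈ milnorSpan p e := f.2
    rw [mem_milnorSpan_iff] at h
    have h1 := LinearMap.congr_fun h (mono p R)
    change toDual p f.1 (proj p e (mono p R)) = f.1.1 (mono p R) at h1
    rw [← h1, proj_mono_of_not_supported hR, map_zero]

end

section

open MilnorDual

variable {p : ℕ} [Fact p.Prime] {e q : ℕ}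

theorem ne_or_ne_of_add_ne_zero {M : Type*} [AddZeroClass M] {a b : M} (h : a + b ≠ 0) :
    a ≠ 0 ∨ b ≠ 0 := by
  by_contra! h0
  exact h (by rw [h0.1, h0.2, add_zero])

/-! ### The Adem relations in `A'_q` -/

/-- The coefficient of `ζ₁^m ζ₂^n` in the product of two generators. -/
def mulCoeff (p q a b m n : ℕ) : ZMod p :=
  if a + b = m + (q + 1) * n ∧ n ≤ b then (m.choose (b - n) : ZMod p) else 0

/-- Splitting off `ζ₂^n` replaces `(a, b)` by `(a - qn, b - n)` and `j` by `j - n`, which reduces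
the identity to `choose_eq_sum`. -/
theorem mulCoeff_eq_sum (hq : q = p ^ e) (he : 1 ≤ e) {a b : ℕ} (hab : a < q * b) (m n : ℕ) :
    mulCoeff p q a b m n = ∑ j ∈ Finset.range (a / q + 1),
      ademCoeff (ZMod p) q a b j * mulCoeff p q (a + b - j) j m n := by
  have hq0 : 0 < q := Nat.pos_of_mul_pos_right (by omega : 0 < q * b)
  have hle : ∀ j ∈ Finset.range (a / q + 1), j ≤ a := fun j hj =>
    (Nat.lt_succ_iff.mp (Finset.mem_range.mp hj)).trans (Nat.div_le_self a q)
  by_cases hd : a + b = m + (q + 1) * n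
  swap
  · rw [mulCoeff, if_neg (fun h => hd h.1)]
    refine (Finset.sum_eq_zero fun j hj => ?_).symm
    have := hle j hj
    rw [mulCoeff, if_neg (fun h => hd (by omega)), mul_zero]
  have hqn : (q + 1) * n = q * n + n := by ring
  -- If `a < q * n`, both sides vanish: on the left `b - n > m`, and on the right every `j ≤ a / q`
  -- is less than `n`.
  rcases lt_or_ge a (q * n) with ha | ha
  · have h1 : mulCoeff p q a b m n = 0 := by
      rw [mulCoeff]
      split_ifs with h
      · rw [Nat.choose_eq_zero_of_lt (by omega), Nat.cast_zero]
      · rfl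
    rw [h1]
    refine (Finset.sum_eq_zero fun j hj => ?_).symm
    have hj : j ≤ a / q := Nat.lt_succ_iff.mp (Finset.mem_range.mp hj)
    have : q * j ≤ a := (Nat.mul_le_mul_left q hj).trans (Nat.mul_div_le a q)
    have hjn : j < n := Nat.lt_of_mul_lt_mul_left (this.trans_lt ha)
    rw [mulCoeff, if_neg (fun h => by omega), mul_zero]
  · obtain ⟨c, rfl⟩ := Nat.exists_eq_add_of_le' ha
    have hnb : n < b := Nat.lt_of_mul_lt_mul_left (ha.trans_lt hab)
    obtain ⟨d, rfl⟩ := Nat.exists_eq_add_of_le' hnb.le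
    have hm : m = c + d := by omega
    have hcd : c < q * d := by
      have : q * (d + n) = q * d + q * n := by ring
      omega
    have hdiv : (c + q * n) / q + 1 = n + (c / q + 1) := by
      rw [Nat.add_mul_div_left _ _ hq0]; ring
    rw [mulCoeff, if_pos ⟨hd, by omega⟩, Nat.add_sub_cancel, hm, choose_eq_sum hq he hcd, hdiv,
      Finset.sum_range_add _ n, Finset.sum_eq_zero (s := Finset.range n), zero_add]
    · refine Finset.sum_congr rfl fun j hj => ?_
      have hj : j ≤ c := (Nat.lt_succ_iff.mp (Finset.mem_range.mp hj)).trans (Nat.div_le_self c q)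
      rw [mulCoeff, if_pos ⟨by omega, by omega⟩, Nat.add_sub_cancel_left, ademCoeff]
      congr 2
      -- The shift changes the sign by `(-1)^{qn + n}`, which is `1` in `𝔽_p`: either `q` is odd or
      -- `p = 2`.
      · have h1 : (-1 : ZMod p) ^ (c + q * n + (n + j)) =
            (-1) ^ (c + j) * ((-1) ^ (q * n) * (-1) ^ n) := by ring
        rw [h1, neg_one_pow_mul_eq hq, ← mul_pow]
        simp
      · have h2 : d + n - (n + j) = d - j := by omega
        have h3 : c + q * n - q * (n + j) = c - q * j := by rw [mul_add]; omega
        rw [h2, h3]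
    · intro j hj
      have hj := Finset.mem_range.mp hj
      rw [mulCoeff, if_neg (fun h => by omega), mul_zero]

/-- With outer variable `t` and inner variable `u`, this is the coefficient of `t^a u^b` in `(u +
t)^m (t^q u)^n`. -/
theorem coeff_coeff_mul_pow (q a b m n : ℕ) :
    ((((Polynomial.C Polynomial.X + Polynomial.X) ^ m *
      (Polynomial.X ^ q * Polynomial.C Polynomial.X) ^ n :
        Polynomial (Polynomial (ZMod p))).coeff a).coeff b) = mulCoeff p q a b m n := by
  have h1 : ((Polynomial.C Polynomial.X + Polynomial.X) ^ m *
      (Polynomial.X ^ q * Polynomial.C Polynomial.X) ^ n : Polynomial (Polynomial (ZMod p))) =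
      (Polynomial.X + Polynomial.C Polynomial.X) ^ m * Polynomial.C (Polynomial.X ^ n) *
        Polynomial.X ^ (q * n) := by
    rw [mul_pow, map_pow]; ring
  have hqn : (q + 1) * n = q * n + n := by ring
  rw [h1, Polynomial.coeff_mul_X_pow']
  split_ifs with ha
  · rw [Polynomial.coeff_mul_C, Polynomial.coeff_X_add_C_pow, mul_right_comm, ← pow_add,
      ← Polynomial.C_eq_natCast, Polynomial.coeff_mul_C, Polynomial.coeff_X_pow, mulCoeff]
    rcases lt_or_ge m (a - q * n) with h | h
    · rw [Nat.choose_eq_zero_of_lt h, Nat.cast_zero, mul_zero, if_neg (by omega)]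
    · by_cases hb : b = m - (a - q * n) + n
      · rw [if_pos hb, one_mul, if_pos (by omega), ← Nat.choose_symm h, hb, Nat.add_sub_cancel]
      · rw [if_neg hb, zero_mul, if_neg (by omega)]
  · rw [Polynomial.coeff_zero, mulCoeff]
    split_ifs with h
    · rw [Nat.choose_eq_zero_of_lt (by omega), Nat.cast_zero]
    · rfl

theorem milnorPower_val (he : 1 ≤ e) (r : ℕ) :
    (milnorPower p he r : SteenrodAlgebra p) = milnorP p (Finsupp.single (e - 1) r) := rfl

theorem pairing_milnorPower_mul (hq : q = p ^ e) (he : 1 ≤ e) (r : ℕ) (f : milnorSubalgebra p e)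
    (S : ℕ →₀ ℕ) : pairing p e (milnorPower p he r * f) S =
      restrict p e f ((lowerHom p q (MvPolynomial.monomial S 1)).coeff r) :=
  restrict_milnorP_mul hq he r f _

variable (p) in
/-- The generating function of the products of two generators. -/
def mulPowerHom (e q : ℕ) : MvPolynomial ℕ (ZMod p) →ₐ[ZMod p] Polynomial (Polynomial (ZMod p)) :=
  (Polynomial.mapAlgHom ((powerHom p e).comp (embed p e))).comp (lowerHom p q)

theorem mulPowerHom_X (he : 1 ≤ e) (k : ℕ) : mulPowerHom p e q (MvPolynomial.X k) =
    if k = 0 then Polynomial.C Polynomial.X + Polynomial.X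
    else if k = 1 then Polynomial.X ^ q * Polynomial.C Polynomial.X else 0 := by
  rw [mulPowerHom, AlgHom.comp_apply, lowerHom_X, Polynomial.coe_mapAlgHom, Polynomial.map_add,
    Polynomial.map_mul, Polynomial.map_pow, Polynomial.map_X, Polynomial.map_C, Polynomial.map_C,
    RingHom.coe_coe, AlgHom.comp_apply, powerHom_embed he]
  rcases k with _ | _ | k
  · simp
  · simp [powerHom_embed he]
  · simp [powerHom_embed he]

theorem pairing_eq_coeff_mulPowerHom (hq : q = p ^ e) (he : 1 ≤ e) (a b : ℕ) (S : ℕ →₀ ℕ) :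
    pairing p e (milnorPower p he a * milnorPower p he b) S =
      ((mulPowerHom p e q (MvPolynomial.monomial S 1)).coeff a).coeff b := by
  rw [pairing_milnorPower_mul hq he, milnorPower_val, restrict_milnorP he, mulPowerHom,
    AlgHom.comp_apply, Polynomial.coe_mapAlgHom, Polynomial.coeff_map]
  rfl

-- Each factor lowers the index of `ζ_k` by at most one, and the result must be a constant; so no
-- `ζ_k` with `k ≥ 3` can occur, and `ζ₁`, `ζ₂` contribute `u + t` and `t^q u`.
open scoped Classical in
theorem pairing_milnorPower_mul_milnorPower (hq : q = p ^ e) (he : 1 ≤ e) (a b : ℕ)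
    (S : ℕ →₀ ℕ) : pairing p e (milnorPower p he a * milnorPower p he b) S =
      if ∀ k, 2 ≤ k → S k = 0 then mulCoeff p q a b (S 0) (S 1) else 0 := by
  rw [pairing_eq_coeff_mulPowerHom hq he, MvPolynomial.monomial_eq, MvPolynomial.C_1, one_mul,
    Finsupp.prod, map_prod]
  split_ifs with hS
  · have hsupp : S.support ⊆ Finset.range 2 := fun k hk => by
      by_contra h
      exact Finsupp.mem_support_iff.mp hk (hS k (not_lt.mp fun h2 => h (Finset.mem_range.mpr h2)))
    rw [Finset.prod_subset hsupp, Finset.prod_range_succ, Finset.prod_range_one, map_pow, map_pow,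
      mulPowerHom_X he, mulPowerHom_X he, if_pos rfl, if_neg one_ne_zero, if_pos rfl,
      coeff_coeff_mul_pow]
    intro k _ hk
    rw [Finsupp.notMem_support_iff.mp hk, pow_zero, map_one]
  · push Not at hS
    obtain ⟨k, hk, hSk⟩ := hS
    rw [Finset.prod_eq_zero (Finsupp.mem_support_iff.mpr hSk), Polynomial.coeff_zero,
      Polynomial.coeff_zero]
    rw [map_pow, mulPowerHom_X he, if_neg (by omega), if_neg (by omega), zero_pow hSk]

theorem milnorPower_zero (he : 1 ≤ e) : milnorPower p he 0 = 1 := by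
  apply Subtype.ext
  rw [milnorPower_val, Finsupp.single_zero, milnorP_zero]
  rfl

theorem isAdem_milnorPower (hq : q = p ^ e) (he : 1 ≤ e) :
    IsAdem (ZMod p) q (milnorPower p he) where
  zero := milnorPower_zero he
  mul_eq a b hab := by
    apply pairing_injective he
    ext S
    rw [map_sum, Finset.sum_apply]
    simp only [map_smul, Pi.smul_apply, pairing_milnorPower_mul_milnorPower hq he, smul_eq_mul]
    split_ifs
    · exact mulCoeff_eq_sum hq he hab _ _
    · simp

/-! ### Admissible monomials in `A'_q` -/

theorem shift_add (R S : ℕ →₀ ℕ) : shift (R + S) = shift R + shift S := by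
  ext; rfl

theorem top_add (q : ℕ) (R S : ℕ →₀ ℕ) : top q (R + S) = top q R + top q S :=
  Finsupp.sum_add_index' (by simp) fun _ _ _ => add_mul _ _ _

theorem degree_add (q : ℕ) (R S : ℕ →₀ ℕ) : degree q (R + S) = degree q R + degree q S :=
  Finsupp.sum_add_index' (by simp) fun _ _ _ => add_mul _ _ _

theorem top_single (q k r : ℕ) : top q (Finsupp.single k r) = r * q ^ k :=
  Finsupp.sum_single_index (zero_mul _)

theorem degree_single (q k r : ℕ) : degree q (Finsupp.single k r) = r * genDegree q k :=
  Finsupp.sum_single_index (zero_mul _)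

theorem monomial_add_one (R S : ℕ →₀ ℕ) : (MvPolynomial.monomial (R + S) 1 :
    MvPolynomial ℕ (ZMod p)) = MvPolynomial.monomial R 1 * MvPolynomial.monomial S 1 := by
  rw [MvPolynomial.monomial_mul, one_mul]

theorem monomial_induction {P : (ℕ →₀ ℕ) → Prop} (h0 : P 0)
    (hadd : ∀ R S, P R → P S → P (R + S)) (hX : ∀ k, P (Finsupp.single k 1)) (R : ℕ →₀ ℕ) : P R := by
  induction R using Finsupp.induction_linear with
  | zero => exact h0
  | add R S hR hS => exact hadd R S hR hS
  | single k r =>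
    induction r with
    | zero => rw [Finsupp.single_zero]; exact h0
    | succ r ih => rw [Finsupp.single_add]; exact hadd _ _ ih (hX k)

theorem shift_single_succ (k : ℕ) : shift (Finsupp.single (k + 1) 1) = Finsupp.single k 1 := by
  ext n
  simp [Finsupp.single_apply]

theorem shift_single_zero : shift (Finsupp.single 0 1) = 0 := by
  ext n
  simp

/-- The top term of the image of `ζ_k` is `t^{q^{k-1}} ζ_{k-1}`, and top terms multiply. This is the
source of triangularity. -/
theorem lowerHom_monomial (hq : 1 ≤ q) (S : ℕ →₀ ℕ) :
    (lowerHom p q (MvPolynomial.monomial S 1)).natDegree ≤ top q S ∧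
      (lowerHom p q (MvPolynomial.monomial S 1)).coeff (top q S) =
        MvPolynomial.monomial (shift S) 1 := by
  induction S using monomial_induction with
  | h0 => simp [show (MvPolynomial.monomial (0 : ℕ →₀ ℕ) (1 : ZMod p)) = 1 from rfl]
  | hadd R S hR hS =>
    rw [monomial_add_one, map_mul, top_add, shift_add, monomial_add_one]
    exact ⟨Polynomial.natDegree_mul_le_of_le hR.1 hS.1, by
      rw [Polynomial.coeff_mul_add_eq_of_natDegree_le hR.1 hS.1, hR.2, hS.2]⟩
  | hX k =>
    change (lowerHom p q (MvPolynomial.X k)).natDegree ≤ _ ∧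
      (lowerHom p q (MvPolynomial.X k)).coeff _ = _
    have hpos : q ^ k ≠ 0 := (Nat.pow_pos hq).ne'
    rw [lowerHom_X, top_single, one_mul]
    constructor
    · refine Polynomial.natDegree_add_le_of_degree_le (by simp) ?_
      rw [mul_comm]
      exact Polynomial.natDegree_C_mul_X_pow_le _ _
    · rw [Polynomial.coeff_add, Polynomial.coeff_C, if_neg hpos, zero_add, Polynomial.coeff_mul_C,
        Polynomial.coeff_X_pow_self, one_mul]
      cases k with
      | zero => rw [if_pos rfl, shift_single_zero]; rfl
      | succ k => rw [if_neg k.succ_ne_zero, shift_single_succ]; rfl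

theorem genDegree_succ (q k : ℕ) : genDegree q (k + 1) = q ^ (k + 1) + genDegree q k := by
  rw [genDegree, Finset.sum_range_succ, add_comm]; rfl

/-- With `t` in degree `1` and the variable in position `k` in degree `genDegree q k`, the map
preserves degree, by the recursion `genDegree_succ`. -/
theorem lowerHom_monomial_homogeneous (S : ℕ →₀ ℕ) (a : ℕ) (T : ℕ →₀ ℕ)
    (h : ((lowerHom p q (MvPolynomial.monomial S 1)).coeff a).coeff T ≠ 0) :
    a + degree q T = degree q S := by
  induction S using monomial_induction generalizing a T with
  | h0 =>
    rw [show (MvPolynomial.monomial (0 : ℕ →₀ ℕ) (1 : ZMod p)) = 1 from rfl, map_one,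
      Polynomial.coeff_one] at h
    split_ifs at h with ha
    · rw [MvPolynomial.coeff_one] at h
      have : T = 0 := by by_contra h0; exact h (if_neg (Ne.symm h0))
      simp [ha, this]
    · simp at h
  | hadd R S hR hS =>
    rw [monomial_add_one, map_mul, Polynomial.coeff_mul, MvPolynomial.coeff_sum] at h
    obtain ⟨⟨i, j⟩, hij, h⟩ := Finset.exists_ne_zero_of_sum_ne_zero h
    rw [MvPolynomial.coeff_mul] at h
    obtain ⟨⟨U, V⟩, hUV, h⟩ := Finset.exists_ne_zero_of_sum_ne_zero h
    have h1 := hR i U (left_ne_zero_of_mul h)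
    have h2 := hS j V (right_ne_zero_of_mul h)
    rw [Finset.HasAntidiagonal.mem_antidiagonal] at hij hUV
    rw [degree_add, ← hij, ← hUV, degree_add]
    simp only at h1 h2 ⊢
    omega
  | hX k =>
    change ((lowerHom p q (MvPolynomial.X k)).coeff a).coeff T ≠ 0 at h
    rw [lowerHom_X, Polynomial.coeff_add, Polynomial.coeff_C, Polynomial.coeff_mul_C,
      Polynomial.coeff_X_pow, MvPolynomial.coeff_add] at h
    have hX : ∀ k, (MvPolynomial.X k : MvPolynomial ℕ (ZMod p)).coeff T ≠ 0 →
        T = Finsupp.single k 1 := by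
      intro k h
      rw [MvPolynomial.coeff_X] at h
      by_contra h0
      exact h (if_neg (Ne.symm h0))
    rcases ne_or_ne_of_add_ne_zero h with h | h
    · split_ifs at h with ha
      · rw [hX k h, ha, zero_add]
      · simp at h
    · by_cases ha : a = q ^ k
      · rw [if_pos ha, one_mul] at h
        rw [ha, degree_single, one_mul]
        cases k with
        | zero =>
          rw [if_pos rfl, MvPolynomial.coeff_one] at h
          have : T = 0 := by by_contra h0; exact h (if_neg (Ne.symm h0))
          simp [this, genDegree]
        | succ k =>
          rw [if_neg k.succ_ne_zero] at h
          rw [hX k h, degree_single, one_mul, genDegree_succ]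
      · simp [ha] at h

theorem pairing_one (e : ℕ) (S : ℕ →₀ ℕ) (he : 1 ≤ e) :
    pairing p e 1 S = if S = 0 then 1 else 0 := by
  have h : pairing p e 1 S = (milnorP p 0).1 (mono p (spread e S)) := by
    rw [milnorP_zero, ← embed_monomial he]; rfl
  rw [h, milnorP_mono]
  refine if_congr ?_ rfl rfl
  have h0 : spread e 0 = 0 := Finsupp.mapDomain_zero
  constructor
  · intro h; exact spread_injective he (h.symm.trans h0.symm)
  · rintro rfl; exact h0.symm

theorem pairing_prod_milnorPower (hq : q = p ^ e) (he : 1 ≤ e) (l : List ℕ) (S : ℕ →₀ ℕ)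
    (h : pairing p e (l.map (milnorPower p he)).prod S ≠ 0) : degree q S = l.sum := by
  induction l generalizing S with
  | nil =>
    rw [List.map_nil, List.prod_nil, pairing_one e S he] at h
    have : S = 0 := by by_contra h0; exact h (if_neg h0)
    simp [this]
  | cons a l ih =>
    rw [List.map_cons, List.prod_cons, pairing_milnorPower_mul hq he, MvPolynomial.as_sum
      ((lowerHom p q (MvPolynomial.monomial S 1)).coeff a), map_sum] at h
    obtain ⟨T, hT, h⟩ := Finset.exists_ne_zero_of_sum_ne_zero h
    have h1 := lowerHom_monomial_homogeneous S a T (MvPolynomial.mem_support_iff.mp hT)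
    rw [← mul_one (MvPolynomial.coeff T _), ← smul_eq_mul, ← MvPolynomial.smul_monomial, map_smul,
      smul_eq_mul] at h
    rw [List.sum_cons, ← h1, ih T (right_ne_zero_of_mul h)]

theorem pairing_adm_degree (hq : q = p ^ e) (he : 1 ≤ e) {R S : ℕ →₀ ℕ}
    (h : pairing p e (adm q (milnorPower p he) R) S ≠ 0) : degree q S = degree q R :=
  (pairing_prod_milnorPower hq he _ S h).trans (sum_word fun _ => apply_eq_zero_of_len_le)

theorem pairing_milnorPower_mul_of_lt (hq : q = p ^ e) (he : 1 ≤ e) {r : ℕ} {S : ℕ →₀ ℕ}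
    (h : top q S < r) (f : milnorSubalgebra p e) :
    pairing p e (milnorPower p he r * f) S = 0 := by
  have hq1 : 1 ≤ q := hq ▸ one_le_pow e
  rw [pairing_milnorPower_mul hq he, Polynomial.coeff_eq_zero_of_natDegree_lt
    ((lowerHom_monomial hq1 S).1.trans_lt h), map_zero]

theorem pairing_milnorPower_top_mul (hq : q = p ^ e) (he : 1 ≤ e) (S : ℕ →₀ ℕ)
    (f : milnorSubalgebra p e) :
    pairing p e (milnorPower p he (top q S) * f) S = pairing p e f (shift S) := by
  have hq1 : 1 ≤ q := hq ▸ one_le_pow e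
  rw [pairing_milnorPower_mul hq he, (lowerHom_monomial hq1 S).2]
  rfl

theorem pairing_adm_self (hq : q = p ^ e) (he : 1 ≤ e) (R : ℕ →₀ ℕ) :
    pairing p e (adm q (milnorPower p he) R) R = 1 := by
  suffices ∀ n (R : ℕ →₀ ℕ), (∀ k, n ≤ k → R k = 0) →
      pairing p e (adm q (milnorPower p he) R) R = 1 from
    this _ R fun _ => apply_eq_zero_of_len_le
  intro n
  induction n with
  | zero =>
    intro R hR
    have : R = 0 := by ext k; exact hR k (Nat.zero_le k)
    rw [this, adm_zero, pairing_one e 0 he, if_pos rfl]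
  | succ n ih =>
    intro R hR
    rw [adm_eq_mul (milnorPower_zero he), pairing_milnorPower_top_mul hq he]
    exact ih _ fun k hk => hR (k + 1) (by omega)

/-- Common initial entries of the two words are stripped by extracting top coefficients. At the
first difference the required power of `t` exceeds the degree in `t`. -/
theorem pairing_adm_eq_zero (hq : q = p ^ e) (he : 1 ≤ e) (n : ℕ) {R S : ℕ →₀ ℕ}
    (heq : ∀ m < n, top q (shift^[m] S) = top q (shift^[m] R))
    (hlt : top q (shift^[n] S) < top q (shift^[n] R)) :
    pairing p e (adm q (milnorPower p he) R) S = 0 := by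
  induction n generalizing R S with
  | zero => 
    rw [adm_eq_mul (milnorPower_zero he)]
    exact pairing_milnorPower_mul_of_lt hq he hlt _
  | succ n ih =>
    have h0 : top q S = top q R := heq 0 (Nat.succ_pos n)
    rw [adm_eq_mul (milnorPower_zero he), ← h0, pairing_milnorPower_top_mul hq he]
    exact ih (fun m hm => heq (m + 1) (by omega)) hlt

theorem iterate_shift_apply_zero (n : ℕ) (R : ℕ →₀ ℕ) : (shift^[n] R) 0 = R n := by
  suffices ∀ k, (shift^[n] R) k = R (n + k) from this 0
  induction n generalizing R with
  | zero => intro k; rw [zero_add]; rfl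
  | succ n ih => intro k; rw [Function.iterate_succ_apply, ih, shift_apply]; congr 1; ring

/-- The admissible word attached to `R`, in the lexicographic order. -/
def lexWord (q : ℕ) (R : ℕ →₀ ℕ) : Lex (ℕ → ℕ) := toLex fun n => top q (shift^[n] R)

/-- By `top_eq`, consecutive entries of the word determine the exponents. -/
theorem lexWord_injective (q : ℕ) : Function.Injective (lexWord q) := by
  intro R S h
  have h : ∀ n, top q (shift^[n] R) = top q (shift^[n] S) := congrFun (toLex.injective h)
  ext n
  have h1 := top_eq q (shift^[n] R)
  have h2 := top_eq q (shift^[n] S)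
  have h3 := h (n + 1)
  rw [Function.iterate_succ_apply', Function.iterate_succ_apply'] at h3
  rw [h n, h2, h3, iterate_shift_apply_zero, iterate_shift_apply_zero] at h1
  omega

/-- In a linear relation, take the lexicographically least word with nonzero coefficient: its own
monomial `ζ^{R₀}` pairs to `1` with it and to `0` with the other terms. -/
theorem linearIndependent_adm_milnorPower (hq : q = p ^ e) (he : 1 ≤ e) :
    LinearIndependent (ZMod p) (adm q (milnorPower p he)) := by
  rw [linearIndependent_iff']
  intro s g hg
  by_contra! hne
  obtain ⟨R, hRs, hR⟩ := hne
  obtain ⟨R₀, hR₀, hmin⟩ := Finset.exists_min_image (s.filter fun R => g R ≠ 0) (lexWord q)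
    ⟨R, Finset.mem_filter.mpr ⟨hRs, hR⟩⟩
  rw [Finset.mem_filter] at hR₀
  have h := congrFun (congrArg (pairing p e) hg) R₀
  rw [map_sum, Finset.sum_apply, Finset.sum_eq_single R₀, map_smul, Pi.smul_apply,
    pairing_adm_self hq he, smul_eq_mul, mul_one, map_zero, Pi.zero_apply] at h
  · exact hR₀.2 h
  · intro S hS hne
    rw [map_smul, Pi.smul_apply]
    by_cases hgS : g S = 0
    · rw [hgS, zero_smul]
    · have hlt : lexWord q R₀ < lexWord q S := lt_of_le_of_ne
        (hmin S (Finset.mem_filter.mpr ⟨hS, hgS⟩)) fun h => hne (lexWord_injective q h).symm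
      obtain ⟨n, heq, hlt⟩ := hlt
      rw [pairing_adm_eq_zero hq he n heq hlt, smul_zero]
  · exact fun h => absurd hR₀.1 h

variable (p) in
/-- The part of degree `d` of `A'_q`. -/
def milnorDegree (e q d : ℕ) : Submodule (ZMod p) (milnorSubalgebra p e) where
  carrier := {f | ∀ S, pairing p e f S ≠ 0 → degree q S = d}
  zero_mem' S h := absurd (by rw [map_zero]; rfl) h
  add_mem' {f g} hf hg S h := by
    rw [map_add, Pi.add_apply] at h
    rcases ne_or_ne_of_add_ne_zero h with h | h
    · exact hf S h
    · exact hg S h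
  smul_mem' c f hf S h := by
    rw [map_smul, Pi.smul_apply, smul_eq_mul] at h
    exact hf S (right_ne_zero_of_mul h)

/-- A dimension count: the pairing embeds the degree `d` part into functions on the finite set of
exponents of degree `d`, and that part contains equally many independent admissible monomials. -/
theorem milnorDegree_le_span (hq : q = p ^ e) (he : 1 ≤ e) (d : ℕ) :
    milnorDegree p e q d ≤ Submodule.span (ZMod p) (Set.range (adm q (milnorPower p he))) := by
  have hq1 : 1 ≤ q := hq ▸ one_le_pow e
  let s : Set (ℕ →₀ ℕ) := {R | degree q R = d}
  have hs : Finite s := (finite_degree_eq hq1 d).to_subtype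
  have : Fintype s := Fintype.ofFinite s
  let φ : milnorDegree p e q d →ₗ[ZMod p] (s → ZMod p) :=
    LinearMap.funLeft (ZMod p) (ZMod p) ((↑) : s → ℕ →₀ ℕ) ∘ₗ pairing p e ∘ₗ
      (milnorDegree p e q d).subtype
  have hφ : Function.Injective φ := by
    rw [injective_iff_map_eq_zero]
    intro f hf
    apply Subtype.ext
    apply pairing_injective he
    ext S
    rw [Submodule.coe_zero, map_zero, Pi.zero_apply]
    by_contra h
    exact h (congrFun hf ⟨S, f.2 S h⟩)
  have : FiniteDimensional (ZMod p) (milnorDegree p e q d) := FiniteDimensional.of_injective φ hφ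
  let v : s → milnorDegree p e q d := fun R =>
    ⟨adm q (milnorPower p he) R, fun S hS => (pairing_adm_degree hq he hS).trans R.2⟩
  have hv : LinearIndependent (ZMod p) v :=
    LinearIndependent.of_comp (milnorDegree p e q d).subtype
      ((linearIndependent_adm_milnorPower hq he).comp _ Subtype.val_injective)
  have hcard : Fintype.card s = Module.finrank (ZMod p) (milnorDegree p e q d) :=
    le_antisymm hv.fintype_card_le_finrank
      ((LinearMap.finrank_le_finrank_of_injective hφ).trans_eq (by simp))
  have htop := hv.span_eq_top_of_card_eq_finrank' hcard
  intro f hf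
  have h : (⟨f, hf⟩ : milnorDegree p e q d) ∈ Submodule.span (ZMod p) (Set.range v) := by
    rw [htop]; trivial
  have h1 := Submodule.mem_map_of_mem (f := (milnorDegree p e q d).subtype) h
  rw [Submodule.map_span] at h1
  refine Submodule.span_mono ?_ h1
  rintro _ ⟨_, ⟨R, rfl⟩, rfl⟩
  exact ⟨R, rfl⟩

theorem span_adm_milnorPower (hq : q = p ^ e) (he : 1 ≤ e) :
    Submodule.span (ZMod p) (Set.range (adm q (milnorPower p he))) = ⊤ := by
  refine eq_top_iff.mpr ?_
  rintro ⟨f, hf⟩ -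
  suffices h : f ∈ (Submodule.span (ZMod p) (Set.range (adm q (milnorPower p he)))).map
      (milnorSubalgebra p e).val.toLinearMap by
    obtain ⟨g, hg, rfl⟩ := h
    exact hg
  refine Submodule.span_le.mpr ?_ hf
  rintro _ ⟨R, hR, rfl⟩
  refine ⟨⟨milnorP p R, Submodule.subset_span ⟨R, hR, rfl⟩⟩, ?_, rfl⟩
  obtain ⟨S, rfl⟩ := (supportedOn_iff he R).mp hR
  -- A Milnor basis element is dual to a single monomial, hence homogeneous.
  refine milnorDegree_le_span hq he (degree q S) fun T hT => ?_
  have h : (milnorP p (spread e S)).1 (mono p (spread e T)) ≠ 0 := by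
    rw [← embed_monomial he]; exact hT
  rw [milnorP_mono] at h
  by_contra hne
  exact h (if_neg fun h0 => hne (by rw [spread_injective he h0]))

/-- The basis of `A'_q` of admissible monomials. -/
def admBasis (hq : q = p ^ e) (he : 1 ≤ e) :
    Module.Basis (ℕ →₀ ℕ) (ZMod p) (milnorSubalgebra p e) :=
  Module.Basis.mk (linearIndependent_adm_milnorPower hq he) (span_adm_milnorPower hq he).ge

end

/-! ### The isomorphism `ρ` -/

section Iso

variable {p : ℕ} [Fact p.Prime] {e q : ℕ}

theorem algebraMap_ademCoeff (k K : Type*) [CommRing k] [CommRing K] [Algebra k K] (q a b j : ℕ) :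
    algebraMap k K (ademCoeff k q a b j) = ademCoeff K q a b j := by
  simp [ademCoeff]

/-- The Adem coefficients are images of integers, hence compatible with extension of scalars. -/
theorem IsAdem.extendScalars {k A : Type*} (K : Type*) [CommRing k] [CommRing K] [Algebra k K]
    [Ring A] [Algebra k A] [Algebra K A] [IsScalarTower k K A] {x : ℕ → A}
    (h : IsAdem k q x) : IsAdem K q x where
  zero := h.zero
  mul_eq a b hab := by
    rw [h.mul_eq a b hab]
    refine Finset.sum_congr rfl fun j _ => ?_
    rw [← algebraMap_ademCoeff k K, algebraMap_smul]

variable (K : Type*) [Field K] [Algebra (ZMod p) K]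

theorem isAdem_tmul_milnorPower (hq : q = p ^ e) (he : 1 ≤ e) :
    IsAdem K q fun r => (1 : K) ⊗ₜ[ZMod p] milnorPower p he r :=
  ((isAdem_milnorPower hq he).map (Algebra.TensorProduct.includeRight :
    milnorSubalgebra p e →ₐ[ZMod p] K ⊗[ZMod p] milnorSubalgebra p e)).extendScalars K

/-- The map `P^r ↦ 1 ⊗ P_e^r`. -/
def rhoHom (hq : q = p ^ e) (he : 1 ≤ e) :
    SteenrodPowers K q →ₐ[K] K ⊗[ZMod p] milnorSubalgebra p e :=
  SteenrodPowers.lift (isAdem_tmul_milnorPower K hq he)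

theorem rhoHom_adm (hq : q = p ^ e) (he : 1 ≤ e) (R : ℕ →₀ ℕ) :
    rhoHom K hq he (adm q (SteenrodPowers.P K q) R) =
      (admBasis hq he).baseChange K R := by
  rw [Module.Basis.baseChange_apply, admBasis, Module.Basis.mk_apply, map_adm]
  simp only [rhoHom, SteenrodPowers.lift_P]
  exact (map_adm (Algebra.TensorProduct.includeRight :
    milnorSubalgebra p e →ₐ[ZMod p] K ⊗[ZMod p] milnorSubalgebra p e) R).symm

/-- Independence is pulled back from the target, where the images form the base change of
`admBasis`. -/
theorem linearIndependent_adm (hq : q = p ^ e) (he : 1 ≤ e) :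
    LinearIndependent K (adm q (SteenrodPowers.P K q)) := by
  refine LinearIndependent.of_comp (rhoHom K hq he).toLinearMap ?_
  have h := ((admBasis hq he).baseChange K).linearIndependent
  rwa [← funext (rhoHom_adm K hq he)] at h

/-- The basis of `A_q` of admissible monomials. -/
def powersBasis (hq : q = p ^ e) (he : 1 ≤ e) :
    Module.Basis (ℕ →₀ ℕ) K (SteenrodPowers K q) :=
  Module.Basis.mk (linearIndependent_adm K hq he) SteenrodPowers.span_adm.ge

theorem powersBasis_apply (hq : q = p ^ e) (he : 1 ≤ e) (R : ℕ →₀ ℕ) :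
    powersBasis K hq he R = adm q (SteenrodPowers.P K q) R := Module.Basis.mk_apply _ _ _

theorem rhoHom_bijective (hq : q = p ^ e) (he : 1 ≤ e) : Function.Bijective (rhoHom K hq he) := by
  have h : (rhoHom K hq he).toLinearMap = ((powersBasis K hq he).equiv
      ((admBasis hq he).baseChange K) (Equiv.refl _)).toLinearMap := by
    refine (powersBasis K hq he).ext fun R => ?_
    rw [LinearEquiv.coe_coe, Module.Basis.equiv_apply, powersBasis_apply]
    exact rhoHom_adm K hq he R
  have h1 : ⇑(rhoHom K hq he) = ((powersBasis K hq he).equiv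
      ((admBasis hq he).baseChange K) (Equiv.refl _)) := congrArg DFunLike.coe h
  rw [h1]
  exact LinearEquiv.bijective _

/-- The isomorphism `P^r ↦ 1 ⊗ P_e^r`. -/
def rho (hq : q = p ^ e) (he : 1 ≤ e) :
    SteenrodPowers K q ≃ₐ[K] K ⊗[ZMod p] milnorSubalgebra p e :=
  AlgEquiv.ofBijective (rhoHom K hq he) (rhoHom_bijective K hq he)

theorem rho_P (hq : q = p ^ e) (he : 1 ≤ e) (r : ℕ) :
    rho K hq he (SteenrodPowers.P K q r) = 1 ⊗ₜ[ZMod p] milnorPower p he r :=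
  SteenrodPowers.lift_P _ r

theorem milnorSubalgebra_one : milnorSubalgebra p 1 = ⊤ := by
  refine eq_top_iff.mpr fun f _ => ?_
  change f ∈ milnorSpan p 1
  induction f using milnor_induction with
  | h0 => exact zero_mem _
  | hadd f g hf hg => exact add_mem (hf trivial) (hg trivial)
  | hsmul c f hf => exact Submodule.smul_mem _ c (hf trivial)
  | hP R => exact Submodule.subset_span ⟨R, fun n _ => one_dvd _, rfl⟩

theorem exists_equiv_steenrodAlgebra : ∃ φ : SteenrodPowers (ZMod p) p ≃ₐ[ZMod p] SteenrodAlgebra p,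
    ∀ r, φ (SteenrodPowers.P (ZMod p) p r) = milnorP p (Finsupp.single 0 r) := by
  -- The case `e = 1` over `𝔽_p`: the scalar extension is trivial and `A'_p` is all of `A_p`.
  refine ⟨(rho (ZMod p) (pow_one p).symm le_rfl).trans ((Algebra.TensorProduct.lid _ _).trans
    ((Subalgebra.equivOfEq _ _ milnorSubalgebra_one).trans Subalgebra.topEquiv)), fun r => ?_⟩
  rw [AlgEquiv.trans_apply, rho_P, AlgEquiv.trans_apply, Algebra.TensorProduct.lid_tmul, one_smul]
  rfl

end Iso

/-! ### Transport of Hopf algebra structures -/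

section Transport

variable {K A B : Type*} [Field K] [Ring A] [Algebra K A] [Ring B] [HopfAlgebra K B]

/-- The coproduct transported along an isomorphism of algebras. -/
def transportComul (φ : A ≃ₐ[K] B) : A →ₐ[K] A ⊗[K] A :=
  (Algebra.TensorProduct.map φ.symm.toAlgHom φ.symm.toAlgHom).comp
    ((Bialgebra.comulAlgHom K B).comp φ.toAlgHom)

theorem transportComul_apply (φ : A ≃ₐ[K] B) (x : A) : transportComul φ x =
    Algebra.TensorProduct.map φ.symm.toAlgHom φ.symm.toAlgHom
      (Coalgebra.comul (R := K) (φ x)) := rfl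

theorem map_transportComul (φ : A ≃ₐ[K] B) (x : A) :
    Algebra.TensorProduct.map φ.toAlgHom φ.toAlgHom (transportComul φ x) =
      Coalgebra.comul (R := K) (φ x) := by
  rw [transportComul_apply]
  induction Coalgebra.comul (R := K) (φ x) with
  | zero => simp
  | add a b ha hb => rw [map_add, map_add, ha, hb]
  | tmul a b => simp

/-- The Hopf algebra structure transported along an isomorphism of algebras. -/
def HopfStructure.transport (φ : A ≃ₐ[K] B) : HopfStructure K A where
  comul := transportComul φ
  counit := (Bialgebra.counitAlgHom K B).comp φ.toAlgHom
  antipode := φ.symm.toLinearMap ∘ₗ HopfAlgebra.antipode K ∘ₗ φ.toLinearMap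
  coassoc := by
    apply AlgHom.ext; intro x
    -- Both composites are images under `φ⁻¹ ⊗ φ⁻¹ ⊗ φ⁻¹` of the two sides of coassociativity in
    -- `B`.
    have h1 : ∀ t : B ⊗[K] B, (Algebra.TensorProduct.assoc K K K A A A)
        (Algebra.TensorProduct.map (transportComul φ) (.id K A)
          (Algebra.TensorProduct.map φ.symm.toAlgHom φ.symm.toAlgHom t)) =
        Algebra.TensorProduct.map φ.symm.toAlgHom
          (Algebra.TensorProduct.map φ.symm.toAlgHom φ.symm.toAlgHom)
          (TensorProduct.assoc K B B B ((Coalgebra.comul (R := K)).rTensor B t)) := by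
      intro t
      induction t with
      | zero => simp
      | add a b ha hb => simp only [map_add, ha, hb]
      | tmul a b =>
        simp only [Algebra.TensorProduct.map_tmul, AlgHom.id_apply, LinearMap.rTensor_tmul,
          transportComul_apply]
        rw [show φ (φ.symm.toAlgHom a) = a from φ.apply_symm_apply a]
        induction Coalgebra.comul (R := K) a with
        | zero => simp
        | add c d hc hd => simp only [TensorProduct.add_tmul, map_add, hc, hd]
        | tmul c d => rfl
    have h2 : ∀ t : B ⊗[K] B, Algebra.TensorProduct.map (.id K A) (transportComul φ)
          (Algebra.TensorProduct.map φ.symm.toAlgHom φ.symm.toAlgHom t) =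
        Algebra.TensorProduct.map φ.symm.toAlgHom
          (Algebra.TensorProduct.map φ.symm.toAlgHom φ.symm.toAlgHom)
          ((Coalgebra.comul (R := K)).lTensor B t) := by
      intro t
      induction t with
      | zero => simp
      | add a b ha hb => simp only [map_add, ha, hb]
      | tmul a b =>
        simp only [Algebra.TensorProduct.map_tmul, AlgHom.id_apply, LinearMap.lTensor_tmul,
          transportComul_apply]
        rw [show φ (φ.symm.toAlgHom b) = b from φ.apply_symm_apply b]
    refine (h1 _).trans (Eq.trans ?_ (h2 _).symm)
    exact congrArg _ (Coalgebra.coassoc_apply (R := K) (φ x))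
  counit_left := by
    apply AlgHom.ext; intro x
    apply (Algebra.TensorProduct.lid K A).injective
    apply φ.injective
    have h : ∀ t : A ⊗[K] A, φ (Algebra.TensorProduct.lid K A (Algebra.TensorProduct.map
        ((Bialgebra.counitAlgHom K B).comp φ.toAlgHom) (.id K A) t)) =
        TensorProduct.lid K B ((Coalgebra.counit (R := K)).rTensor B
          (Algebra.TensorProduct.map φ.toAlgHom φ.toAlgHom t)) := by
      intro t
      induction t with
      | zero => simp
      | add x y hx hy => simp only [map_add, hx, hy]
      | tmul a b => simp
    refine (h (transportComul φ x)).trans ?_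
    rw [map_transportComul, Coalgebra.rTensor_counit_comul]
    simp
  counit_right := by
    apply AlgHom.ext; intro x
    apply (Algebra.TensorProduct.rid K K A).injective
    apply φ.injective
    have h : ∀ t : A ⊗[K] A, φ (Algebra.TensorProduct.rid K K A (Algebra.TensorProduct.map
        (.id K A) ((Bialgebra.counitAlgHom K B).comp φ.toAlgHom) t)) =
        TensorProduct.rid K B ((Coalgebra.counit (R := K)).lTensor B
          (Algebra.TensorProduct.map φ.toAlgHom φ.toAlgHom t)) := by
      intro t
      induction t with
      | zero => simp
      | add x y hx hy => simp only [map_add, hx, hy]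
      | tmul a b => simp
    refine (h (transportComul φ x)).trans ?_
    rw [map_transportComul, Coalgebra.lTensor_counit_comul]
    simp
  antipode_left := by
    apply LinearMap.ext; intro x
    apply φ.injective
    have h : ∀ t : A ⊗[K] A, φ (LinearMap.mul' K A ((φ.symm.toLinearMap ∘ₗ
        HopfAlgebra.antipode K ∘ₗ φ.toLinearMap).rTensor A t)) =
        LinearMap.mul' K B ((HopfAlgebra.antipode K).rTensor B
          (Algebra.TensorProduct.map φ.toAlgHom φ.toAlgHom t)) := by
      intro t
      induction t with
      | zero => simp
      | add x y hx hy => simp only [map_add, hx, hy]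
      | tmul a b => simp
    refine (h (transportComul φ x)).trans ?_
    rw [map_transportComul, HopfAlgebra.mul_antipode_rTensor_comul_apply]
    simp
  antipode_right := by
    apply LinearMap.ext; intro x
    apply φ.injective
    have h : ∀ t : A ⊗[K] A, φ (LinearMap.mul' K A ((φ.symm.toLinearMap ∘ₗ
        HopfAlgebra.antipode K ∘ₗ φ.toLinearMap).lTensor A t)) =
        LinearMap.mul' K B ((HopfAlgebra.antipode K).lTensor B
          (Algebra.TensorProduct.map φ.toAlgHom φ.toAlgHom t)) := by
      intro t
      induction t with
      | zero => simp
      | add x y hx hy => simp only [map_add, hx, hy]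
      | tmul a b => simp
    refine (h (transportComul φ x)).trans ?_
    rw [map_transportComul, HopfAlgebra.mul_antipode_lTensor_comul_apply]
    simp

/-- The isomorphism is one of bialgebras for the transported structure. -/
def transportEquiv (φ : A ≃ₐ[K] B) :
    letI := (HopfStructure.transport φ).toHopfAlgebra
    A ≃ₐc[K] B :=
  letI := (HopfStructure.transport φ).toHopfAlgebra
  BialgEquiv.ofAlgEquiv φ rfl (AlgHom.ext fun x => map_transportComul φ x)

theorem transport_comul (φ : A ≃ₐ[K] B) (x : A) :
    (HopfStructure.transport φ).comul x = transportComul φ x := rfl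

theorem transportEquiv_apply (φ : A ≃ₐ[K] B) :
    letI := (HopfStructure.transport φ).toHopfAlgebra
    ∀ x, transportEquiv φ x = φ x := fun _ => rfl

theorem transportEquiv_antipode (φ : A ≃ₐ[K] B) :
    letI := (HopfStructure.transport φ).toHopfAlgebra
    ∀ x, transportEquiv φ (HopfAlgebra.antipode K x) =
      HopfAlgebra.antipode K (transportEquiv φ x) :=
  fun _ => φ.apply_symm_apply _

end Transport

/-! ### The Hopf algebra structure of `A_q` -/

section Hopf

variable {p : ℕ} [Fact p.Prime] {e q : ℕ}

/-- A sequence concentrated in one position decomposes only into sequences concentrated there. The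
equality can be tested in `A_p ⊗ A_p`, the inclusion being injective on tensor squares. -/
theorem comul_milnorPower (he : 1 ≤ e) (r : ℕ) :
    Coalgebra.comul (R := ZMod p) (milnorPower p he r) =
      ∑ x ∈ Finset.HasAntidiagonal.antidiagonal r,
        milnorPower p he x.1 ⊗ₜ[ZMod p] milnorPower p he x.2 := by
  apply IsHopfSubalgebra.map_val_injective (milnorSubalgebra p e)
  refine ((isHopfSubalgebra_milnorSubalgebra e).map_comul _).trans ?_
  rw [milnorPower_val, comul_milnorP, map_sum, Finsupp.antidiagonal_single, Finset.sum_map]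
  rfl

theorem comul_one_tmul {k C ι : Type*} (K : Type*) [Field k] [Field K] [Algebra k K] [Ring C]
    [HopfAlgebra k C] {c : C} {s : Finset ι} {f g : ι → C}
    (h : Coalgebra.comul (R := k) c = ∑ i ∈ s, f i ⊗ₜ[k] g i) :
    Coalgebra.comul (R := K) ((1 : K) ⊗ₜ[k] c) =
      ∑ i ∈ s, ((1 : K) ⊗ₜ[k] f i) ⊗ₜ[K] ((1 : K) ⊗ₜ[k] g i) := by
  rw [TensorProduct.comul_tmul, h, TensorProduct.tmul_sum, map_sum]
  rfl

variable (K : Type*) [Field K] [Algebra (ZMod p) K]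

theorem transportComul_rho_P (hq : q = p ^ e) (he : 1 ≤ e) (r : ℕ) :
    transportComul (rho K hq he) (SteenrodPowers.P K q r) =
      ∑ x ∈ Finset.HasAntidiagonal.antidiagonal r,
        SteenrodPowers.P K q x.1 ⊗ₜ[K] SteenrodPowers.P K q x.2 := by
  rw [transportComul_apply, rho_P, comul_one_tmul K (comul_milnorPower he r), map_sum]
  refine Finset.sum_congr rfl fun x _ => ?_
  rw [Algebra.TensorProduct.map_tmul, ← rho_P K hq he, ← rho_P K hq he]
  exact congrArg₂ (· ⊗ₜ[K] ·) ((rho K hq he).symm_apply_apply _)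
    ((rho K hq he).symm_apply_apply _)

/-- The Hopf algebra structure of `A_q` and the isomorphism with `A'_q ⊗ K`. -/
theorem exists_hopfStructure (hq : q = p ^ e) (he : 1 ≤ e) :
    ∃ H : HopfStructure K (SteenrodPowers K q),
      (∀ r, H.comul (SteenrodPowers.P K q r) =
        ∑ x ∈ Finset.HasAntidiagonal.antidiagonal r,
          SteenrodPowers.P K q x.1 ⊗ₜ[K] SteenrodPowers.P K q x.2) ∧
      letI := H.toHopfAlgebra
      ∃ ρ : SteenrodPowers K q ≃ₐc[K] K ⊗[ZMod p] milnorSubalgebra p e,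
        (∀ r, ρ (SteenrodPowers.P K q r) = 1 ⊗ₜ[ZMod p] milnorPower p he r) ∧
        ∀ x, ρ (HopfAlgebra.antipode K x) = HopfAlgebra.antipode K (ρ x) := by
  refine ⟨HopfStructure.transport (rho K hq he), fun r => ?_, ?_⟩
  · rw [transport_comul]
    exact transportComul_rho_P K hq he r
  · refine ⟨transportEquiv (rho K hq he), fun r => ?_, ?_⟩
    · refine (transportEquiv_apply (rho K hq he) _).trans ?_
      exact rho_P K hq he r
    · exact transportEquiv_antipode (rho K hq he)

end Hopf

/-! ### Generators -/

/-- The sequence `1, 0, …, 0, ε, 0, …` with `ε` in position `p ^ k` of the dual numbers. -/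
def epsilonSeq (K : Type*) [Field K] (p k r : ℕ) : DualNumber K :=
  if r = 0 then 1 else if r = p ^ k then DualNumber.eps else 0

theorem epsilonSeq_mul (K : Type*) [Field K] {p : ℕ} (k : ℕ) {a b : ℕ} (ha : a ≠ 0) (hb : b ≠ 0) :
    epsilonSeq K p k a * epsilonSeq K p k b = 0 := by
  simp only [epsilonSeq, if_neg ha, if_neg hb]
  split_ifs <;> simp

section Generators

variable {p : ℕ} [Fact p.Prime] {e q : ℕ} (K : Type*) [Field K] [Algebra (ZMod p) K]

/-- Products of two terms of positive index vanish since `ε² = 0`. For `a, b > 0` there remains the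
`j = 0` term of each relation, and its coefficient must be zero when `a + b = p ^ k`. -/
theorem isAdem_epsilonSeq (hq : q = p ^ e) (he : 1 ≤ e) (k : ℕ) :
    IsAdem K q (epsilonSeq K p k) where
  zero := if_pos rfl
  mul_eq a b hab := by
    have hb : b ≠ 0 := by rintro rfl; simp at hab
    have h1 : ∀ j ∈ Finset.range (a / q + 1), j ≠ 0 →
        ademCoeff K q a b j • (epsilonSeq K p k (a + b - j) * epsilonSeq K p k j) = 0 := by
      intro j hj h0
      have := IsAdem.lt_of_le_div hab (Nat.lt_succ_iff.mp (Finset.mem_range.mp hj))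
      rw [epsilonSeq_mul K k (by omega) h0, smul_zero]
    have h2 : epsilonSeq K p k 0 = 1 := if_pos rfl
    rw [Finset.sum_eq_single_of_mem 0 (by simp) h1, Nat.sub_zero, h2, mul_one]
    by_cases ha : a = 0
    · subst ha
      simp [h2, ademCoeff]
    · rw [epsilonSeq_mul K k ha hb]
      by_cases hk : a + b = p ^ k
      -- Modulo `p`, the inner binomials `C(p^k, j)` vanish, so the identity collapses to `0 =
      -- ademCoeff (ZMod p) q a b 0`.
      · have h3 := choose_eq_sum hq he hab
        have hdvd : ∀ j, j ≠ 0 → j ≠ p ^ k → (((p ^ k).choose j : ℕ) : ZMod p) = 0 :=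
          fun j h0 h1 => (ZMod.natCast_eq_zero_iff _ _).mpr
            ((Fact.out : p.Prime).dvd_choose_pow h0 h1)
        rw [hk, hdvd b hb (by omega), Finset.sum_eq_single_of_mem 0 (by simp)] at h3
        · have h4 : ademCoeff K q a b 0 = 0 := by
            rw [← algebraMap_ademCoeff (ZMod p) K]
            rw [Nat.choose_zero_right, Nat.cast_one, mul_one] at h3
            rw [ademCoeff, ← h3, map_zero]
          rw [h4, zero_smul]
        · intro j hj h0
          have := IsAdem.lt_of_le_div hab (Nat.lt_succ_iff.mp (Finset.mem_range.mp hj))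
          rw [hdvd j h0 (by omega), mul_zero]
      · rw [epsilonSeq, if_neg (by omega), if_neg hk, smul_zero]

/-- For `r = a + p^k` with `p^k` the largest power of `p` below `r` and `a > 0`, the relation for
`P^a P^{p^k}` has `P^r` as its `j = 0` term, with coefficient nonzero by `choose_ne_zero_of_lt`. All
other factors have index less than `r`. -/
theorem P_mem_adjoin (hq : q = p ^ e) (he : 1 ≤ e) (r : ℕ) : SteenrodPowers.P K q r ∈
    Algebra.adjoin K (Set.range fun j : ℕ => SteenrodPowers.P K q (p ^ j)) := by
  have hp : p.Prime := Fact.out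
  have hp2 := hp.two_le
  have hq2 : p ≤ q := hq ▸ Nat.le_self_pow (by omega) p
  induction r using Nat.strong_induction_on with
  | _ r ih =>
    rcases Nat.eq_zero_or_pos r with rfl | hr
    · rw [(SteenrodPowers.isAdem_P K q).zero]; exact one_mem _
    · let k := Nat.log p r
      have hk1 : p ^ k ≤ r := Nat.pow_log_le_self p hr.ne'
      have hk2 : r < p ^ (k + 1) := Nat.lt_pow_succ_log_self hp.one_lt r
      obtain ⟨a, ha⟩ := Nat.exists_eq_add_of_le' hk1
      rcases Nat.eq_zero_or_pos a with rfl | ha0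
      · exact Algebra.subset_adjoin ⟨k, by rw [ha, zero_add]⟩
      · have hpk : 0 < p ^ k := Nat.pow_pos hp.pos
        have hlt : a < (p - 1) * p ^ k := by
          have : (p - 1) * p ^ k + p ^ k = p ^ (k + 1) := by
            obtain ⟨c, rfl⟩ : ∃ c, p = c + 1 := ⟨p - 1, by omega⟩
            rw [Nat.add_sub_cancel]; ring
          omega
        have hab : a < q * p ^ k :=
          hlt.trans_le (Nat.mul_le_mul_right _ (by omega))
        have h1 := (SteenrodPowers.isAdem_P K q).mul_eq a (p ^ k) hab
        rw [Finset.sum_range_succ', ← ha, Nat.sub_zero, (SteenrodPowers.isAdem_P K q).zero,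
          mul_one] at h1
        have hc : ademCoeff K q a (p ^ k) 0 ≠ 0 := by
          rw [← algebraMap_ademCoeff (ZMod p) K, Ne, FaithfulSMul.algebraMap_eq_zero_iff, ademCoeff,
            Nat.sub_zero, mul_zero, Nat.sub_zero]
          exact mul_ne_zero (pow_ne_zero _ (neg_ne_zero.mpr one_ne_zero))
            (choose_ne_zero_of_lt hq he k a hlt)
        have h2 := sub_mem (mul_mem (ih a (by omega))
            (Algebra.subset_adjoin (R := K)
              (⟨k, rfl⟩ : SteenrodPowers.P K q (p ^ k) ∈ Set.range fun j : ℕ =>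
                SteenrodPowers.P K q (p ^ j))))
          (sum_mem fun j (hj : j ∈ Finset.range (a / q)) =>
            Subalgebra.smul_mem _ (mul_mem (ih (r - (j + 1)) (by omega))
              (ih (j + 1) (by
                have := Finset.mem_range.mp hj
                have := Nat.div_le_self a q
                omega))) (ademCoeff K q a (p ^ k) (j + 1)))
        rw [h1, add_sub_cancel_left] at h2
        have h3 := Subalgebra.smul_mem _ h2 (ademCoeff K q a (p ^ k) 0)⁻¹
        rwa [smul_smul, inv_mul_cancel₀ hc, one_smul] at h3

theorem minimal_generators (hq : q = p ^ e) (he : 1 ≤ e) :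
    Minimal (fun S : Set (SteenrodPowers K q) => Algebra.adjoin K S = ⊤)
      (Set.range fun j : ℕ => SteenrodPowers.P K q (p ^ j)) := by
  have hp : p.Prime := Fact.out
  constructor
  · refine eq_top_iff.mpr fun y _ => ?_
    have h := SteenrodPowers.mem_span_prod y
    refine (Submodule.span_le (p := Subalgebra.toSubmodule (Algebra.adjoin K
      (Set.range fun j : ℕ => SteenrodPowers.P K q (p ^ j))))).mpr ?_ h
    rintro _ ⟨l, rfl⟩
    change (l.map _).prod ∈ Algebra.adjoin K _
    refine list_prod_mem fun z hz => ?_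
    obtain ⟨r, _, rfl⟩ := List.mem_map.mp hz
    exact P_mem_adjoin K hq he r
  · rintro S hS hle _ ⟨k, rfl⟩
    by_contra hk
    -- If `P^{p^k}` is omitted, `δ` kills all remaining generators, so its image would be `K`; yet
    -- `δ` sends `P^{p^k}` to `ε`.
    let δ := SteenrodPowers.lift (isAdem_epsilonSeq K hq he k)
    have h0 : ∀ y ∈ S, δ y ∈ (⊥ : Subalgebra K (DualNumber K)) := by
      intro y hy
      obtain ⟨j, rfl⟩ := hle hy
      have hj : p ^ j ≠ p ^ k := fun h => hk (by
        change SteenrodPowers.P K q (p ^ k) ∈ S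
        rw [← h]; exact hy)
      have : δ (SteenrodPowers.P K q (p ^ j)) = 0 := by
        rw [SteenrodPowers.lift_P, epsilonSeq, if_neg (Nat.pow_pos hp.pos).ne', if_neg hj]
      change δ (SteenrodPowers.P K q (p ^ j)) ∈ _
      rw [this]; exact zero_mem _
    have h1 : Algebra.adjoin K S ≤ (⊥ : Subalgebra K (DualNumber K)).comap δ :=
      Algebra.adjoin_le h0
    have hS : Algebra.adjoin K S = ⊤ := hS
    rw [hS] at h1
    have h2 : δ (SteenrodPowers.P K q (p ^ k)) ∈ (⊥ : Subalgebra K (DualNumber K)) := h1 trivial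
    rw [SteenrodPowers.lift_P, epsilonSeq, if_neg (Nat.pow_pos hp.pos).ne', if_pos rfl,
      Algebra.mem_bot] at h2
    obtain ⟨c, hc⟩ := h2
    have h3 := congrArg TrivSqZeroExt.snd hc
    rw [DualNumber.snd_eps, TrivSqZeroExt.algebraMap_eq_inl, TrivSqZeroExt.snd_inl] at h3
    exact zero_ne_one h3

end Generators

/-! ### The grading and the Poincaré series -/

theorem finite_homogeneous (K : Type*) [Field K] {q : ℕ} (hq : 1 ≤ q) (d : ℕ) :
    Module.Finite K (SteenrodPowers.homogeneous K q d) := by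
  rw [SteenrodPowers.homogeneous_eq]
  exact FiniteDimensional.span_of_finite K
    ((finite_degree_eq hq d).image _)

section Grading

variable {p : ℕ} [Fact p.Prime] {e q : ℕ} (K : Type*) [Field K] [Algebra (ZMod p) K]

instance (q : ℕ) : SetLike.GradedMonoid (SteenrodPowers.homogeneous K q) where
  one_mem := Submodule.subset_span ⟨[], rfl, rfl⟩
  mul_mem i j x y hx hy := by
    have h := Submodule.mul_mem_mul hx hy
    rw [SteenrodPowers.homogeneous, SteenrodPowers.homogeneous, Submodule.span_mul_span] at h
    refine Submodule.span_mono ?_ h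
    rintro _ ⟨_, ⟨l, rfl, rfl⟩, _, ⟨l', rfl, rfl⟩, rfl⟩
    exact ⟨l ++ l', by simp, by simp⟩

theorem adm_mem_homogeneous (q : ℕ) (R : ℕ →₀ ℕ) : adm q (SteenrodPowers.P K q) R ∈
    SteenrodPowers.homogeneous K q (degree q R) := by
  rw [SteenrodPowers.homogeneous_eq]
  exact Submodule.subset_span ⟨R, rfl, rfl⟩

/-- The decomposition of `A_q` into its homogeneous components. -/
def decomposeHom (hq : q = p ^ e) (he : 1 ≤ e) :
    SteenrodPowers K q →ₗ[K] DirectSum ℕ fun d => SteenrodPowers.homogeneous K q d :=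
  (powersBasis K hq he).constr K fun R => DirectSum.lof K ℕ
    (fun d => SteenrodPowers.homogeneous K q d) (degree q R) ⟨_, adm_mem_homogeneous K q R⟩

theorem decomposeHom_adm (hq : q = p ^ e) (he : 1 ≤ e) (R : ℕ →₀ ℕ) :
    decomposeHom K hq he (adm q (SteenrodPowers.P K q) R) = DirectSum.lof K ℕ
      (fun d => SteenrodPowers.homogeneous K q d) (degree q R) ⟨_, adm_mem_homogeneous K q R⟩ := by
  have h := (powersBasis K hq he).constr_basis K (fun R => DirectSum.lof K ℕ
    (fun d => SteenrodPowers.homogeneous K q d) (degree q R) ⟨_, adm_mem_homogeneous K q R⟩) R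
  rwa [powersBasis_apply] at h

theorem decomposeHom_of_mem (hq : q = p ^ e) (he : 1 ≤ e) {d : ℕ} {y : SteenrodPowers K q}
    (hy : y ∈ SteenrodPowers.homogeneous K q d) : decomposeHom K hq he y =
      DirectSum.lof K ℕ (fun d => SteenrodPowers.homogeneous K q d) d ⟨y, hy⟩ := by
  have hy' := hy
  rw [SteenrodPowers.homogeneous_eq] at hy'
  induction hy' using Submodule.span_induction with
  | mem y h =>
    obtain ⟨R, rfl, rfl⟩ := h
    exact decomposeHom_adm K hq he R
  | zero =>
    rw [map_zero]
    exact (map_zero (DirectSum.lof K ℕ (fun d => SteenrodPowers.homogeneous K q d) d)).symm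
  | add y z hy' hz' ihy ihz =>
    rw [← SteenrodPowers.homogeneous_eq] at hy' hz'
    rw [map_add, ihy hy', ihz hz', ← map_add]
    rfl
  | smul c y hy' ihy =>
    rw [← SteenrodPowers.homogeneous_eq] at hy'
    rw [map_smul, ihy hy', ← map_smul]
    rfl

theorem nonempty_gradedAlgebra (hq : q = p ^ e) (he : 1 ≤ e) :
    Nonempty (GradedAlgebra (SteenrodPowers.homogeneous K q)) := by
  have h1 : DirectSum.coeLinearMap (SteenrodPowers.homogeneous K q) ∘ₗ decomposeHom K hq he =
      .id := by
    refine (powersBasis K hq he).ext fun R => ?_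
    rw [powersBasis_apply, LinearMap.comp_apply, decomposeHom_adm]
    exact DirectSum.coeLinearMap_lof (SteenrodPowers.homogeneous K q) (degree q R) _
  have h2 : decomposeHom K hq he ∘ₗ DirectSum.coeLinearMap (SteenrodPowers.homogeneous K q) =
      .id := by
    refine DirectSum.linearMap_ext K fun d => LinearMap.ext fun y => ?_
    rw [LinearMap.comp_apply, LinearMap.comp_apply, DirectSum.coeLinearMap_lof]
    exact decomposeHom_of_mem K hq he y.2
  exact ⟨{ (inferInstance : SetLike.GradedMonoid (SteenrodPowers.homogeneous K q)),
    DirectSum.Decomposition.ofLinearMap (SteenrodPowers.homogeneous K q)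
      (decomposeHom K hq he) h1 h2 with }⟩

theorem finrank_homogeneous (hq : q = p ^ e) (he : 1 ≤ e) (d : ℕ) :
    Module.finrank K (SteenrodPowers.homogeneous K q d) = {R | degree q R = d}.ncard := by
  have : Fintype {R | degree q R = d} :=
    (finite_degree_eq (hq ▸ MilnorDual.one_le_pow e) d).fintype
  have h := (linearIndependent_adm K hq he).comp ((↑) : {R | degree q R = d} → ℕ →₀ ℕ)
    Subtype.val_injective
  rw [SteenrodPowers.homogeneous_eq, Set.image_eq_range, ← Nat.card_coe_set_eq,
    Nat.card_eq_fintype_card]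
  exact finrank_span_eq_card h

end Grading

section Poincare

open PowerSeries
open scoped PowerSeries.WithPiTopology

theorem coeff_inv_one_sub_X_pow {F : Type*} [Field F] {n : ℕ} (hn : 1 ≤ n) (d : ℕ) :
    coeff d ((1 - (X : F⟦X⟧) ^ n)⁻¹) = if n ∣ d then 1 else 0 := by
  have h : (PowerSeries.mk fun d => if n ∣ d then (1 : F) else 0) = (1 - (X : F⟦X⟧) ^ n)⁻¹ := by
    rw [PowerSeries.eq_inv_iff_mul_eq_one (by simp [show n ≠ 0 by omega])]
    ext d
    rw [mul_sub, mul_one, map_sub, coeff_mul_X_pow', coeff_mk, coeff_one]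
    rcases Nat.eq_zero_or_pos d with rfl | hd
    · rw [if_pos (dvd_zero n), if_neg (by omega), if_pos rfl, sub_zero]
    · rw [if_neg (show d ≠ 0 by omega)]
      rcases le_or_gt n d with hnd | hnd
      · rw [if_pos hnd, coeff_mk]
        simp only [Nat.dvd_sub_iff_left hnd dvd_rfl, sub_self]
      · rw [if_neg (show ¬ n ≤ d by omega), if_neg fun h => by
          have := Nat.le_of_dvd hd h
          omega, sub_zero]
  rw [← h, coeff_mk]

/-- The generating function of the number of exponent sequences of given weighted degree. -/
theorem hasProd_inv_one_sub_X_pow {m : ℕ → ℕ} (hm : ∀ k, k + 1 ≤ m k) :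
    HasProd (fun k => (1 - (X : ℚ⟦X⟧) ^ m k)⁻¹)
      (PowerSeries.mk fun d => ({R : ℕ →₀ ℕ | (R.sum fun k r => r * m k) = d}.ncard : ℚ)) := by
  rw [HasProd, WithPiTopology.tendsto_iff_coeff_tendsto]
  -- Factors with `k ≥ d` have `m k > d` and do not affect the coefficient of degree `d`, which is
  -- constant once all `k < d` are included.
  refine fun d => tendsto_atTop_of_eventually_const (i₀ := Finset.range d) fun s hs => ?_
  rw [coeff_mk, coeff_prod]
  simp only [coeff_inv_one_sub_X_pow (le_trans (Nat.le_add_left 1 _) (hm _)), Finset.prod_ite_zero,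
    Finset.prod_const_one, Finset.sum_boole]
  norm_cast
  rw [← Set.ncard_coe_finset]
  symm
  have hle : ∀ (R : ℕ →₀ ℕ) (k : ℕ), R k * m k ≤ R.sum fun k r => r * m k := fun R k => by
    by_cases hk : R k = 0
    · simp [hk]
    · exact Finset.single_le_sum (f := fun k => R k * m k) (fun _ _ => Nat.zero_le _)
        (Finsupp.mem_support_iff.mpr hk)
  have hsupp : ∀ R : ℕ →₀ ℕ, (R.sum fun k r => r * m k) = d → R.support ⊆ s := by
    intro R hR k hk
    refine hs (Finset.mem_range.mpr ?_)
    have h1 := hle R k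
    have h2 : 1 ≤ R k := Nat.one_le_iff_ne_zero.mpr (Finsupp.mem_support_iff.mp hk)
    have h3 := hm k
    nlinarith
  have hdiv : ∀ k, 0 < m k := fun k => by have := hm k; omega
  -- A monomial chosen from each geometric series has exponents `R k * m k`, and `R` is recovered by
  -- division.
  refine Set.ncard_congr (fun R _ => Finsupp.onFinset R.support (fun k => R k * m k)
    fun k hk => Finsupp.mem_support_iff.mpr (left_ne_zero_of_mul hk)) ?_ ?_ ?_
  · intro R hR
    have hR : (R.sum fun k r => r * m k) = d := hR
    simp only [Finset.coe_filter, Set.mem_ofPred_eq, Finset.mem_finsuppAntidiag,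
      Finsupp.onFinset_apply]
    refine ⟨⟨?_, ?_⟩, fun k _ => dvd_mul_left _ _⟩
    · rw [← hR, Finsupp.sum]
      refine (Finset.sum_subset (hsupp R hR) fun k _ hk => ?_).symm
      rw [Finsupp.onFinset_apply, Finsupp.notMem_support_iff.mp hk, zero_mul]
    · exact Finsupp.support_onFinset_subset.trans (hsupp R hR)
  · intro R S _ _ h
    ext k
    have := DFunLike.congr_fun h k
    exact Nat.eq_of_mul_eq_mul_right (hdiv k) this
  · intro l hl
    simp only [Finset.coe_filter, Set.mem_ofPred_eq, Finset.mem_finsuppAntidiag] at hl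
    obtain ⟨⟨hsum, hls⟩, hdvd⟩ := hl
    have hdvd' : ∀ k, l k / m k * m k = l k := fun k => by
      by_cases hk : k ∈ s
      · exact Nat.div_mul_cancel (hdvd k hk)
      · have : l k = 0 := Finsupp.notMem_support_iff.mp fun h => hk (hls h)
        simp [this]
    refine ⟨Finsupp.onFinset l.support (fun k => l k / m k) fun k hk =>
      Finsupp.mem_support_iff.mpr fun h => hk (by rw [h, Nat.zero_div]), ?_, ?_⟩
    · change Finsupp.sum _ _ = d
      rw [Finsupp.onFinset_sum _ (fun k => zero_mul _)]
      simp only [hdvd']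
      rw [← hsum]
      refine Finset.sum_subset hls fun k _ hk => Finsupp.notMem_support_iff.mp hk
    · ext k
      exact hdvd' k

end Poincare

end Steenrod

end

theorem proposition2p10 (p : ℕ) [Fact p.Prime] (e : ℕ) (he : 1 ≤ e) :
    -- for `q = p` the presented algebra is `A_p`, with `P^r` the Milnor basis element `P(r)`
    (∃ φ : Steenrod.SteenrodPowers (ZMod p) p ≃ₐ[ZMod p] Steenrod.SteenrodAlgebra p,
      ∀ r, φ (Steenrod.SteenrodPowers.P (ZMod p) p r) =
        Steenrod.milnorP p (Finsupp.single 0 r)) ∧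
    -- the Hopf algebra isomorphism `ρ`
    (∃ H : Steenrod.HopfStructure (GaloisField p e)
        (Steenrod.SteenrodPowers (GaloisField p e) (p ^ e)),
      (∀ r, H.comul (Steenrod.SteenrodPowers.P (GaloisField p e) (p ^ e) r) =
        ∑ x ∈ Finset.HasAntidiagonal.antidiagonal r,
          Steenrod.SteenrodPowers.P (GaloisField p e) (p ^ e) x.1 ⊗ₜ[GaloisField p e]
            Steenrod.SteenrodPowers.P (GaloisField p e) (p ^ e) x.2) ∧
      letI := H.toHopfAlgebra
      ∃ ρ : Steenrod.SteenrodPowers (GaloisField p e) (p ^ e) ≃ₐc[GaloisField p e]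
          GaloisField p e ⊗[ZMod p] Steenrod.milnorSubalgebra p e,
        (∀ r, ρ (Steenrod.SteenrodPowers.P (GaloisField p e) (p ^ e) r) =
          1 ⊗ₜ[ZMod p] Steenrod.milnorPower p he r) ∧
        ∀ x, ρ (HopfAlgebra.antipode (GaloisField p e) x) =
          HopfAlgebra.antipode (GaloisField p e) (ρ x)) ∧
    -- the `P^{p^j}` form a minimal generating set
    Minimal (fun S : Set (Steenrod.SteenrodPowers (GaloisField p e) (p ^ e)) =>
        Algebra.adjoin (GaloisField p e) S = ⊤)
      (Set.range fun j : ℕ => Steenrod.SteenrodPowers.P (GaloisField p e) (p ^ e) (p ^ j)) ∧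
    -- the grading and the Poincaré series
    Nonempty (GradedAlgebra (Steenrod.SteenrodPowers.homogeneous (GaloisField p e) (p ^ e))) ∧
    (∀ d, Module.Finite (GaloisField p e)
      (Steenrod.SteenrodPowers.homogeneous (GaloisField p e) (p ^ e) d)) ∧
    HasProd (fun j : ℕ =>
        (1 - (PowerSeries.X : PowerSeries ℚ) ^ (((p ^ e) ^ (j + 1) - 1) / (p ^ e - 1)))⁻¹)
      (PowerSeries.mk fun d => (Module.finrank (GaloisField p e)
        (Steenrod.SteenrodPowers.homogeneous (GaloisField p e) (p ^ e) d) : ℚ)) := by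
  refine ⟨Steenrod.exists_equiv_steenrodAlgebra,
    Steenrod.exists_hopfStructure (GaloisField p e) rfl he,
    Steenrod.minimal_generators (GaloisField p e) rfl he,
    Steenrod.nonempty_gradedAlgebra (GaloisField p e) rfl he,
    Steenrod.finite_homogeneous (GaloisField p e) (Steenrod.MilnorDual.one_le_pow e), ?_⟩
  -- The bound `q ≥ 2` identifies the quotient `(q^{j+1} - 1)/(q - 1)` with the geometric sum
  -- `genDegree q j`.
  have hq2 : 2 ≤ p ^ e := (Nat.Prime.two_le Fact.out).trans (Nat.le_self_pow (by omega) p)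
  simp only [Steenrod.finrank_homogeneous (GaloisField p e) rfl he, ← Nat.geomSum_eq hq2]
  exact Steenrod.hasProd_inv_one_sub_X_pow
    (Steenrod.succ_le_genDegree (le_trans one_le_two hq2))
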